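/- Let $N\ge 1$, $q\in\mathbb C\setminus\{0,1,-1\}$, $t=q^2$, $p\in\mathbb C\setminus\{0\}$, $V=\mathbb C^2=\mathbb C\!\uparrow\oplus\,\mathbb C\!\downarrow$ and $\mathcal H=V^{\otimes N}$. **Conventions.** On $\mathbb C[z]=\mathbb C[z_1,\dots,z_N]$ put $T_i^{\mathrm{pol}}=-q^{-1}(t z_i-z_{i+1})\,\frac{1-s_i}{z_i-z_{i+1}}+q$ for $1\le i\le N-1$, where $s_i$ exchanges $z_i$ and $z_{i+1}$, let $(\pi F)(z_1,\dots,z_N)=F(p z_N,z_1,\dots,z_{N-1})$, and $$Y_i=T^{\mathrm{pol}}_i\cdots T^{\mathrm{pol}}_{N-1}\,\pi\,(T^{\mathrm{pol}}_1)^{-1}\cdots(T^{\mathrm{pol}}_{i-1})^{-1},\qquad 1\le i\le N .$$ In the basis $\uparrow\uparrow,\uparrow\downarrow,\downarrow\uparrow,\downarrow\downarrow$ of $V\otimes V$ let $$T^{\mathrm{sp}}=\begin{pmatrix}q&&&\\&q-q^{-1}&1&\\&1&0&\\&&&q\end{pmatrix},\qquad \check R(u)=\frac1{tu-1}\begin{pmatrix}tu-1&&&\\&(t-1)u&q(u-1)&\\&q(u-1)&t-1&\\&&&tu-1\end{pmatrix},\qquad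 R(u)=P\check R(u),$$ with $P$ the permutation of the two factors. Subscripts give the tensor factors in which an operator acts. The *physical space* is $\widetilde{\mathcal H}=\bigcap_{i=1}^{N-1}\ker(T^{\mathrm{sp}}_{i,i+1}-T^{\mathrm{pol}}_i)\subset\mathcal H\otimes\mathbb C[z]$. The *spin-Macdonald operators* are $\widetilde D_r=e_r(Y_1,\dots,Y_N)$ and $\widetilde D_{-r}=e_r(Y_1^{-1},\dots,Y_N^{-1})$, where $r\ge 0$ and $e_r$ is the elementary symmetric polynomial. With an auxiliary space $V_a\cong V$, the *monodromy matrix* is $$\widetilde L_a(u)=R_{aN}(uY_N)\cdots R_{a1}(uY_1),$$ understood through its expansions in powers of $u$ at $u=0$ and of $u^{-1}$ at $u=\infty$; the *modes* are the coefficients of the entries of these expansions as $2\times 2$ matrices in $V_a$. The algebra $U_q(L\mathfrak{gl}_2)$ is the unital associative $\mathbb C$-algebra generated by the modes of $L^+(u)=\sum_{n\ge0}u^nL^+_n$ and $L^-(u)=\sum_{n\ge0}u^{-n}L^-_n$ ($2\times2$ matrices of generators), subject to the relations $$R_{ab}(u/v)\,L_a(u)\,L_b(v)=L_b(v)\,L_a(u)\,R_{ab}(u/v)$$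 (the *RLL-relations*, multiplied by the scalar denominator of $R_{ab}(u/v)$) for each choice of $L(u)\in\{L^{+}(u),L^-(u)\}$ and $L(v)\in\{L^+(v),L^-(v)\}$, together with $(L_0^+)_{21}=0=(L_0^-)_{12}$ and $(L^+_0)_{\alpha\alpha}(L_0^-)_{\alpha\alpha}=1=(L_0^-)_{\alpha\alpha}(L^+_0)_{\alpha\alpha}$ for $\alpha=1,2$. **(I)** For every $p\ne0$ the following hold. 1. Each $Y_i$ is invertible, and so are the denominators $tuY_i-1$ (expanded at $u=0$, and, after division by $u$, at $u=\infty$), so that $\widetilde L_a(u)$ is well defined. In both expansions, with $T^{\mathrm{sp}}_0=T^{\mathrm{sp}}_{a1}$, $T^{\mathrm{sp}}_i=T^{\mathrm{sp}}_{i,i+1}$ and $P_{(a1\cdots N)}$ the cyclic permutation of tensor factors $a\to1\to\cdots\to N\to a$, $$\prod_{i=1}^N(1-tuY_i)\;\widetilde L_a(u)=(-q)^N\,P_{(a1\cdots N)}\bigl(u\,T^{\mathrm{sp}}_{N-1}Y_N-(T_{N-1}^{\mathrm{sp}})^{-1}\bigr)\cdots\bigl(u\,T^{\mathrm{sp}}_0Y_1-(T^{\mathrm{sp}}_0)^{-1}\bigr).$$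 2. $\widetilde L_a(u)$ satisfies the RLL-relations on $\mathcal H\otimes\mathbb C[z]$. 3. All modes of $\widetilde L_a(u)$, and all spin-Macdonald operators $\widetilde D_{\pm r}$, preserve the physical space $\widetilde{\mathcal H}$. 4. Sending the generators of $U_q(L\mathfrak{gl}_2)$ to the corresponding modes of $\widetilde L_a(u)$ defines an action of $U_q(L\mathfrak{gl}_2)$ on $\widetilde{\mathcal H}$, and this action commutes with all spin-Macdonald operators $\widetilde D_{\pm r}$. **(II)** Suppose moreover that $q^{2N}\neq1$. Let $\mathrm{ev}:\mathcal H\otimes\mathbb C[z]\to\mathcal H$ be the evaluation $z_j\mapsto\omega^j$, $\omega=e^{2\pi\mathrm i/N}$, and let $\widetilde L_a^\circ(u)$ be $\widetilde L_a(u)$ at $p=1$. Then the following hold. 1. $\mathrm{ev}(\widetilde{\mathcal H})=\mathcal H$. 2. $L_a(u)\,\mathrm{ev}\Psi=\mathrm{ev}\bigl(\widetilde L^\circ_a(u)\Psi\bigr)$ for $\Psi\in\widetilde{\mathcal H}$ gives a well-defined operator $L_a(u)$ on $V_a\otimes\mathcal H$. It satisfies the RLL-relations, and its modes define an action of $U_q(L\mathfrak{gl}_2)$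 on $\mathcal H$. 3. This action commutes with the abelian symmetries of the spin chain. These are, firstly, the Hamiltonians $H_r$, $1\le r\le N$, which exist and are uniquely determined by $$(q-q^{-1})\,H_r\,\mathrm{ev}\Psi=\partial_p\big|_{p=1}\,\mathrm{ev}\Bigl(\widetilde D_r\Psi-\tfrac rN\genfrac{[}{]}{0pt}{}{N}{r}_{q}\,\widetilde D_N\Psi\Bigr)\qquad(\Psi\in\widetilde{\mathcal H}),$$ where $\genfrac{[}{]}{0pt}{}{N}{r}_q$ is the Gaussian binomial coefficient normalised to be invariant under $q\mapsto q^{-1}$; and, secondly, the $q$-translation operator $G=\check R_{N-1,N}(\omega^{1-N})\cdots\check R_{23}(\omega^{1-3})\,\check R_{12}(\omega^{1-2})$. -/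

import Mathlib

open scoped PowerSeries Kronecker

noncomputable section

namespace SpinRuijsenaars

/-! ## Polynomials, divided differences, the basic representation -/

/-- Spin configurations of a chain with `N` sites, `0` standing for `↑` and `1` for `↓`;
they label the standard basis of `(ℂ²)^{⊗N}`. -/
abbrev Config (N : ℕ) : Type := Fin N → Fin 2

/-- The spin-chain Hilbert space `(ℂ²)^{⊗N}`, a vector being given by its components. -/
abbrev SpinSpace (N : ℕ) : Type := Config N → ℂ

/-- `ℂ[z₁, …, z_N]`. -/
abbrev Pol (N : ℕ) : Type := MvPolynomial (Fin N) ℂ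

/-- `(ℂ²)^{⊗N} ⊗ ℂ[z₁, …, z_N]`, a vector being given by its spin components. -/
abbrev BigSpace (N : ℕ) : Type := Config N → Pol N

variable {N : ℕ}

/-- The transposition `z_i ↔ z_j`. -/
def swapVars (i j : Fin N) : Pol N →ₐ[ℂ] Pol N := MvPolynomial.rename (Equiv.swap i j)

theorem sub_dvd_sub_swapVars (i j : Fin N) (F : Pol N) :
    (MvPolynomial.X i - MvPolynomial.X j : Pol N) ∣ F - swapVars i j F := by
  induction F using MvPolynomial.induction_on with
  | C a => simp [swapVars]
  | add F G hF hG =>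
    have h : F + G - swapVars i j (F + G) = (F - swapVars i j F) + (G - swapVars i j G) := by
      rw [map_add]; ring
    rw [h]; exact dvd_add hF hG
  | mul_X F k hF =>
    have hX : (MvPolynomial.X i - MvPolynomial.X j : Pol N) ∣
        MvPolynomial.X k - swapVars i j (MvPolynomial.X k) := by
      simp only [swapVars, MvPolynomial.rename_X]
      by_cases hi : k = i
      · subst hi; simp
      · by_cases hj : k = j
        · subst hj
          rw [Equiv.swap_apply_right]
          exact ⟨-1, by ring⟩
        · rw [Equiv.swap_apply_of_ne_of_ne hi hj]; simp
    have h : F * MvPolynomial.X k - swapVars i j (F * MvPolynomial.X k)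
        = (F - swapVars i j F) * MvPolynomial.X k
          + swapVars i j F * (MvPolynomial.X k - swapVars i j (MvPolynomial.X k)) := by
      rw [map_mul]; ring
    rw [h]
    exact dvd_add (hF.mul_right _) (hX.mul_left _)

theorem X_sub_X_ne_zero {i j : Fin N} (h : i ≠ j) :
    (MvPolynomial.X i - MvPolynomial.X j : Pol N) ≠ 0 :=
  sub_ne_zero.2 fun e => h (MvPolynomial.X_injective e)

/-- The divided difference `(z_i - z_j)⁻¹ (1 - s_{ij})`, for `i ≠ j`. -/
def divDiff (i j : Fin N) : Pol N →ₗ[ℂ] Pol N :=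
  if h : i ≠ j then
    { toFun := fun F => (sub_dvd_sub_swapVars i j F).choose
      map_add' := fun F G => by
        apply mul_left_cancel₀ (X_sub_X_ne_zero h)
        rw [mul_add, ← (sub_dvd_sub_swapVars i j F).choose_spec,
          ← (sub_dvd_sub_swapVars i j G).choose_spec,
          ← (sub_dvd_sub_swapVars i j (F + G)).choose_spec, map_add]
        ring
      map_smul' := fun c F => by
        apply mul_left_cancel₀ (X_sub_X_ne_zero h)
        rw [RingHom.id_apply, mul_smul_comm, ← (sub_dvd_sub_swapVars i j F).choose_spec,
          ← (sub_dvd_sub_swapVars i j (c • F)).choose_spec, map_smul, smul_sub] }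
  else 0

theorem mul_divDiff {i j : Fin N} (h : i ≠ j) (F : Pol N) :
    (MvPolynomial.X i - MvPolynomial.X j) * divDiff i j F = F - swapVars i j F := by
  rw [divDiff, dif_pos h]
  exact (sub_dvd_sub_swapVars i j F).choose_spec.symm

/-- The Demazure–Lusztig operator `-t^{-1/2} (t z_i - z_j) ∂_{ij} + t^{1/2}`, where `t^{1/2} = q`;
the Hecke generators are the case `j = i + 1`. -/
def Tpol (q : ℂ) (i j : Fin N) : Module.End ℂ (Pol N) :=
  (-q⁻¹) • (LinearMap.mulLeft ℂ (MvPolynomial.C (q ^ 2) * MvPolynomial.X i - MvPolynomial.X j)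
    * divDiff i j) + q • 1

/-- The inverse of `Tpol q i j`, by the Hecke condition. -/
def TpolInv (q : ℂ) (i j : Fin N) : Module.End ℂ (Pol N) :=
  Tpol q i j - (q - q⁻¹) • 1

/-- The twisted cyclic shift `(π F)(z₁, …, z_N) = F(p z_N, z₁, …, z_{N-1})`. The subtraction
`j - 1` is the cyclic one of `Fin N`. -/
def piOp [NeZero N] (p : ℂ) : Module.End ℂ (Pol N) :=
  (MvPolynomial.aeval fun j : Fin N =>
    if j = 0 then MvPolynomial.C p * (MvPolynomial.X (j - 1) : Pol N)
    else MvPolynomial.X (j - 1)).toLinearMap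

/-- The affine generators `Y_i = T_i ⋯ T_{N-1} π T_1⁻¹ ⋯ T_{i-1}⁻¹` (difference parameter `p`). -/
def Y [NeZero N] (q p : ℂ) (i : Fin N) : Module.End ℂ (Pol N) :=
  (((List.finRange N).filter fun k => i ≤ k ∧ (k : ℕ) + 1 < N).map fun k => Tpol q k (k + 1)).prod
    * piOp p
    * (((List.finRange N).filter fun k => k < i).map fun k => TpolInv q k (k + 1)).prod

/-- `e_r(y) = ∑_{i₁ < ⋯ < i_r} y_{i₁} ⋯ y_{i_r}`. -/
def esymmOp {A : Type*} [Ring A] (y : Fin N → A) (r : ℕ) : A :=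
  ∑ S ∈ Finset.powersetCard r (Finset.univ : Finset (Fin N)), ((S.sort (· ≤ ·)).map y).prod

/-! ## Spin operators and the `R`-matrix -/

section TwoSite

variable {A : Type*} [Ring A] {m : ℕ}

/-- The operator on `(ℂ²)^{⊗m}` that acts by the `4 × 4` matrix `M` in the (ordered) tensor
factors `i`, `j`, and by the identity elsewhere. -/
def twoSite (i j : Fin m) (M : Matrix (Fin 2 × Fin 2) (Fin 2 × Fin 2) A) :
    Matrix (Config m) (Config m) A :=
  Matrix.of fun σ τ =>
    if ∀ k, k ≠ i → k ≠ j → σ k = τ k then M (σ i, σ j) (τ i, τ j) else 0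

/-- The spin Hecke generator `T^sp`. -/
def Tsp (q : ℂ) : Matrix (Fin 2 × Fin 2) (Fin 2 × Fin 2) ℂ :=
  Matrix.of fun x y =>
    if x = y then (if x = (0, 1) then q - q⁻¹ else if x = (1, 0) then 0 else q)
    else if x = y.swap then 1 else 0

/-- The inverse of `T^sp`, by the Hecke condition. -/
def TspInv (q : ℂ) : Matrix (Fin 2 × Fin 2) (Fin 2 × Fin 2) ℂ :=
  Tsp q - (q - q⁻¹) • 1

variable [Algebra ℂ A]

/-- The denominator of the `R`-matrix at `u = a / b`, namely `t a - b`, where `t = q²`. -/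
def Rden (q : ℂ) (a b : A) : A := q ^ 2 • a - b

/-- `t a - b` times the braid-form `R`-matrix `Ř(u)` at `u = a / b`. Here
`(t u - 1) Ř(u)` has entries `t u - 1` at `↑↑` and `↓↓`, and the middle block
`((t - 1) u, t^{1/2} (u - 1); t^{1/2} (u - 1), t - 1)`. -/
def RcheckNum (q : ℂ) (a b : A) : Matrix (Fin 2 × Fin 2) (Fin 2 × Fin 2) A :=
  Matrix.of fun x y =>
    if x = y then
      (if x = (0, 1) then (q ^ 2 - 1) • a else if x = (1, 0) then (q ^ 2 - 1) • b else Rden q a b)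
    else if x = y.swap then q • (a - b) else 0

/-- `t a - b` times `R(a / b) = P Ř(a / b)`, with `P` the permutation of the two factors. -/
def Rnum (q : ℂ) (a b : A) : Matrix (Fin 2 × Fin 2) (Fin 2 × Fin 2) A :=
  Matrix.of fun x y => RcheckNum q a b x.swap y

/-- `R(a / b) = P Ř(a / b)`, for commuting `a`, `b` such that `t a - b` is invertible. -/
def Rmat (q : ℂ) (a b : A) : Matrix (Fin 2 × Fin 2) (Fin 2 × Fin 2) A :=
  Matrix.of fun x y => Ring.inverse (Rden q a b) * Rnum q a b x y

/-- `R_{aN}(u y_N) ⋯ R_{a2}(u y_2) R_{a1}(u y_1)` at `u = a / b`, on `V_a ⊗ (ℂ²)^{⊗N}`. The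
auxiliary space is tensor factor `0` of `N + 1` factors. -/
def monodromy (q : ℂ) (y : Fin N → A) (a b : A) : Matrix (Config (N + 1)) (Config (N + 1)) A :=
  ((List.finRange N).reverse.map fun i => twoSite 0 i.succ (Rmat q (a * y i) b)).prod

/-- The cyclic permutation `P_{(a1⋯N)}` of the tensor factors of `V_a ⊗ (ℂ²)^{⊗N}`: the content
of each factor moves to the next one, and that of the last factor to the auxiliary space. -/
def cyclicPerm : Matrix (Config (N + 1)) (Config (N + 1)) A :=
  Matrix.of fun σ τ => if ∀ k, σ (k + 1) = τ k then 1 else 0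

/-- `P_{(a1⋯N)} (a T_{N-1} y_N - b T_{N-1}⁻¹) ⋯ (a T_0 y_1 - b T_0⁻¹)`, where `T_i` acts in
the tensor factors `i`, `i + 1` of `V_a ⊗ (ℂ²)^{⊗N}`, the auxiliary space being factor `0`. -/
def heckeForm (q : ℂ) (y : Fin N → A) (a b : A) : Matrix (Config (N + 1)) (Config (N + 1)) A :=
  cyclicPerm * ((List.finRange N).reverse.map fun i => twoSite i.castSucc i.succ
    (Matrix.of fun x x' => Tsp q x x' • (a * y i) - TspInv q x x' • b)).prod

end TwoSite

/-- A matrix of operators on polynomials acts on `(ℂ²)^{⊗N} ⊗ ℂ[z₁, …, z_N]`. -/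
def act (M : Matrix (Config N) (Config N) (Module.End ℂ (Pol N))) :
    Module.End ℂ (BigSpace N) :=
  LinearMap.pi fun σ => ∑ τ, M σ τ ∘ₗ LinearMap.proj τ

/-- A spin operator, extended by the identity on polynomials. -/
def spinAct (M : Matrix (Config N) (Config N) ℂ) : Module.End ℂ (BigSpace N) :=
  act (M.map (algebraMap ℂ (Module.End ℂ (Pol N))))

/-- An operator on polynomials, extended by the identity on spins. -/
def polAct (O : Module.End ℂ (Pol N)) : Module.End ℂ (BigSpace N) :=
  LinearMap.compLeft O (Config N)

/-- The physical space: the vectors on which `T_i^sp` and `T_i^pol` coincide, `1 ≤ i ≤ N - 1`. -/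
def physical (N : ℕ) (q : ℂ) : Submodule ℂ (BigSpace N) :=
  ⨅ (i : Fin N) (j : Fin N) (_ : (j : ℕ) = i + 1),
    LinearMap.ker (spinAct (twoSite i j (Tsp q)) - polAct (Tpol q i j))

/-- The spin-Macdonald operator `D̃_r = e_r(Y_1, …, Y_N)`. -/
def spinMacdonald [NeZero N] (q p : ℂ) (r : ℕ) : Module.End ℂ (BigSpace N) :=
  polAct (esymmOp (Y q p) r)

/-- The spin-Macdonald operator `D̃_{-r} = e_r(Y_1⁻¹, …, Y_N⁻¹)`. -/
def spinMacdonaldNeg [NeZero N] (q p : ℂ) (r : ℕ) : Module.End ℂ (BigSpace N) :=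
  polAct (esymmOp (fun i => Ring.inverse (Y q p i)) r)

/-! ## Spectral parameter, monodromy matrix -/

/-- The two points around which one expands in the spectral parameter `u`. -/
inductive Pt : Type
  | zero : Pt
  | infty : Pt

/-- The power-series variable `X` is the local coordinate at the point, `X = u` at `0` and
`X = u⁻¹` at `∞`. We write `u = uNum / uDen`. -/
def uNum (A : Type*) [Ring A] : Pt → A⟦X⟧
  | Pt.zero => PowerSeries.X
  | Pt.infty => 1

/-- See `uNum`. -/
def uDen (A : Type*) [Ring A] : Pt → A⟦X⟧
  | Pt.zero => 1
  | Pt.infty => PowerSeries.X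

/-- `Y_i` as a constant power series. -/
def Yser [NeZero N] (q p : ℂ) (i : Fin N) : (Module.End ℂ (Pol N))⟦X⟧ := PowerSeries.C (Y q p i)

/-- The monodromy matrix `L̃_a(u) = R_{aN}(u Y_N) ⋯ R_{a1}(u Y_1)`, expanded at `u = 0` or
at `u = ∞`. -/
def Ltilde [NeZero N] (q p : ℂ) (ε : Pt) :
    Matrix (Config (N + 1)) (Config (N + 1)) (Module.End ℂ (Pol N))⟦X⟧ :=
  monodromy q (Yser q p) (uNum _ ε) (uDen _ ε)

/-- The coefficient of `u^n` (at `0`) or `u^{-n}` (at `∞`) of the `(α, β)` entry of `L̃_a(u)` as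
a matrix on the auxiliary space; so `(0, 0)`, `(0, 1)`, `(1, 0)`, `(1, 1)` give the modes of
`A(u)`, `B(u)`, `C(u)`, `D(u)`. -/
def mode [NeZero N] (q p : ℂ) (ε : Pt) (n : ℕ) (α β : Fin 2) : Module.End ℂ (BigSpace N) :=
  act (Matrix.of fun σ τ : Config N =>
    PowerSeries.coeff n (Ltilde q p ε (Fin.cons α σ) (Fin.cons β τ)))

/-! ## The `RLL`-relations and the quantum-loop algebra -/

section RLL

variable {W : Type*} [Ring W] [Algebra ℂ W]

/-- `R_{ab}(u / v)` without its denominator. Power series in the coordinates of `u` (inner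
variable) and of `v` (outer variable); `ε`, `ε'` are the points where `u`, `v` are expanded. -/
def RnumUV (W : Type*) [Ring W] [Algebra ℂ W] (q : ℂ) (ε ε' : Pt) :
    Matrix (Fin 2 × Fin 2) (Fin 2 × Fin 2) W⟦X⟧⟦X⟧ :=
  Rnum q (PowerSeries.C (uNum W ε) * uDen W⟦X⟧ ε') (PowerSeries.C (uDen W ε) * uNum W⟦X⟧ ε')

/-- `L_a(u)` on `V_a ⊗ V_b`. -/
def LaU (L : Matrix (Fin 2) (Fin 2) W⟦X⟧) : Matrix (Fin 2 × Fin 2) (Fin 2 × Fin 2) W⟦X⟧⟦X⟧ :=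
  L.map PowerSeries.C ⊗ₖ 1

/-- `L_b(v)` on `V_a ⊗ V_b`. -/
def LbV (L : Matrix (Fin 2) (Fin 2) W⟦X⟧) : Matrix (Fin 2 × Fin 2) (Fin 2 × Fin 2) W⟦X⟧⟦X⟧ :=
  1 ⊗ₖ L.map (PowerSeries.map PowerSeries.C)

/-- The left-hand side of `R_{ab}(u/v) L_a(u) L_b(v) = L_b(v) L_a(u) R_{ab}(u/v)`, times the
scalar denominator of `R_{ab}(u/v)`. -/
def rllLeft (q : ℂ) (L : Pt → Matrix (Fin 2) (Fin 2) W⟦X⟧) (ε ε' : Pt) :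
    Matrix (Fin 2 × Fin 2) (Fin 2 × Fin 2) W⟦X⟧⟦X⟧ :=
  RnumUV W q ε ε' * LaU (L ε) * LbV (L ε')

/-- The right-hand side, times the same denominator. -/
def rllRight (q : ℂ) (L : Pt → Matrix (Fin 2) (Fin 2) W⟦X⟧) (ε ε' : Pt) :
    Matrix (Fin 2 × Fin 2) (Fin 2 × Fin 2) W⟦X⟧⟦X⟧ :=
  LbV (L ε') * LaU (L ε) * RnumUV W q ε ε'

/-- The `2 × 2` matrices of generating series with given coefficients. -/
def seriesMatrix (ℓ : Pt → ℕ → Fin 2 → Fin 2 → W) (ε : Pt) : Matrix (Fin 2) (Fin 2) W⟦X⟧ :=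
  Matrix.of fun α β => PowerSeries.mk fun n => ℓ ε n α β

/-- The `RLL`-relations, for `u`, `v` expanded at `0` or at `∞` independently. -/
def SatisfiesRLL (q : ℂ) (ℓ : Pt → ℕ → Fin 2 → Fin 2 → W) : Prop :=
  ∀ ε ε', rllLeft q (seriesMatrix ℓ) ε ε' = rllRight q (seriesMatrix ℓ) ε ε'

end RLL

/-- Labels for the modes of `L^±(u)`: point of expansion, order, row, column. -/
abbrev Gen : Type := Pt × ℕ × Fin 2 × Fin 2

/-- The free generators. -/
def freeGen (ε : Pt) (n : ℕ) (α β : Fin 2) : FreeAlgebra ℂ Gen := FreeAlgebra.ι ℂ (ε, n, α, β)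

/-- The defining relations of `U_q(L gl_2)` in the Faddeev–Reshetikhin–Takhtajan presentation at
level zero: the `RLL`-relations, triangularity of the leading coefficients at `0` and `∞`, and the
relation between their diagonal entries. -/
inductive LoopRel (q : ℂ) : FreeAlgebra ℂ Gen → FreeAlgebra ℂ Gen → Prop
  | rll (ε ε' : Pt) (x y : Fin 2 × Fin 2) (m n : ℕ) :
      LoopRel q
        (PowerSeries.coeff m (PowerSeries.coeff n (rllLeft q (seriesMatrix freeGen) ε ε' x y)))
        (PowerSeries.coeff m (PowerSeries.coeff n (rllRight q (seriesMatrix freeGen) ε ε' x y)))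
  | upper : LoopRel q (freeGen Pt.zero 0 1 0) 0
  | lower : LoopRel q (freeGen Pt.infty 0 0 1) 0
  | inv_right (α : Fin 2) : LoopRel q (freeGen Pt.zero 0 α α * freeGen Pt.infty 0 α α) 1
  | inv_left (α : Fin 2) : LoopRel q (freeGen Pt.infty 0 α α * freeGen Pt.zero 0 α α) 1

/-- The quantum-loop algebra `U_q(L gl_2)`. -/
abbrev QuantumLoop (q : ℂ) : Type := RingQuot (LoopRel q)

/-- The modes of `L^±(u)` that generate the quantum-loop algebra. -/
def loopGen (q : ℂ) (ε : Pt) (n : ℕ) (α β : Fin 2) : QuantumLoop q :=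
  RingQuot.mkAlgHom ℂ (LoopRel q) (freeGen ε n α β)

/-! ## The spin chain -/

/-- `ω^j`, `j = 1, …, N`, where `ω = exp(2πi/N)`. -/
def evPoint (N : ℕ) (j : Fin N) : ℂ :=
  Complex.exp (2 * Real.pi * Complex.I / N) ^ ((j : ℕ) + 1)

/-- The evaluation `z_j ↦ ω^j`. -/
def ev (N : ℕ) : BigSpace N →ₗ[ℂ] SpinSpace N :=
  LinearMap.pi fun σ => (MvPolynomial.aeval (evPoint N)).toLinearMap ∘ₗ LinearMap.proj σ

/-- The (Gaussian) `q`-binomial coefficient, in the convention symmetric under `q ↦ q⁻¹`. -/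
def qBinom (q : ℂ) : ℕ → ℕ → ℂ
  | _, 0 => 1
  | 0, _ + 1 => 0
  | n + 1, k + 1 => q ^ (k + 1) * qBinom q n (k + 1) + q ^ ((k : ℤ) - n) * qBinom q n k

/-- `H` is the spin-chain Hamiltonian `H_r`: on the physical space `H ∘ ev = ev ∘ H̃_r`, where
`H̃_r = (q - q⁻¹)⁻¹ ∂_p|_{p=1} (D̃_r - (r/N) [N choose r]_q D̃_N)`. -/
def IsHamiltonian [NeZero N] (q : ℂ) (r : ℕ) (H : Module.End ℂ (SpinSpace N)) : Prop :=
  ∀ Ψ ∈ physical N q,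
    HasDerivAt
      (fun p : ℂ => ev N (spinMacdonald q p r Ψ - ((r / N : ℂ) * qBinom q N r) •
        spinMacdonald q p N Ψ))
      ((q - q⁻¹) • H (ev N Ψ)) 1

/-- `Ř(u)` for a number `u` with `t u ≠ 1`. -/
def Rcheck (q u : ℂ) : Matrix (Fin 2 × Fin 2) (Fin 2 × Fin 2) ℂ :=
  (Rden q u 1)⁻¹ • RcheckNum q u 1

/-- The `q`-translation operator `G`, the evaluation of
`Ř_{N-1,N}(z_1/z_N) ⋯ Ř_{23}(z_1/z_3) Ř_{12}(z_1/z_2)`. -/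
def qTranslation (N : ℕ) [NeZero N] (q : ℂ) : Module.End ℂ (SpinSpace N) :=
  Matrix.toLin' ((((List.finRange N).filter fun k : Fin N => (k : ℕ) + 1 < N).reverse.map
    fun k : Fin N => twoSite k (k + 1) (Rcheck q (evPoint N 0 / evPoint N (k + 1)))).prod)

end SpinRuijsenaars

end

open scoped PowerSeries Kronecker

noncomputable section

namespace SpinRuijsenaars

/-! ## Demazure–Lusztig operators through point evaluation -/

section PointEvaluation

variable {N : ℕ}

open MvPolynomial

/-! The engine is the affine Hecke algebra. At a point with distinct coordinates, a Demazure–Lusztig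
operator is a combination of the identity and a transposition of the variables, so the relations
among the `T_i` and `π` are rational identities (`affineRel_heckeT`). They make the `Y_i` commute
with each other and make their elementary symmetric functions commute with the `T_i`.

For (I), the monodromy matrix is an ordered product of one-site factors. In one factor `Y_i` behaves
like a scalar variable, so its RLL-relation is the Yang–Baxter equation; entries of factors at
different sites commute, and the relation propagates along the chain (`satisfiesRLL_mode`). Put Θ =
`T^sp - T^pol` at two neighbouring sites. Moving Θ through the two neighbouring factors only
exchanges their `Y`'s (`heckeDiff_mul_siteNum`), so the kernel of Θ is preserved. The leading
coefficients of the modes are triangular with mutually inverse diagonals, whence the action of the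
quantum-loop algebra. It commutes with the spin-Macdonald operators because the `Y_i` commute. The
Hecke form comes from collecting the permutations in `R = P Ř` on the left.

For (II), the value of a physical vector at a transposed point is its value at the original point
acted on by `Ř` (`evalAt_comp_swap`). The condition on `q^(2N)` makes these matrices finite along
the orbit of the evaluation point, so a physical vector that vanishes there vanishes on the whole
orbit. At `p = 1` the operator `π` only permutes variables; hence `Y_i`, `Y_i⁻¹` and all modes
preserve the polynomials vanishing on the orbit, and the modes descend (`ev_mode_eq_zero`).
Surjectivity follows by applying a Hecke symmetriser to a polynomial chosen to isolate one class of
points of the orbit (`exists_evalAt_symmetrizer`). The operator `G` is the scaling of all variables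
by `ω`: this commutes with the `Y_i` and permutes the evaluation point cyclically
(`qTranslation_ev`).

The Hamiltonians need more. With `w = T_{N-1} ⋯ T_1 z_1` one has `w Y_{i+1} = Y_i w` and `w Y_1 =
p⁻¹ Y_N w`, so `D_r` nearly commutes with `w`. At `p = 1` it commutes exactly, hence commutes with
every `z_i`, and is the scalar `[N choose r]` (`esymmOp_Y_one`). Let `E_r` be its derivative at `p =
1`. Since `D_r` is scalar there, `E_r` commutes with the `Y_i` at `p = 1`; and its commutator with a
symmetric polynomial is a multiplication operator (`esymmDeriv_mul`). For the elementary symmetric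
polynomial `e_k` with `0 < k < N` the multiplier vanishes at the evaluation point, being invariant
on the orbit and picking up `ω^k` under scaling. For `k = N` it is a constant times `e_N`, which the
multiple of `D_N` in the definition of `H_r` cancels. So symmetric polynomials act on evaluation
composed with the corrected derivative by their values, which forces this functional to vanish on
the ideal of the orbit (`apply_eq_zero_of_mem_orbitIdeal`). This makes `H_r` well defined;
surjectivity of evaluation makes it unique. -/

/-- The coefficient of `F ∘ s_{ij}` in `Tpol q i j F`. -/
def braidCoef (q x y : ℂ) : ℂ := q⁻¹ * (q ^ 2 * x - y) / (x - y)

theorem eval_swapVars (z : Fin N → ℂ) (i j : Fin N) (F : Pol N) :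
    eval z (swapVars i j F) = eval (z ∘ Equiv.swap i j) F := by
  simp [swapVars, eval_rename]

theorem eval_Tpol (q : ℂ) {z : Fin N → ℂ} {i j : Fin N} (h : z i ≠ z j) (F : Pol N) :
    eval z (Tpol q i j F) = (q - braidCoef q (z i) (z j)) * eval z F
      + braidCoef q (z i) (z j) * eval (z ∘ Equiv.swap i j) F := by
  have hij : i ≠ j := fun e => h (by rw [e])
  have hz : z i - z j ≠ 0 := sub_ne_zero.2 h
  have hd : (z i - z j) * eval z (divDiff i j F)
      = eval z F - eval (z ∘ Equiv.swap i j) F := by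
    have := congrArg (eval z) (mul_divDiff hij F)
    simpa [eval_swapVars] using this
  have hd' : eval z (divDiff i j F)
      = (eval z F - eval (z ∘ Equiv.swap i j) F) / (z i - z j) := by
    field_simp; rw [mul_comm]; exact hd
  simp only [Tpol, LinearMap.add_apply, LinearMap.smul_apply, Module.End.mul_apply,
    LinearMap.mulLeft_apply, Module.End.one_apply, smul_eval, map_add, map_mul, map_sub, eval_C,
    eval_X, hd', braidCoef, map_pow]
  ring

/-- Multiplying by the product of all differences `z_i - z_j`, which is a nonzero polynomial, makes
both sides agree at the points with coinciding coordinates as well. -/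
theorem pol_ext_injective {F G : Pol N}
    (h : ∀ z : Fin N → ℂ, Function.Injective z → eval z F = eval z G) : F = G := by
  have hD : (∏ x ∈ (Finset.univ : Finset (Fin N)).offDiag,
      (X x.1 - X x.2 : Pol N)) ≠ 0 :=
    Finset.prod_ne_zero_iff.2 fun x hx => X_sub_X_ne_zero (Finset.mem_offDiag.1 hx).2.2
  refine mul_right_cancel₀ hD (MvPolynomial.funext fun z => ?_)
  by_cases hz : Function.Injective z
  · simp [h z hz]
  · obtain ⟨i, j, hij, hne⟩ := Function.not_injective_iff.1 hz
    have : eval z (∏ x ∈ (Finset.univ : Finset (Fin N)).offDiag, (X x.1 - X x.2 : Pol N)) = 0 := by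
      rw [map_prod]
      exact Finset.prod_eq_zero (i := (i, j)) (by simp [hne]) (by simp [hij])
    simp [this]

theorem swapped_injective {z : Fin N → ℂ} (h : Function.Injective z) (i j : Fin N) :
    Function.Injective (z ∘ Equiv.swap i j) :=
  h.comp (Equiv.injective _)

theorem comp_swap_swap (z : Fin N → ℂ) (i j : Fin N) :
    (z ∘ Equiv.swap i j) ∘ Equiv.swap i j = z := by
  ext k; simp

theorem Tpol_mul_self {q : ℂ} (hq : q ≠ 0) {i j : Fin N} (hij : i ≠ j) :
    Tpol q i j * Tpol q i j = (q - q⁻¹) • Tpol q i j + 1 := by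
  refine LinearMap.ext fun F => pol_ext_injective fun z hz => ?_
  have h1 : z i ≠ z j := fun e => hij (hz e)
  have h2 : (z ∘ Equiv.swap i j) i ≠ (z ∘ Equiv.swap i j) j := fun e =>
    hij (swapped_injective hz i j e)
  have h3 : z i - z j ≠ 0 := sub_ne_zero.2 h1
  have h4 : z j - z i ≠ 0 := sub_ne_zero.2 h1.symm
  simp only [Module.End.mul_apply, LinearMap.add_apply, LinearMap.smul_apply,
    Module.End.one_apply, map_add, smul_eval, eval_Tpol q h1, eval_Tpol q h2, comp_swap_swap]
  simp only [Function.comp, Equiv.swap_apply_left, Equiv.swap_apply_right, braidCoef]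
  field_simp
  ring

theorem Tpol_mul_TpolInv {q : ℂ} (hq : q ≠ 0) {i j : Fin N} (hij : i ≠ j) :
    Tpol q i j * TpolInv q i j = 1 := by
  rw [TpolInv, mul_sub, Tpol_mul_self hq hij]; simp

theorem TpolInv_mul_Tpol {q : ℂ} (hq : q ≠ 0) {i j : Fin N} (hij : i ≠ j) :
    TpolInv q i j * Tpol q i j = 1 := by
  rw [TpolInv, sub_mul, Tpol_mul_self hq hij]; simp

theorem Tpol_commute (q : ℂ) {i j k l : Fin N} (hij : i ≠ j) (hkl : k ≠ l)
    (hik : i ≠ k) (hil : i ≠ l) (hjk : j ≠ k) (hjl : j ≠ l) :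
    Tpol q i j * Tpol q k l = Tpol q k l * Tpol q i j := by
  refine LinearMap.ext fun F => pol_ext_injective fun z hz => ?_
  have h1 : z i ≠ z j := fun e => hij (hz e)
  have h2 : z k ≠ z l := fun e => hkl (hz e)
  have h3 : (z ∘ Equiv.swap i j) k ≠ (z ∘ Equiv.swap i j) l := fun e =>
    hkl (swapped_injective hz i j e)
  have h4 : (z ∘ Equiv.swap k l) i ≠ (z ∘ Equiv.swap k l) j := fun e =>
    hij (swapped_injective hz k l e)
  have hc : (z ∘ Equiv.swap i j) ∘ Equiv.swap k l = (z ∘ Equiv.swap k l) ∘ Equiv.swap i j := by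
    ext m; simp only [Function.comp, Equiv.swap_apply_def]; congr 1; split_ifs <;> simp_all
  simp only [Module.End.mul_apply, eval_Tpol q h1, eval_Tpol q h2, eval_Tpol q h3,
    eval_Tpol q h4, hc]
  simp only [Function.comp, Equiv.swap_apply_of_ne_of_ne hik hil,
    Equiv.swap_apply_of_ne_of_ne hjk hjl, Equiv.swap_apply_of_ne_of_ne hik.symm hjk.symm,
    Equiv.swap_apply_of_ne_of_ne hil.symm hjl.symm]
  ring

theorem Tpol_braid {q : ℂ} (hq : q ≠ 0) {i j k : Fin N} (hij : i ≠ j) (hjk : j ≠ k)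
    (hik : i ≠ k) :
    Tpol q i j * Tpol q j k * Tpol q i j = Tpol q j k * Tpol q i j * Tpol q j k := by
  refine LinearMap.ext fun F => pol_ext_injective fun z hz => ?_
  have key : ∀ (w : Fin N → ℂ) (_ : Function.Injective w) (a b : Fin N), a ≠ b → w a ≠ w b :=
    fun w hw a b hab e => hab (hw e)
  have hs : Function.Injective (z ∘ Equiv.swap i j) := swapped_injective hz _ _
  have hr : Function.Injective (z ∘ Equiv.swap j k) := swapped_injective hz _ _
  have hsr := swapped_injective hs j k
  have hrs := swapped_injective hr i j
  have hc : ((z ∘ Equiv.swap i j) ∘ Equiv.swap j k) ∘ Equiv.swap i j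
      = ((z ∘ Equiv.swap j k) ∘ Equiv.swap i j) ∘ Equiv.swap j k := by
    ext m; simp only [Function.comp, Equiv.swap_apply_def]; congr 1; split_ifs <;> simp_all
  simp only [Module.End.mul_apply, eval_Tpol q (key z hz i j hij), eval_Tpol q (key z hz j k hjk),
    eval_Tpol q (key _ hs i j hij), eval_Tpol q (key _ hs j k hjk),
    eval_Tpol q (key _ hr i j hij), eval_Tpol q (key _ hr j k hjk),
    eval_Tpol q (key _ hsr i j hij), eval_Tpol q (key _ hrs j k hjk), comp_swap_swap, hc]
  have e1 : Equiv.swap i j k = k := Equiv.swap_apply_of_ne_of_ne hik.symm hjk.symm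
  have e2 : Equiv.swap j k i = i := Equiv.swap_apply_of_ne_of_ne hij hik
  simp only [Function.comp, Equiv.swap_apply_left, Equiv.swap_apply_right, e1, e2]
  have a1 := sub_ne_zero.2 (key z hz i j hij)
  have a2 := sub_ne_zero.2 (key z hz j k hjk)
  have a3 := sub_ne_zero.2 (key z hz i k hik)
  have a4 := sub_ne_zero.2 (key z hz i j hij).symm
  have a5 := sub_ne_zero.2 (key z hz j k hjk).symm
  simp only [braidCoef]
  generalize z i = x at *
  generalize z j = y at *
  generalize z k = w at *
  generalize eval z F = f0
  generalize eval (z ∘ Equiv.swap i j) F = f1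
  generalize eval (z ∘ Equiv.swap j k) F = f2
  generalize eval ((z ∘ Equiv.swap i j) ∘ Equiv.swap j k) F = f3
  generalize eval ((z ∘ Equiv.swap j k) ∘ Equiv.swap i j) F = f4
  generalize eval (((z ∘ Equiv.swap j k) ∘ Equiv.swap i j) ∘ Equiv.swap j k) F = f5
  -- Opposite differences are normalised so that each pair of variables contributes a single
  -- denominator.
  have b4 : y - x = -(x - y) := by ring
  have b5 : w - y = -(y - w) := by ring
  rw [b4, b5]
  field_simp
  ring

/-- The point at which `piOp p F` reads `F`. -/
def shiftPoint [NeZero N] (p : ℂ) (z : Fin N → ℂ) : Fin N → ℂ :=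
  fun j => if j = 0 then p * z (j - 1) else z (j - 1)

theorem eval_piOp [NeZero N] (p : ℂ) (z : Fin N → ℂ) (F : Pol N) :
    eval z (piOp p F) = eval (shiftPoint p z) F := by
  have : (aeval z : Pol N →ₐ[ℂ] ℂ).comp (aeval fun j : Fin N =>
      if j = 0 then C p * (X (j - 1) : Pol N) else X (j - 1)) = aeval (shiftPoint p z) := by
    refine MvPolynomial.algHom_ext fun j => ?_
    by_cases hj : j = 0 <;> simp [shiftPoint, hj]
  have := DFunLike.congr_fun this F
  simpa [piOp, aeval_eq_eval] using this

/-- The parameter `p` enters the shift only at index `0`; away from it `π` is a plain relabelling of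
the variables. -/
theorem piOp_mul_Tpol [NeZero N] (q p : ℂ) {j k : Fin N} (hj : j ≠ 0) (hk : k ≠ 0)
    (hjk : j ≠ k) : piOp p * Tpol q j k = Tpol q (j - 1) (k - 1) * piOp p := by
  refine LinearMap.ext fun F => pol_ext_injective fun z hz => ?_
  have h0 : j - 1 ≠ k - 1 := fun e => hjk (sub_left_injective e)
  have h1 : z (j - 1) ≠ z (k - 1) := fun e => h0 (hz e)
  have h2 : shiftPoint p z j ≠ shiftPoint p z k := by simpa [shiftPoint, hj, hk] using h1
  have hc : shiftPoint p z ∘ Equiv.swap j k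
      = shiftPoint p (z ∘ Equiv.swap (j - 1) (k - 1)) := by
    ext m
    simp only [shiftPoint, Function.comp]
    by_cases hmj : m = j
    · subst hmj; simp [hj, hk]
    · by_cases hmk : m = k
      · subst hmk; simp [hj, hk]
      · rw [Equiv.swap_apply_of_ne_of_ne hmj hmk, Equiv.swap_apply_of_ne_of_ne
          (fun e => hmj (sub_left_injective e)) (fun e => hmk (sub_left_injective e))]
  simp only [Module.End.mul_apply, eval_piOp, eval_Tpol q h1, eval_Tpol q h2, hc]
  simp [shiftPoint, hj, hk]

theorem braidCoef_scale (q : ℂ) {p : ℂ} (hp : p ≠ 0) (x y : ℂ) :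
    braidCoef q (p * x) (p * y) = braidCoef q x y := by
  simp only [braidCoef]
  rw [show q⁻¹ * (q ^ 2 * (p * x) - p * y) = p * (q⁻¹ * (q ^ 2 * x - y)) by ring,
    ← mul_sub, mul_div_mul_left _ _ hp]

/-- The square of `π` carries both of the first two variables around the end. Both are scaled by
`p`, and the braid coefficient is homogeneous of degree zero. In the cyclic numbering `-1 - 1` and
`-1` are the last two indices. -/
theorem piOp_piOp_mul_Tpol [NeZero N] (q : ℂ) {p : ℂ} (hp : p ≠ 0) (hN : (1 : Fin N) ≠ 0) :
    piOp p * piOp p * Tpol q 0 1 = Tpol q (-1 - 1) (-1 : Fin N) * (piOp p * piOp p) := by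
  refine LinearMap.ext fun F => pol_ext_injective fun z hz => ?_
  have hN' : (-1 : Fin N) ≠ 0 := neg_ne_zero.2 hN
  have h0 : (-1 - 1 : Fin N) ≠ -1 := by simpa [sub_eq_self] using hN
  have h1 : z (-1 - 1) ≠ z (-1) := fun e => h0 (hz e)
  have e0 : shiftPoint p (shiftPoint p z) 0 = p * z (-1 - 1) := by
    simp [shiftPoint, hN']
  have e1 : shiftPoint p (shiftPoint p z) 1 = p * z (-1) := by
    simp [shiftPoint, hN]
  have h2 : shiftPoint p (shiftPoint p z) 0 ≠ shiftPoint p (shiftPoint p z) 1 := by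
    rw [e0, e1]; exact fun e => h1 (mul_left_cancel₀ hp e)
  have hgen : ∀ (w : Fin N → ℂ) (m : Fin N), m ≠ 0 → m ≠ 1 →
      shiftPoint p (shiftPoint p w) m = w (m - 1 - 1) := by
    intro w m hm0 hm1
    simp [shiftPoint, hm0, sub_eq_zero, hm1]
  have hc : shiftPoint p (shiftPoint p z) ∘ Equiv.swap 0 1
      = shiftPoint p (shiftPoint p (z ∘ Equiv.swap (-1 - 1) (-1))) := by
    ext m
    by_cases hm0 : m = 0
    · subst hm0
      simp [shiftPoint, hN, hN']
    · by_cases hm1 : m = 1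
      · subst hm1; simp [shiftPoint, hN, hN']
      · have hm3 : m - 1 - 1 ≠ -1 - 1 := fun e => hm0 (by
          have := sub_left_injective (sub_left_injective (e.trans (by rw [zero_sub]) :
            m - 1 - 1 = 0 - 1 - 1)); exact this)
        have hm2 : m - 1 - 1 ≠ -1 := fun e => hm1 (by
          have := sub_left_injective (e.trans (by simp) : m - 1 - 1 = 0 - 1)
          exact sub_eq_zero.1 this)
        rw [hgen _ _ hm0 hm1]
        simp only [Function.comp]
        rw [Equiv.swap_apply_of_ne_of_ne hm0 hm1, Equiv.swap_apply_of_ne_of_ne hm3 hm2,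
          hgen _ _ hm0 hm1]
  simp only [Module.End.mul_apply, eval_piOp, eval_Tpol q h1, eval_Tpol q h2, hc, e0, e1,
    braidCoef_scale q hp]

/-- This cross relation between Hecke generators and variables is what produces all `z_i` from the
first one, and with it the shift operator for the `Y_i`. -/
theorem Tpol_mul_mulLeft_X_mul_Tpol {q : ℂ} (hq : q ≠ 0) {i j : Fin N} (hij : i ≠ j) :
    Tpol q i j * LinearMap.mulLeft ℂ (X i) * Tpol q i j = LinearMap.mulLeft ℂ (X j : Pol N) := by
  refine LinearMap.ext fun F => pol_ext_injective fun z hz => ?_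
  have h1 : z i ≠ z j := fun e => hij (hz e)
  have h2 : (z ∘ Equiv.swap i j) i ≠ (z ∘ Equiv.swap i j) j := fun e =>
    hij (swapped_injective hz i j e)
  have h3 : z i - z j ≠ 0 := sub_ne_zero.2 h1
  have h4 : z j - z i ≠ 0 := sub_ne_zero.2 h1.symm
  simp only [Module.End.mul_apply, LinearMap.mulLeft_apply, map_mul, eval_X, eval_Tpol q h1,
    eval_Tpol q h2, comp_swap_swap]
  simp only [Function.comp, Equiv.swap_apply_left, Equiv.swap_apply_right, braidCoef]
  have b4 : z j - z i = -(z i - z j) := by ring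
  rw [b4]
  field_simp
  ring

theorem Tpol_mul_mulLeft (q : ℂ) {i j : Fin N} (hij : i ≠ j) {f : Pol N}
    (hf : swapVars i j f = f) :
    Tpol q i j * LinearMap.mulLeft ℂ f = LinearMap.mulLeft ℂ f * Tpol q i j := by
  refine LinearMap.ext fun F => pol_ext_injective fun z hz => ?_
  have h1 : z i ≠ z j := fun e => hij (hz e)
  have hf' : eval (z ∘ Equiv.swap i j) f = eval z f := by rw [← eval_swapVars, hf]
  simp only [Module.End.mul_apply, LinearMap.mulLeft_apply, map_mul, eval_Tpol q h1, hf']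
  ring

theorem Tpol_apply_of_swapVars_eq (q : ℂ) {i j : Fin N} (hij : i ≠ j) {f : Pol N}
    (hf : swapVars i j f = f) : Tpol q i j f = q • f := by
  refine pol_ext_injective fun z hz => ?_
  have h1 : z i ≠ z j := fun e => hij (hz e)
  have hf' : eval (z ∘ Equiv.swap i j) f = eval z f := by rw [← eval_swapVars, hf]
  rw [eval_Tpol q h1, hf', smul_eval]
  ring

/-- An eigenvector for `q` need be symmetric only where the braid coefficient is nonzero, which is
what `ht` ensures. -/
theorem eval_swap_of_Tpol_apply {q : ℂ} (hq : q ≠ 0) {i j : Fin N}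
    {F : Pol N} (hF : Tpol q i j F = q • F) {z : Fin N → ℂ} (hz : z i ≠ z j)
    (ht : q ^ 2 * z i ≠ z j) : eval (z ∘ Equiv.swap i j) F = eval z F := by
  have h := congrArg (eval z) hF
  rw [eval_Tpol q hz, smul_eval] at h
  have hb : braidCoef q (z i) (z j) ≠ 0 :=
    div_ne_zero (mul_ne_zero (inv_ne_zero hq) (sub_ne_zero.2 ht)) (sub_ne_zero.2 hz)
  exact mul_left_cancel₀ hb (by linear_combination h)

end PointEvaluation


/-! ## Affine Hecke algebra relations -/

section AffineHecke

variable {A : Type*} [Ring A]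

/-- `T a * T (a + 1) * ⋯ * T (a + n - 1)`. -/
def upProd (T : ℕ → A) (a n : ℕ) : A := ((List.range' a n).map T).prod

theorem upProd_zero (T : ℕ → A) (a : ℕ) : upProd T a 0 = 1 := by simp [upProd]

theorem upProd_succ_left (T : ℕ → A) (a n : ℕ) :
    upProd T a (n + 1) = T a * upProd T (a + 1) n := by
  simp [upProd, List.range'_succ]

theorem upProd_succ (T : ℕ → A) (a n : ℕ) :
    upProd T a (n + 1) = upProd T a n * T (a + n) := by
  simp [upProd, List.range'_1_concat]

theorem upProd_add (T : ℕ → A) (a m n : ℕ) :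
    upProd T a (m + n) = upProd T a m * upProd T (a + m) n := by
  induction n with
  | zero => simp [upProd_zero]
  | succ n ih => rw [← Nat.add_assoc, upProd_succ, ih, upProd_succ, mul_assoc, Nat.add_assoc]

/-- `T (a + n - 1) * ⋯ * T a`. -/
def downProd (T : ℕ → A) (a n : ℕ) : A := ((List.range' a n).reverse.map T).prod

theorem downProd_zero (T : ℕ → A) (a : ℕ) : downProd T a 0 = 1 := by simp [downProd]

theorem downProd_succ (T : ℕ → A) (a n : ℕ) :
    downProd T a (n + 1) = T (a + n) * downProd T a n := by
  simp [downProd, List.range'_1_concat]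

theorem downProd_succ_left (T : ℕ → A) (a n : ℕ) :
    downProd T a (n + 1) = downProd T (a + 1) n * T a := by
  simp [downProd, List.range'_succ]

theorem commute_upProd {T : ℕ → A} {x : A} {a n : ℕ}
    (h : ∀ k, a ≤ k → k < a + n → Commute x (T k)) : Commute x (upProd T a n) := by
  induction n with
  | zero => rw [upProd_zero]; exact Commute.one_right x
  | succ n ih =>
    rw [upProd_succ]
    exact (ih fun k h1 h2 => h k h1 (by omega)).mul_right (h _ (by omega) (by omega))

theorem commute_downProd {T : ℕ → A} {x : A} {a n : ℕ}
    (h : ∀ k, a ≤ k → k < a + n → Commute x (T k)) : Commute x (downProd T a n) := by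
  induction n with
  | zero => rw [downProd_zero]; exact Commute.one_right x
  | succ n ih =>
    rw [downProd_succ]
    exact (h _ (by omega) (by omega)).mul_right (ih fun k h1 h2 => h k h1 (by omega))

theorem upProd_mul_downProd {T Ti : ℕ → A} {a n : ℕ}
    (h : ∀ k, a ≤ k → k < a + n → T k * Ti k = 1) :
    upProd T a n * downProd Ti a n = 1 := by
  induction n generalizing a with
  | zero => simp [downProd_zero, upProd_zero]
  | succ n ih =>
    rw [upProd_succ, downProd_succ, mul_assoc, ← mul_assoc (T _),
      h _ (by omega) (by omega), one_mul]
    exact ih fun k h1 h2 => h k (by omega) (by omega)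

/-- Braid relations among `T 0, …, T (n - 1)`. -/
structure BraidRel (n : ℕ) (T : ℕ → A) : Prop where
  braid : ∀ i, i + 1 < n → T i * T (i + 1) * T i = T (i + 1) * T i * T (i + 1)
  far : ∀ i j, i + 2 ≤ j → j < n → Commute (T i) (T j)

theorem BraidRel.far' {n : ℕ} {T : ℕ → A} (h : BraidRel n T) {i j : ℕ} (hi : i < n) (hj : j < n)
    (hij : i + 2 ≤ j ∨ j + 2 ≤ i) : Commute (T i) (T j) := by
  rcases hij with hij | hij
  · exact h.far i j hij hj
  · exact (h.far j i hij hi).symm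

/-- Only the pair `T i * T (i + 1)` inside the product matters: the factors on its right commute
with `T i`, those on its left with `T (i + 1)`, and the braid relation exchanges the two. -/
theorem BraidRel.upProd_mul {n : ℕ} {T : ℕ → A} (h : BraidRel n T) {a m i : ℕ} (ha : a ≤ i)
    (hi : i + 1 < a + m) (hm : a + m ≤ n) : upProd T a m * T i = T (i + 1) * upProd T a m := by
  obtain ⟨k, rfl⟩ := Nat.exists_eq_add_of_le ha
  obtain ⟨l, rfl⟩ : ∃ l, m = k + (2 + l) := ⟨m - k - 2, by omega⟩
  have e : upProd T (a + k) 2 = T (a + k) * T (a + k + 1) := by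
    rw [upProd_succ, upProd_succ, upProd_zero, one_mul, add_zero]
  rw [upProd_add, upProd_add, e]
  have c1 : Commute (T (a + k)) (upProd T (a + k + 2) l) :=
    commute_upProd fun j h1 h2 => h.far' (by omega) (by omega) (by omega)
  have c2 : Commute (T (a + k + 1)) (upProd T a k) :=
    commute_upProd fun j h1 h2 => h.far' (by omega) (by omega) (by omega)
  have hb := h.braid (a + k) (by omega)
  calc upProd T a k * (T (a + k) * T (a + k + 1) * upProd T (a + k + 2) l) * T (a + k)
      = upProd T a k * (T (a + k) * T (a + k + 1)) * (upProd T (a + k + 2) l * T (a + k)) := by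
        noncomm_ring
    _ = upProd T a k * (T (a + k) * T (a + k + 1) * T (a + k)) * upProd T (a + k + 2) l := by
        rw [← c1.eq]; noncomm_ring
    _ = (upProd T a k * T (a + k + 1)) * (T (a + k) * T (a + k + 1) * upProd T (a + k + 2) l) := by
        rw [hb]; noncomm_ring
    _ = _ := by rw [← c2.eq]; noncomm_ring

theorem BraidRel.mul_downProd {n : ℕ} {T : ℕ → A} (h : BraidRel n T) {a m i : ℕ} (ha : a ≤ i)
    (hi : i + 1 < a + m) (hm : a + m ≤ n) :
    T i * downProd T a m = downProd T a m * T (i + 1) := by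
  obtain ⟨k, rfl⟩ := Nat.exists_eq_add_of_le ha
  -- The braid relations are symmetric under reversal of products, so the claim is the previous
  -- lemma in the opposite ring.
  have hop : BraidRel n fun j => MulOpposite.op (T j) :=
    ⟨fun j hj => by
      have := congrArg MulOpposite.op (h.braid j hj)
      simpa [mul_assoc] using this,
     fun j l hjl hl => (h.far j l hjl hl).op⟩
  have hud : ∀ m, upProd (fun j => MulOpposite.op (T j)) a m = MulOpposite.op (downProd T a m) := by
    intro m
    induction m with
    | zero => simp [upProd_zero, downProd_zero]
    | succ m ih => rw [upProd_succ, downProd_succ, ih, MulOpposite.op_mul]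
  have := hop.upProd_mul ha hi hm
  rw [hud, ← MulOpposite.op_mul, ← MulOpposite.op_mul] at this
  exact MulOpposite.op_injective this

/-- Relations for `T 0, …, T (n - 1)` and `π` in the affine Hecke algebra of rank `n + 1`. -/
structure AffineRel (n : ℕ) (T Ti : ℕ → A) (π : A) : Prop extends BraidRel n T where
  mul_inv : ∀ i, i < n → T i * Ti i = 1
  inv_mul : ∀ i, i < n → Ti i * T i = 1
  pi_mul : ∀ i, i + 1 < n → π * T (i + 1) = T i * π
  pi_pi_mul : 0 < n → π * π * T 0 = T (n - 1) * (π * π)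

/-- `Y_i = T_i ⋯ T_{n-1} π T_0⁻¹ ⋯ T_{i-1}⁻¹`. -/
def affineY (n : ℕ) (T Ti : ℕ → A) (π : A) (i : ℕ) : A :=
  upProd T i (n - i) * π * upProd Ti 0 i

variable {n : ℕ} {T Ti : ℕ → A} {π : A}

theorem commute_of_inverse {x t s : A} (h1 : t * s = 1) (h2 : s * t = 1) (h : Commute x t) :
    Commute x s := by
  let u : Aˣ := ⟨t, s, h1, h2⟩
  exact (Commute.units_inv_right (u := u) h : Commute x (u⁻¹ : Aˣ))

namespace AffineRel

variable (h : AffineRel n T Ti π)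
include h

theorem commute_inv {i : ℕ} (hi : i < n) {x : A} (hx : Commute x (T i)) : Commute x (Ti i) :=
  commute_of_inverse (h.mul_inv i hi) (h.inv_mul i hi) hx

theorem affineY_succ {i : ℕ} (hi : i < n) :
    affineY n T Ti π (i + 1) = Ti i * affineY n T Ti π i * Ti i := by
  rw [affineY, affineY, upProd_succ, zero_add, show n - i = (n - (i + 1)) + 1 by omega,
    upProd_succ_left]
  simp only [← mul_assoc]
  rw [h.inv_mul i hi, one_mul]

theorem mul_affineY_succ_mul {i : ℕ} (hi : i < n) :
    T i * affineY n T Ti π (i + 1) * T i = affineY n T Ti π i := by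
  rw [h.affineY_succ hi]
  calc T i * (Ti i * affineY n T Ti π i * Ti i) * T i
      = (T i * Ti i) * affineY n T Ti π i * (Ti i * T i) := by noncomm_ring
    _ = _ := by rw [h.mul_inv i hi, h.inv_mul i hi, one_mul, mul_one]

/-- For `Y_0` the index is raised by the product of the `T`'s and lowered back by `π`. Conjugation
by `Ti` extends this upwards; the one case not covered by far commutation is `Y_{j+2}`, where the
braid relation turns `T j` into `T (j + 1)`, which commutes with `Y_j`. -/
theorem commute_T_affineY {i j : ℕ} (hi : i ≤ n) (hj : j < n) (h1 : j ≠ i) (h2 : j + 1 ≠ i) :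
    Commute (T j) (affineY n T Ti π i) := by
  induction i using Nat.strong_induction_on generalizing j with
  | _ i ih =>
    match i with
    | 0 =>
      obtain ⟨j, rfl⟩ : ∃ k, j = k + 1 := ⟨j - 1, by omega⟩
      have : upProd T 0 n * T j = T (j + 1) * upProd T 0 n :=
        h.toBraidRel.upProd_mul (Nat.zero_le _) (by omega) (by omega)
      simp only [affineY, upProd_zero, mul_one, Nat.sub_zero]
      rw [Commute, SemiconjBy, ← mul_assoc, ← this, mul_assoc, mul_assoc, h.pi_mul j hj]
    | i + 1 =>
      rw [h.affineY_succ (by omega)]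
      by_cases hji : j + 1 = i
      · subst hji
        rw [h.affineY_succ (by omega)]
        have c : Commute (T (j + 1)) (affineY n T Ti π j) :=
          ih j (by omega) (by omega) (by omega) (by omega) (by omega)
        have hb := h.braid j (by omega)
        have b1 : T j * Ti (j + 1) * Ti j = Ti (j + 1) * Ti j * T (j + 1) := by
          calc T j * Ti (j + 1) * Ti j
              = Ti (j + 1) * Ti j * (T j * T (j + 1) * T j) * Ti (j + 1) * Ti j := by
                rw [show Ti (j + 1) * Ti j * (T j * T (j + 1) * T j) * Ti (j + 1) * Ti j
                  = Ti (j + 1) * (Ti j * T j) * T (j + 1) * T j * Ti (j + 1) * Ti j by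
                    noncomm_ring, h.inv_mul j (by omega), mul_one, h.inv_mul (j + 1) (by omega),
                  one_mul]
            _ = Ti (j + 1) * Ti j * T (j + 1) * (T j * (T (j + 1) * Ti (j + 1)) * Ti j) := by
                rw [hb]; noncomm_ring
            _ = _ := by
                rw [h.mul_inv (j + 1) (by omega), mul_one, h.mul_inv j (by omega), mul_one]
        have b2 : Ti j * Ti (j + 1) * T j = T (j + 1) * (Ti j * Ti (j + 1)) := by
          calc Ti j * Ti (j + 1) * T j
              = Ti j * Ti (j + 1) * (T j * T (j + 1) * T j) * (Ti j * Ti (j + 1)) := by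
                rw [show Ti j * Ti (j + 1) * (T j * T (j + 1) * T j) * (Ti j * Ti (j + 1))
                  = Ti j * Ti (j + 1) * T j * T (j + 1) * (T j * Ti j) * Ti (j + 1) by
                    noncomm_ring, h.mul_inv j (by omega), mul_one, mul_assoc _ (T (j + 1)),
                    h.mul_inv (j + 1) (by omega), mul_one]
            _ = Ti j * (Ti (j + 1) * T (j + 1)) * T j * T (j + 1) * (Ti j * Ti (j + 1)) := by
                rw [hb]; noncomm_ring
            _ = _ := by
                rw [h.inv_mul (j + 1) (by omega), mul_one, h.inv_mul j (by omega), one_mul]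
        rw [Commute, SemiconjBy]
        calc T j * (Ti (j + 1) * (Ti j * affineY n T Ti π j * Ti j) * Ti (j + 1))
            = (T j * Ti (j + 1) * Ti j) * affineY n T Ti π j * (Ti j * Ti (j + 1)) := by
              noncomm_ring
          _ = Ti (j + 1) * Ti j * (T (j + 1) * affineY n T Ti π j) * (Ti j * Ti (j + 1)) := by
              rw [b1]; noncomm_ring
          _ = Ti (j + 1) * Ti j * affineY n T Ti π j * (T (j + 1) * (Ti j * Ti (j + 1))) := by
              rw [c.eq]; noncomm_ring
          _ = _ := by rw [← b2]; noncomm_ring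
      · have c1 : Commute (T j) (Ti i) := h.commute_inv (by omega)
          (h.toBraidRel.far' hj (by omega) (by omega))
        have c2 : Commute (T j) (affineY n T Ti π i) :=
          ih i (by omega) (by omega) hj (by omega) (by omega)
        exact (c1.mul_right c2).mul_right c1

/-- Since `Y_0 = T_0 (D π)` and `Y_1 = (D π) T_0⁻¹`, the claim amounts to `T_0` commuting with `(D
π)²`. Collecting both `π` on the right reduces this to the braid relations and the rule for `π π
T_0`. -/
theorem commute_affineY_zero_one (hn : 0 < n) :
    Commute (affineY n T Ti π 0) (affineY n T Ti π 1) := by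
  obtain ⟨m, rfl⟩ : ∃ m, n = m + 1 := ⟨n - 1, by omega⟩
  set D := upProd T 1 m
  have e0 : affineY (m + 1) T Ti π 0 = T 0 * (D * π) := by
    simp [affineY, upProd_zero, D, upProd_succ_left, mul_assoc]
  have e1 : affineY (m + 1) T Ti π 1 = D * π * Ti 0 := by
    simp [affineY, D, upProd_succ_left, upProd_zero]
  have hD : ∀ k, k ≤ m → π * upProd T 1 k = upProd T 0 k * π := by
    intro k hk
    induction k with
    | zero => simp [upProd_zero]
    | succ k ih =>
      rw [upProd_succ, upProd_succ, ← mul_assoc, ih (by omega), mul_assoc, zero_add,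
        Nat.add_comm 1 k, h.pi_mul k (by omega), mul_assoc]
  have hC : ∀ k, k ≤ m → upProd T 0 (m + 1) * upProd T 0 k
      = upProd T 1 k * upProd T 0 (m + 1) := by
    intro k hk
    induction k with
    | zero => simp [upProd_zero]
    | succ k ih =>
      rw [upProd_succ T 0 k, ← mul_assoc, ih (by omega), mul_assoc, zero_add,
        h.toBraidRel.upProd_mul (Nat.zero_le _) (by omega) (by omega), ← mul_assoc,
        upProd_succ T 1 k, Nat.add_comm 1 k]
  have sq : D * π * (D * π) = D * upProd T 0 m * (π * π) := by
    calc D * π * (D * π) = D * (π * upProd T 1 m) * π := by simp only [D, mul_assoc]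
      _ = _ := by rw [hD m le_rfl]; noncomm_ring
  have key : T 0 * (D * π * (D * π)) = D * π * (D * π) * T 0 := by
    calc T 0 * (D * π * (D * π)) = upProd T 0 (m + 1) * upProd T 0 m * (π * π) := by
          rw [sq, upProd_succ_left]; simp only [D, zero_add, mul_assoc]
      _ = D * upProd T 0 m * (T m * (π * π)) := by
          rw [hC m le_rfl, upProd_succ, zero_add]; simp only [D, mul_assoc]
      _ = _ := by
          have := h.pi_pi_mul (by omega)
          rw [Nat.add_sub_cancel] at this
          rw [← this, sq]; noncomm_ring
  rw [e0, e1, Commute, SemiconjBy]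
  calc T 0 * (D * π) * (D * π * Ti 0) = T 0 * (D * π * (D * π)) * Ti 0 := by noncomm_ring
    _ = D * π * (D * π) * (T 0 * Ti 0) := by rw [key]; noncomm_ring
    _ = D * π * (Ti 0 * T 0) * (D * π) := by
      rw [h.mul_inv 0 (by omega), h.inv_mul 0 (by omega), mul_one, mul_one]
    _ = _ := by noncomm_ring

/-- Everything follows from the pair `Y_0`, `Y_1`, because `Y_{i+1}` is `Y_i` between two copies of
`Ti i` and the latter commutes with the other generator involved. -/
theorem commute_affineY_aux {i j : ℕ} (hij : i < j) (hj : j ≤ n) :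
    Commute (affineY n T Ti π i) (affineY n T Ti π j) := by
  induction i generalizing j with
  | zero =>
    induction j with
    | zero => omega
    | succ j ih =>
      rcases Nat.eq_zero_or_pos j with rfl | hj0
      · exact h.commute_affineY_zero_one (by omega)
      · rw [h.affineY_succ (by omega)]
        have c : Commute (affineY n T Ti π 0) (Ti j) := h.commute_inv (by omega)
          (h.commute_T_affineY (by omega) (by omega) (by omega) (by omega)).symm
        exact (c.mul_right (ih hj0 (by omega))).mul_right c
  | succ i ih =>
    rw [h.affineY_succ (i := i) (by omega)]
    have c : Commute (affineY n T Ti π j) (Ti i) := h.commute_inv (by omega)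
      (h.commute_T_affineY hj (by omega) (by omega) (by omega)).symm
    exact ((c.mul_right (ih (by omega) hj).symm).mul_right c).symm

theorem commute_affineY {i j : ℕ} (hi : i ≤ n) (hj : j ≤ n) :
    Commute (affineY n T Ti π i) (affineY n T Ti π j) := by
  rcases lt_trichotomy i j with hij | rfl | hij
  · exact h.commute_affineY_aux hij hj
  · exact Commute.refl _
  · exact (h.commute_affineY_aux hij hi).symm

/-- The element dual to `π` intertwines `Y_{i+1}` and `Y_i`; here `x` stands for `z_0`. -/
theorem downProd_mul_affineY_succ {x x' : A} (hx : ∀ i, 0 < i → i < n → Commute x (T i))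
    (hx' : 0 < n → T 0 * x * T 0 = x') (hpi : π * x' = x * π) {i : ℕ} (hi : i < n) :
    downProd T 0 n * x * affineY n T Ti π (i + 1) = affineY n T Ti π i * (downProd T 0 n * x) := by
  induction i with
  | zero =>
    obtain ⟨m, rfl⟩ : ∃ m, n = m + 1 := ⟨n - 1, by omega⟩
    have hc : ∀ k, k ≤ m → downProd T 0 (m + 1) * upProd T 1 k
        = upProd T 0 k * downProd T 0 (m + 1) := by
      intro k hk
      induction k with
      | zero => simp [upProd_zero]
      | succ k ih =>
        rw [upProd_succ, ← mul_assoc, ih (by omega), mul_assoc, Nat.add_comm 1 k,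
          ← h.toBraidRel.mul_downProd (Nat.zero_le _) (by omega) (by omega), upProd_succ,
          zero_add, mul_assoc]
    have hD : ∀ k, k ≤ m → π * downProd T 1 k = downProd T 0 k * π := by
      intro k hk
      induction k with
      | zero => simp [downProd_zero]
      | succ k ih =>
        rw [downProd_succ, downProd_succ, ← mul_assoc, Nat.add_comm 1 k, h.pi_mul k (by omega),
          mul_assoc, ih (by omega), zero_add, mul_assoc]
    have cx : Commute x (upProd T 1 m) := commute_upProd fun k h1 h2 => hx k (by omega) (by omega)
    have e0 : affineY (m + 1) T Ti π 0 = upProd T 0 (m + 1) * π := by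
      simp [affineY, upProd_zero]
    have e1 : affineY (m + 1) T Ti π 1 = upProd T 1 m * π * Ti 0 := by
      simp [affineY, upProd_succ_left, upProd_zero]
    have lhs : downProd T 0 (m + 1) * x * affineY (m + 1) T Ti π 1
        = upProd T 0 m * downProd T 0 (m + 1) * x * π * Ti 0 := by
      calc _ = downProd T 0 (m + 1) * (x * upProd T 1 m) * π * Ti 0 := by rw [e1]; noncomm_ring
        _ = (downProd T 0 (m + 1) * upProd T 1 m) * x * π * Ti 0 := by rw [cx.eq]; noncomm_ring
        _ = _ := by rw [hc m le_rfl]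
    have rhs : affineY (m + 1) T Ti π 0 * (downProd T 0 (m + 1) * x)
        = upProd T 0 (m + 1) * downProd T 0 m * (x * π) * Ti 0 := by
      calc _ = upProd T 0 (m + 1) * (π * downProd T 1 m) * (T 0 * x) := by
            rw [e0, downProd_succ_left]; noncomm_ring
        _ = upProd T 0 (m + 1) * downProd T 0 m * π * (T 0 * x * (T 0 * Ti 0)) := by
            rw [hD m le_rfl, h.mul_inv 0 (by omega), mul_one]; noncomm_ring
        _ = upProd T 0 (m + 1) * downProd T 0 m * (π * (T 0 * x * T 0)) * Ti 0 := by
            noncomm_ring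
        _ = _ := by rw [hx' (by omega), hpi]
    rw [zero_add, lhs, rhs, upProd_succ, downProd_succ, zero_add]
    noncomm_ring
  | succ i ih =>
    -- The shift element also lowers the index of the Hecke generators, so conjugation transports
    -- the relation from `i` to `i + 1`.
    have cT : downProd T 0 n * x * T (i + 1) = T i * (downProd T 0 n * x) := by
      rw [mul_assoc, (hx _ (by omega) (by omega)).eq, ← mul_assoc, ← mul_assoc,
        ← h.toBraidRel.mul_downProd (Nat.zero_le _) (by omega) (by omega)]
    have cTi : downProd T 0 n * x * Ti (i + 1) = Ti i * (downProd T 0 n * x) := by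
      calc downProd T 0 n * x * Ti (i + 1)
          = Ti i * T i * (downProd T 0 n * x) * Ti (i + 1) := by
            rw [h.inv_mul i (by omega), one_mul]
        _ = Ti i * (T i * (downProd T 0 n * x)) * Ti (i + 1) := by noncomm_ring
        _ = Ti i * (downProd T 0 n * x) * (T (i + 1) * Ti (i + 1)) := by
            rw [← cT]; noncomm_ring
        _ = _ := by rw [h.mul_inv (i + 1) (by omega), mul_one]
    rw [h.affineY_succ (i := i + 1) (by omega)]
    conv_rhs => rw [h.affineY_succ (i := i) (by omega)]
    set Z := downProd T 0 n * x
    calc Z * (Ti (i + 1) * affineY n T Ti π (i + 1) * Ti (i + 1))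
        = Z * Ti (i + 1) * affineY n T Ti π (i + 1) * Ti (i + 1) := by noncomm_ring
      _ = Ti i * (Z * affineY n T Ti π (i + 1)) * Ti (i + 1) := by rw [cTi]; noncomm_ring
      _ = Ti i * affineY n T Ti π i * (Z * Ti (i + 1)) := by
        rw [ih (by omega)]; noncomm_ring
      _ = _ := by rw [cTi]; noncomm_ring

end AffineRel

end AffineHecke


/-! ## The generators `Y_i` and their elementary symmetric functions -/

section ElementarySymmetric

variable {A : Type*} [Ring A] {N : ℕ}

open Polynomial in
-- The `y i` need not commute; the increasing order of the list matches the sorted order in which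
-- each subset is multiplied.
theorem coeff_prod_one_add (y : Fin N → A) (l : List (Fin N)) (hl : l.Pairwise (· < ·)) (r : ℕ) :
    ((l.map fun i => (1 + X * C (y i) : A[X])).prod).coeff r
      = ∑ S ∈ Finset.powersetCard r l.toFinset, ((S.sort (· ≤ ·)).map y).prod := by
  induction l generalizing r with
  | nil =>
    rcases r with _ | r
    · simp
    · rw [List.toFinset_nil, Finset.powersetCard_eq_empty.2 (by simp)]
      simp [coeff_one]
  | cons a l ih =>
    rw [List.pairwise_cons] at hl
    have ha : a ∉ l.toFinset := fun h => lt_irrefl _ (hl.1 a (List.mem_toFinset.1 h))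
    rw [List.map_cons, List.prod_cons, add_mul, one_mul, coeff_add, ih hl.2, List.toFinset_cons]
    rcases r with _ | r
    · simp [mul_assoc]
    · rw [mul_assoc, coeff_X_mul, coeff_C_mul, ih hl.2, Finset.powersetCard_succ_insert ha,
        Finset.sum_union, Finset.sum_image, Finset.mul_sum]
      · congr 1
        refine Finset.sum_congr rfl fun S hS => ?_
        have hS' : S ⊆ l.toFinset := (Finset.mem_powersetCard.1 hS).1
        rw [Finset.sort_insert (r := (· ≤ ·)) (fun b hb => (hl.1 b (List.mem_toFinset.1 (hS' hb))).le)
          (fun h => ha (hS' h)), List.map_cons, List.prod_cons]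
      · intro S hS S' hS' h
        have hS := fun h => ha ((Finset.mem_powersetCard.1 (Finset.mem_coe.1 hS)).1 h)
        have hS' := fun h => ha ((Finset.mem_powersetCard.1 (Finset.mem_coe.1 hS')).1 h)
        rw [← Finset.erase_insert hS, ← Finset.erase_insert hS', h]
      · rw [Finset.disjoint_left]
        intro S hS hS'
        obtain ⟨S', _, rfl⟩ := Finset.mem_image.1 hS'
        exact ha ((Finset.mem_powersetCard.1 hS).1 (Finset.mem_insert_self _ _))

/-- The generating function `∏ (1 + X y_k)` of the elementary symmetric functions. -/
def esymmGen (y : ℕ → A) (a n : ℕ) : Polynomial A :=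
  upProd (fun k => 1 + Polynomial.X * Polynomial.C (y k)) a n

theorem map_finRange_eq {α : Type*} (f : ℕ → α) :
    (List.finRange N).map (fun i : Fin N => f i) = (List.range' 0 N).map f := by
  rw [← List.range_eq_range', ← List.map_coe_finRange_eq_range, List.map_map]; rfl

theorem esymmOp_eq_coeff (y : ℕ → A) (r : ℕ) :
    esymmOp (fun i : Fin N => y i) r = (esymmGen y 0 N).coeff r := by
  rw [esymmGen, upProd, ← map_finRange_eq, coeff_prod_one_add (fun i : Fin N => y i) _
    (List.pairwise_lt_finRange N)]
  simp [esymmOp]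

open Polynomial in
-- The two neighbouring factors multiply to a quadratic polynomial in `X` whose coefficients are
-- `1`, `y_i + y_{i+1}` and `y_i y_{i+1}`, so no commutation with the individual `y_i`, `y_{i+1}` is
-- needed.
theorem commute_esymmGen {y : ℕ → A} {t : A} {n i : ℕ} (hi : i + 1 < n)
    (h : ∀ j, j < n → j ≠ i → j ≠ i + 1 → Commute t (y j)) (h1 : Commute t (y i + y (i + 1)))
    (h2 : Commute t (y i * y (i + 1))) : Commute (C t) (esymmGen y 0 n) := by
  obtain ⟨l, rfl⟩ : ∃ l, n = i + (2 + l) := ⟨n - i - 2, by omega⟩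
  have hC : ∀ j, j < i + (2 + l) → j ≠ i → j ≠ i + 1 → Commute (C t) (1 + X * C (y j)) := by
    intro j h1 h2 h3
    refine (Commute.one_right _).add_right ((commute_X _).symm.mul_right ?_)
    exact (h j h1 h2 h3).map (C : A →+* A[X])
  rw [esymmGen, upProd_add, upProd_add]
  refine (commute_upProd fun j h1 h2 => hC j (by omega) (by omega) (by omega)).mul_right
    (Commute.mul_right ?_ (commute_upProd fun j h1 h2 => hC j (by omega) (by omega) (by omega)))
  have e : upProd (fun k => 1 + X * C (y k)) (0 + i) 2
      = 1 + X * C (y i + y (i + 1)) + X * (X * C (y i * y (i + 1))) := by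
    rw [upProd_succ, upProd_succ, upProd_zero, one_mul, zero_add, add_zero, C_add, C_mul, mul_add,
      add_mul, add_mul, one_mul, mul_one, one_mul]
    have : X * C (y i) * (X * C (y (i + 1))) = X * (X * (C (y i) * C (y (i + 1)))) := by
      rw [mul_assoc, ← mul_assoc (C (y i)), ← X_mul_C, mul_assoc]
    rw [this, mul_add]; abel
  rw [e]
  refine ((Commute.one_right _).add_right ((commute_X _).symm.mul_right ?_)).add_right
    ((commute_X _).symm.mul_right ((commute_X _).symm.mul_right ?_))
  · exact h1.map (C : A →+* A[X])
  · exact h2.map (C : A →+* A[X])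

theorem commute_esymmOp {y : ℕ → A} {t : A} {i : ℕ} (hi : i + 1 < N)
    (h : ∀ j, j < N → j ≠ i → j ≠ i + 1 → Commute t (y j)) (h1 : Commute t (y i + y (i + 1)))
    (h2 : Commute t (y i * y (i + 1))) (r : ℕ) :
    Commute t (esymmOp (fun i : Fin N => y i) r) := by
  have := congrArg (fun f => Polynomial.coeff f r) (commute_esymmGen hi h h1 h2).eq
  simp only [Polynomial.coeff_C_mul, Polynomial.coeff_mul_C] at this
  rw [esymmOp_eq_coeff]; exact this

theorem commute_esymmOp_of_forall {y : Fin N → A} {t : A} (h : ∀ j, Commute t (y j)) (r : ℕ) :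
    Commute t (esymmOp y r) := by
  refine Commute.sum_right _ _ _ fun S _ => ?_
  refine Commute.list_prod_right _ _ fun x hx => ?_
  obtain ⟨j, _, rfl⟩ := List.mem_map.1 hx
  exact h j

/-- By the quadratic relation both products equal `κ t y t + y t + t y`. -/
theorem commute_add_conj {R : Type*} [Ring R] [Algebra ℂ R] {t x y : R} {κ : ℂ}
    (ht : t * t = κ • t + 1) (hx : t * y * t = x) : Commute t (x + y) := by
  subst hx
  rw [Commute, SemiconjBy]
  have e1 : t * (t * y * t) = (t * t) * y * t := by noncomm_ring
  have e2 : t * y * t * t = t * y * (t * t) := by noncomm_ring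
  rw [mul_add, add_mul, e1, e2, ht]
  simp only [add_mul, mul_add, one_mul, mul_one, smul_mul_assoc, mul_smul_comm]
  abel

theorem commute_mul_conj {R : Type*} [Ring R] {t x y : R} (hx : t * y * t = x)
    (hxy : Commute x y) : Commute t (x * y) := by
  rw [Commute, SemiconjBy]
  nth_rw 1 [hxy.eq]
  rw [← hx]; noncomm_ring

end ElementarySymmetric

/-! ### The polynomial representation of the affine Hecke algebra -/

section Generators

variable {N : ℕ} [NeZero N]

theorem fin_mk_add_one {i : ℕ} (h : i + 1 < N) :
    (⟨i, (Nat.lt_succ_self i).trans h⟩ : Fin N) + 1 = ⟨i + 1, h⟩ := by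
  apply Fin.ext
  rw [Fin.val_add, Fin.val_one', Nat.mod_eq_of_lt (a := 1) (by omega), Nat.mod_eq_of_lt h]

/-- `Tpol q i (i + 1)` with a natural index. -/
def heckeT (N : ℕ) (q : ℂ) (i : ℕ) : Module.End ℂ (Pol N) :=
  if h : i + 1 < N then Tpol q ⟨i, (Nat.lt_succ_self i).trans h⟩ ⟨i + 1, h⟩ else 1

/-- The inverse of `heckeT N q i`. -/
def heckeTInv (N : ℕ) (q : ℂ) (i : ℕ) : Module.End ℂ (Pol N) :=
  if h : i + 1 < N then TpolInv q ⟨i, (Nat.lt_succ_self i).trans h⟩ ⟨i + 1, h⟩ else 1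

theorem heckeT_of_lt (q : ℂ) {i : ℕ} (h : i + 1 < N) :
    heckeT N q i = Tpol q ⟨i, (Nat.lt_succ_self i).trans h⟩ ⟨i + 1, h⟩ := dif_pos h

theorem heckeT_mul_self {q : ℂ} (hq : q ≠ 0) {i : ℕ} (h : i + 1 < N) :
    heckeT N q i * heckeT N q i = (q - q⁻¹) • heckeT N q i + 1 := by
  rw [heckeT_of_lt q h]
  exact Tpol_mul_self hq (by simp)

theorem braidRel_heckeT {q : ℂ} (hq : q ≠ 0) : BraidRel (N - 1) (heckeT N q) where
  braid i hi := by
    rw [heckeT_of_lt q (by omega : i + 1 < N), heckeT_of_lt q (by omega : i + 1 + 1 < N)]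
    exact Tpol_braid hq (by simp) (by simp) (by simp [Fin.ext_iff]; omega)
  far i j hij hj := by
    rw [heckeT_of_lt q (by omega : i + 1 < N), heckeT_of_lt q (by omega : j + 1 < N)]
    refine Tpol_commute q ?_ ?_ ?_ ?_ ?_ ?_ <;> simp [Fin.ext_iff] <;> omega

theorem affineRel_heckeT {q p : ℂ} (hq : q ≠ 0) (hp : p ≠ 0) :
    AffineRel (N - 1) (heckeT N q) (heckeTInv N q) (piOp p) where
  toBraidRel := braidRel_heckeT hq
  -- The abstract relations have rank `n = N - 1`, so that the generators `0, …, N - 2` are exactly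
  -- those with `i + 1 < N`.
  mul_inv i hi := by
    rw [heckeT, heckeTInv, dif_pos (by omega), dif_pos (by omega)]
    exact Tpol_mul_TpolInv hq (by simp)
  inv_mul i hi := by
    rw [heckeT, heckeTInv, dif_pos (by omega), dif_pos (by omega)]
    exact TpolInv_mul_Tpol hq (by simp)
  pi_mul i hi := by
    have h1 : i + 1 < N := by omega
    have h2 : i + 1 + 1 < N := by omega
    rw [heckeT_of_lt q h1, heckeT_of_lt q h2, piOp_mul_Tpol q p (by simp [Fin.ext_iff])
      (by simp [Fin.ext_iff]) (by simp [Fin.ext_iff]), ← fin_mk_add_one h2, ← fin_mk_add_one h1,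
      add_sub_cancel_right, add_sub_cancel_right]
  pi_pi_mul hN := by
    obtain ⟨m, rfl⟩ : ∃ m, N = m + 2 := ⟨N - 2, by omega⟩
    have h1 : (1 : Fin (m + 2)) ≠ 0 := by simp
    have e0 : heckeT (m + 2) q 0 = Tpol q 0 1 := by
      rw [heckeT_of_lt q (by omega : 0 + 1 < m + 2)]; rfl
    have e1 : heckeT (m + 2) q (m + 2 - 1 - 1) = Tpol q (-1 - 1) (-1 : Fin (m + 2)) := by
      have h2 : (⟨m + 1, by omega⟩ : Fin (m + 2)) = -1 := by
        rw [eq_neg_iff_add_eq_zero]; apply Fin.ext; simp [Fin.val_add]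
      have h3 : (⟨m, by omega⟩ : Fin (m + 2)) = -1 - 1 := by
        rw [eq_sub_iff_add_eq, fin_mk_add_one (by omega), h2]
      rw [heckeT_of_lt q (by omega : m + 2 - 1 - 1 + 1 < m + 2), ← h3, ← h2]
      rfl
    rw [e0, e1, piOp_piOp_mul_Tpol q hp h1]

theorem filter_range'_eq {m k n : ℕ} (P : ℕ → Prop) [DecidablePred P]
    (h1 : ∀ j, j < m → ¬P j) (h2 : ∀ j, m ≤ j → j < m + k → P j)
    (h3 : ∀ j, m + k ≤ j → j < m + k + n → ¬P j) :
    (List.range' 0 (m + k + n)).filter (fun j => decide (P j)) = List.range' m k := by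
  have e : List.range' 0 (m + k + n) = List.range' 0 m ++ List.range' m k
      ++ List.range' (m + k) n := by
    rw [← List.range'_append_1 (m := m + k) (n := n), ← List.range'_append_1 (m := m) (n := k)]
    simp only [zero_add]
  rw [e, List.filter_append, List.filter_append, List.filter_eq_nil_iff.2, List.filter_eq_self.2,
    List.filter_eq_nil_iff.2]
  · simp
  · intro j hj; simp only [List.mem_range'_1] at hj; simpa using h3 j hj.1 hj.2
  · intro j hj; simp only [List.mem_range'_1] at hj; simpa using h2 j hj.1 hj.2
  · intro j hj; simp only [List.mem_range'_1] at hj; simpa using h1 j (by omega)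

theorem map_filter_finRange {α : Type*} (f : Fin N → α) (g : ℕ → α) (P : Fin N → Prop)
    (Q : ℕ → Prop) [DecidablePred P] [DecidablePred Q] (hPQ : ∀ i : Fin N, P i ↔ Q i)
    (hfg : ∀ i : Fin N, P i → f i = g i) :
    ((List.finRange N).filter fun i => decide (P i)).map f
      = ((List.range' 0 N).filter fun i => decide (Q i)).map g := by
  rw [← List.range_eq_range', ← List.map_coe_finRange_eq_range, List.filter_map, List.map_map]
  have : (List.finRange N).filter ((fun i => decide (Q i)) ∘ (fun i : Fin N => (i : ℕ)))
      = (List.finRange N).filter fun i => decide (P i) :=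
    List.filter_congr fun i _ => by simp [hPQ]
  rw [this]
  exact List.map_congr_left fun i hi => hfg i (by simpa using (List.mem_filter.1 hi).2)

/-- `Y q p i` with a natural index. -/
def natY (N : ℕ) [NeZero N] (q p : ℂ) (i : ℕ) : Module.End ℂ (Pol N) :=
  affineY (N - 1) (heckeT N q) (heckeTInv N q) (piOp p) i

theorem Y_eq_natY (q p : ℂ) (i : Fin N) : Y q p i = natY N q p i := by
  obtain ⟨i, hi⟩ := i
  have hN := NeZero.ne N
  have e1 := map_filter_finRange (fun k : Fin N => Tpol q k (k + 1)) (heckeT N q)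
    (fun k => (⟨i, hi⟩ : Fin N) ≤ k ∧ (k : ℕ) + 1 < N) (fun k => i ≤ k ∧ k + 1 < N)
    (fun k => by simp [Fin.le_def]) (fun k hk => by
      rw [heckeT_of_lt q hk.2, ← fin_mk_add_one hk.2])
  have e2 := map_filter_finRange (fun k : Fin N => TpolInv q k (k + 1)) (heckeTInv N q)
    (fun k => k < (⟨i, hi⟩ : Fin N)) (fun k => k < i)
    (fun k => by simp [Fin.lt_def]) (fun k hk => by
      have : (k : ℕ) + 1 < N := by simp only [Fin.lt_def] at hk; omega
      rw [heckeTInv, dif_pos this, ← fin_mk_add_one this])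
  have f1 := filter_range'_eq (m := i) (k := N - 1 - i) (n := 1) (fun k => i ≤ k ∧ k + 1 < N)
    (fun j h => by omega) (fun j h h' => by omega) (fun j h h' => by omega)
  have f2 := filter_range'_eq (m := 0) (k := i) (n := N - i) (fun k => k < i)
    (fun j h => by omega) (fun j h h' => by omega) (fun j h h' => by omega)
  rw [show i + (N - 1 - i) + 1 = N by omega] at f1
  rw [show 0 + i + (N - i) = N by omega] at f2
  rw [f1] at e1
  rw [f2] at e2
  rw [Y, e1, e2]
  rfl

theorem isUnit_piOp {p : ℂ} (hp : p ≠ 0) : IsUnit (piOp p : Module.End ℂ (Pol N)) := by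
  -- The inverse shift divides by `p` exactly when the index wraps around.
  let σ : Module.End ℂ (Pol N) := (MvPolynomial.aeval fun j : Fin N =>
    if j + 1 = 0 then MvPolynomial.C p⁻¹ * (MvPolynomial.X (j + 1) : Pol N)
    else MvPolynomial.X (j + 1)).toLinearMap
  have h1 : piOp p * σ = 1 := by
    refine LinearMap.ext fun F => ?_
    have : ((MvPolynomial.aeval fun j : Fin N =>
        if j = 0 then MvPolynomial.C p * (MvPolynomial.X (j - 1) : Pol N)
        else MvPolynomial.X (j - 1)).comp (MvPolynomial.aeval fun j : Fin N =>
        if j + 1 = 0 then MvPolynomial.C p⁻¹ * (MvPolynomial.X (j + 1) : Pol N)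
        else MvPolynomial.X (j + 1)) : Pol N →ₐ[ℂ] Pol N) = AlgHom.id ℂ _ := by
      refine MvPolynomial.algHom_ext fun j => ?_
      by_cases hj : j + 1 = 0
      · have : (0 - 1 : Fin N) = j := by rw [← hj]; simp
        simp only [AlgHom.comp_apply, MvPolynomial.aeval_X, hj, if_true, map_mul, this,
          MvPolynomial.algHom_C, MvPolynomial.algebraMap_eq, AlgHom.id_apply]
        rw [← mul_assoc, ← map_mul, inv_mul_cancel₀ hp, map_one, one_mul]
      · simp [hj]
    exact DFunLike.congr_fun this F
  have h2 : σ * piOp p = 1 := by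
    refine LinearMap.ext fun F => ?_
    have : ((MvPolynomial.aeval fun j : Fin N =>
        if j + 1 = 0 then MvPolynomial.C p⁻¹ * (MvPolynomial.X (j + 1) : Pol N)
        else MvPolynomial.X (j + 1)).comp (MvPolynomial.aeval fun j : Fin N =>
        if j = 0 then MvPolynomial.C p * (MvPolynomial.X (j - 1) : Pol N)
        else MvPolynomial.X (j - 1)) : Pol N →ₐ[ℂ] Pol N) = AlgHom.id ℂ _ := by
      refine MvPolynomial.algHom_ext fun j => ?_
      by_cases hj : j = 0
      · subst hj
        simp only [AlgHom.comp_apply, MvPolynomial.aeval_X, if_true, map_mul, sub_add_cancel,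
          MvPolynomial.algHom_C, MvPolynomial.algebraMap_eq, AlgHom.id_apply]
        rw [← mul_assoc, ← map_mul, mul_inv_cancel₀ hp, map_one, one_mul]
      · simp [hj]
    exact DFunLike.congr_fun this F
  exact ⟨⟨_, _, h1, h2⟩, rfl⟩

section

variable {q p : ℂ} (hq : q ≠ 0) (hp : p ≠ 0)
include hq

theorem isUnit_heckeT (i : ℕ) : IsUnit (heckeT N q i) := by
  by_cases h : i + 1 < N
  · rw [heckeT_of_lt q h]
    exact ⟨⟨_, _, Tpol_mul_TpolInv hq (by simp), TpolInv_mul_Tpol hq (by simp)⟩, rfl⟩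
  · rw [heckeT, dif_neg h]; exact isUnit_one

theorem isUnit_heckeTInv (i : ℕ) : IsUnit (heckeTInv N q i) := by
  by_cases h : i + 1 < N
  · rw [heckeTInv, dif_pos h]
    exact ⟨⟨_, _, TpolInv_mul_Tpol hq (by simp), Tpol_mul_TpolInv hq (by simp)⟩, rfl⟩
  · rw [heckeTInv, dif_neg h]; exact isUnit_one

include hp

theorem isUnit_natY (i : ℕ) : IsUnit (natY N q p i) := by
  have hprod : ∀ (f : ℕ → Module.End ℂ (Pol N)), (∀ k, IsUnit (f k)) → ∀ a n,
      IsUnit (upProd f a n) := by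
    intro f hf a n
    induction n with
    | zero => rw [upProd_zero]; exact isUnit_one
    | succ n ih => rw [upProd_succ]; exact ih.mul (hf _)
  exact ((hprod _ (isUnit_heckeT hq) _ _).mul (isUnit_piOp hp)).mul
    (hprod _ (isUnit_heckeTInv hq) _ _)

theorem isUnit_Y (i : Fin N) : IsUnit (Y q p i) := by
  rw [Y_eq_natY]; exact isUnit_natY hq hp i

theorem commute_Y (i j : Fin N) : Commute (Y q p i) (Y q p j) := by
  rw [Y_eq_natY, Y_eq_natY]
  exact (affineRel_heckeT hq hp).commute_affineY (by omega) (by omega)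

theorem commute_heckeT_natY {i j : ℕ} (hi : i < N) (hj : j + 1 < N) (h1 : j ≠ i)
    (h2 : j + 1 ≠ i) : Commute (heckeT N q j) (natY N q p i) :=
  (affineRel_heckeT hq hp).commute_T_affineY (by omega) (by omega) h1 h2

theorem heckeT_mul_natY_mul {i : ℕ} (hi : i + 1 < N) :
    heckeT N q i * natY N q p (i + 1) * heckeT N q i = natY N q p i :=
  (affineRel_heckeT hq hp).mul_affineY_succ_mul (by omega)

/-- This is the centrality of symmetric functions of the `Y_i` with respect to the finite Hecke
algebra: `T_i` sees only the sum and the product of `Y_i` and `Y_{i+1}`. -/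
theorem commute_heckeT_esymmOp {i : ℕ} (hi : i + 1 < N) (r : ℕ) :
    Commute (heckeT N q i) (esymmOp (Y q p) r) := by
  rw [show (Y q p : Fin N → _) = fun i : Fin N => natY N q p i from funext (Y_eq_natY q p)]
  have h1 := heckeT_mul_natY_mul (N := N) hq hp hi
  refine commute_esymmOp hi (fun j hj hji hji' => commute_heckeT_natY hq hp hj hi (by omega)
    (by omega)) (commute_add_conj (heckeT_mul_self hq hi) h1) (commute_mul_conj h1 ?_) r
  exact (affineRel_heckeT hq hp).commute_affineY (by omega) (by omega)

/-- Inverting `T_i Y_{i+1} T_i = Y_i` gives `T_i Y_i⁻¹ T_i = Y_{i+1}⁻¹`, so the same argument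
applies with the two indices exchanged. -/
theorem commute_heckeT_esymmOp_inverse {i : ℕ} (hi : i + 1 < N) (r : ℕ) :
    Commute (heckeT N q i) (esymmOp (fun j => Ring.inverse (Y q p j)) r) := by
  rw [show (fun j : Fin N => Ring.inverse (Y q p j)) = fun i : Fin N =>
    Ring.inverse (natY N q p i) from funext fun j => by rw [Y_eq_natY]]
  have h1 := heckeT_mul_natY_mul (N := N) hq hp hi
  have hu := fun j => isUnit_natY (N := N) hq hp j
  have hc : Commute (natY N q p (i + 1)) (natY N q p i) :=
    (affineRel_heckeT hq hp).commute_affineY (by omega) (by omega)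
  have h2 : heckeT N q i * Ring.inverse (natY N q p i) * heckeT N q i
      = Ring.inverse (natY N q p (i + 1)) := by
    obtain ⟨y, hy⟩ := hu (i + 1)
    obtain ⟨t, ht⟩ := isUnit_heckeT (N := N) hq i
    rw [← h1, ← hy, ← ht, ← Units.val_mul, ← Units.val_mul, Ring.inverse_unit, Ring.inverse_unit,
      ← Units.val_mul, ← Units.val_mul]
    congr 1; group
  have hc' := hc.ringInverse_ringInverse
  have h3 := commute_add_conj (heckeT_mul_self hq hi) h2
  have h4 := commute_mul_conj h2 hc'
  rw [add_comm] at h3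
  rw [hc'.eq] at h4
  refine commute_esymmOp (y := fun k => Ring.inverse (natY N q p k)) hi
    (fun j hj hji hji' => ?_) h3 h4 r
  obtain ⟨y, hy⟩ := hu j
  rw [← hy, Ring.inverse_unit]
  exact Commute.units_inv_right (hy ▸ commute_heckeT_natY hq hp hj hi (by omega) (by omega))

end

end Generators


/-! ## Operators on spins -/

section SpinOperators

variable {N : ℕ}

/-- An operator on polynomials, extended by the identity on spins, as an algebra homomorphism. -/
def polActHom : Module.End ℂ (Pol N) →ₐ[ℂ] Module.End ℂ (BigSpace N) where
  toFun := polAct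
  map_one' := rfl
  map_mul' _ _ := rfl
  map_zero' := rfl
  map_add' _ _ := rfl
  commutes' _ := rfl

theorem polActHom_apply (O : Module.End ℂ (Pol N)) (Ψ : BigSpace N) (σ : Config N) :
    polActHom O Ψ σ = O (Ψ σ) := rfl

theorem act_apply (M : Matrix (Config N) (Config N) (Module.End ℂ (Pol N))) (Ψ : BigSpace N)
    (σ : Config N) : act M Ψ σ = ∑ τ, M σ τ (Ψ τ) := by
  simp [act]

/-- `act` as a ring homomorphism. -/
def actHom : Matrix (Config N) (Config N) (Module.End ℂ (Pol N)) →+* Module.End ℂ (BigSpace N) where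
  toFun := act
  map_one' := by
    refine LinearMap.ext fun Ψ => funext fun σ => ?_
    rw [act_apply, Finset.sum_eq_single σ]
    · simp
    · intro τ _ h; simp [Matrix.one_apply_ne h.symm]
    · simp
  map_zero' := by
    refine LinearMap.ext fun Ψ => funext fun σ => ?_
    simp [act_apply]
  map_add' M M' := by
    refine LinearMap.ext fun Ψ => funext fun σ => ?_
    simp [act_apply, Finset.sum_add_distrib]
  map_mul' M M' := by
    refine LinearMap.ext fun Ψ => funext fun σ => ?_
    simp only [Module.End.mul_apply, act_apply, Matrix.mul_apply, map_sum, LinearMap.sum_apply]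
    exact Finset.sum_comm

/-- The matrix unit `|s⟩⟨s'|` in tensor factor `i`. -/
def siteUnit (i : Fin N) (s s' : Fin 2) : Module.End ℂ (BigSpace N) where
  toFun Ψ σ := if σ i = s then Ψ (Function.update σ i s') else 0
  map_add' Ψ Ψ' := by
    funext σ
    simp only [Pi.add_apply]
    split_ifs <;> simp
  map_smul' c Ψ := by
    funext σ
    simp only [Pi.smul_apply, RingHom.id_apply]
    split_ifs <;> simp

theorem siteUnit_apply (i : Fin N) (s s' : Fin 2) (Ψ : BigSpace N) (σ : Config N) :
    siteUnit i s s' Ψ σ = if σ i = s then Ψ (Function.update σ i s') else 0 := rfl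

theorem siteUnit_mul (i : Fin N) (s s' r r' : Fin 2) :
    siteUnit i s s' * siteUnit i r r' = if s' = r then siteUnit i s r' else 0 := by
  refine LinearMap.ext fun Ψ => funext fun σ => ?_
  rw [Module.End.mul_apply, siteUnit_apply, siteUnit_apply]
  by_cases h : s' = r <;> by_cases h' : σ i = s <;> simp [h, h', siteUnit_apply]

theorem sum_siteUnit (i : Fin N) : ∑ s, siteUnit i s s = 1 := by
  refine LinearMap.ext fun Ψ => funext fun σ => ?_
  rw [LinearMap.sum_apply, Finset.sum_apply]
  simp [siteUnit_apply]

theorem commute_siteUnit {i j : Fin N} (hij : i ≠ j) (s s' r r' : Fin 2) :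
    Commute (siteUnit i s s') (siteUnit j r r') := by
  refine LinearMap.ext fun Ψ => funext fun σ => ?_
  simp only [Module.End.mul_apply, siteUnit_apply, Function.update_of_ne hij,
    Function.update_of_ne hij.symm, Function.update_comm hij]
  split_ifs <;> rfl

theorem commute_siteUnit_polActHom (i : Fin N) (s s' : Fin 2) (O : Module.End ℂ (Pol N)) :
    Commute (siteUnit i s s') (polActHom O) := by
  refine LinearMap.ext fun Ψ => funext fun σ => ?_
  simp only [Module.End.mul_apply, siteUnit_apply, polActHom_apply]
  split_ifs <;> simp

/-- The operator that acts by a `2 × 2` matrix of operators in tensor factor `i`. -/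
theorem act_oneSite (i : Fin N) (M : Fin 2 → Fin 2 → Module.End ℂ (Pol N)) :
    act (Matrix.of fun σ τ : Config N => if ∀ k, k ≠ i → σ k = τ k then M (σ i) (τ i) else 0)
      = ∑ s, ∑ s', siteUnit i s s' * polActHom (M s s') := by
  refine LinearMap.ext fun Ψ => funext fun σ => ?_
  rw [act_apply]
  have h1 : ∀ s', (if ∀ k, k ≠ i → σ k = Function.update σ i s' k then
      M (σ i) (Function.update σ i s' i) else 0) (Ψ (Function.update σ i s'))
      = M (σ i) s' (Ψ (Function.update σ i s')) := by
    intro s'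
    rw [if_pos fun k hk => by rw [Function.update_of_ne hk], Function.update_self]
  rw [← Fintype.sum_of_injective (fun s' : Fin 2 => Function.update σ i s')
    (Function.update_injective σ i)
    (fun s' => M (σ i) s' (Ψ (Function.update σ i s'))) _ ?_ (fun s' => (h1 s').symm)]
  · simp only [LinearMap.sum_apply, Finset.sum_apply, Module.End.mul_apply, siteUnit_apply,
      polActHom_apply]
    symm
    rw [Finset.sum_eq_single (σ i) (fun s _ hs => by simp [Ne.symm hs]) (by simp)]
    simp
  · intro τ hτ
    rw [Matrix.of_apply, if_neg, LinearMap.zero_apply]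
    intro h
    refine hτ ⟨τ i, funext fun k => ?_⟩
    by_cases hk : k = i
    · subst hk; simp
    · simp [Function.update_of_ne hk, h k hk]

/-- The operator that acts by a `4 × 4` matrix in the tensor factors `i` and `j`. -/
def spinTwo (i j : Fin N) (M : Matrix (Fin 2 × Fin 2) (Fin 2 × Fin 2) ℂ) :
    Module.End ℂ (BigSpace N) :=
  ∑ x, ∑ y, M x y • (siteUnit i x.1 y.1 * siteUnit j x.2 y.2)

theorem spinTwo_apply {i j : Fin N} (hij : i ≠ j) (M : Matrix (Fin 2 × Fin 2) (Fin 2 × Fin 2) ℂ)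
    (Ψ : BigSpace N) (σ : Config N) :
    spinTwo i j M Ψ σ = ∑ y, M (σ i, σ j) y •
      Ψ (Function.update (Function.update σ i y.1) j y.2) := by
  simp only [spinTwo, LinearMap.sum_apply, Finset.sum_apply, LinearMap.smul_apply, Pi.smul_apply,
    Module.End.mul_apply, siteUnit_apply, Function.update_of_ne hij.symm]
  rw [Finset.sum_eq_single (σ i, σ j)]
  · simp
  · intro x _ hx
    refine Finset.sum_eq_zero fun y _ => ?_
    by_cases h1 : σ i = x.1
    · rw [if_pos h1, if_neg, smul_zero]
      intro h2; exact hx (Prod.ext h1.symm h2.symm)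
    · rw [if_neg h1, smul_zero]
  · simp

theorem spinAct_twoSite {i j : Fin N} (hij : i ≠ j)
    (M : Matrix (Fin 2 × Fin 2) (Fin 2 × Fin 2) ℂ) :
    spinAct (twoSite i j M) = spinTwo i j M := by
  refine LinearMap.ext fun Ψ => funext fun σ => ?_
  rw [spinTwo_apply hij, spinAct, act_apply]
  symm
  -- Only the configurations that agree with `σ` away from `i` and `j` contribute, and these are
  -- parametrised by their two values at `i` and `j`.
  refine Fintype.sum_of_injective
    (fun y : Fin 2 × Fin 2 => Function.update (Function.update σ i y.1) j y.2) ?_ _ _ ?_ ?_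
  · intro y y' h
    have h1 := congrFun h i
    have h2 := congrFun h j
    simp only [Function.update_of_ne hij, Function.update_self] at h1 h2
    exact Prod.ext h1 h2
  · intro τ hτ
    rw [Matrix.map_apply, twoSite, Matrix.of_apply, if_neg]
    · simp
    intro h
    refine hτ ⟨(τ i, τ j), funext fun k => ?_⟩
    by_cases hk : k = j
    · subst hk; simp
    · by_cases hk' : k = i
      · subst hk'; simp [Function.update_of_ne hk]
      · simp [Function.update_of_ne hk, Function.update_of_ne hk', h k hk' hk]
  · intro y
    rw [Matrix.map_apply, twoSite, Matrix.of_apply, if_pos]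
    · simp [Function.update_of_ne hij, Module.algebraMap_end_apply]
    · intro k hk hk'
      rw [Function.update_of_ne hk', Function.update_of_ne hk]

theorem spinTwo_mul {i j : Fin N} (hij : i ≠ j)
    (M M' : Matrix (Fin 2 × Fin 2) (Fin 2 × Fin 2) ℂ) :
    spinTwo i j (M * M') = spinTwo i j M * spinTwo i j M' := by
  refine LinearMap.ext fun Ψ => funext fun σ => ?_
  simp only [Module.End.mul_apply, spinTwo_apply hij, Matrix.mul_apply, Finset.sum_smul,
    Finset.smul_sum, Function.update_of_ne hij, Function.update_self, smul_smul]
  rw [Finset.sum_comm]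
  refine Finset.sum_congr rfl fun x _ => Finset.sum_congr rfl fun y _ => ?_
  congr 2
  funext k
  by_cases hk : k = j
  · subst hk; simp
  · by_cases hk' : k = i
    · subst hk'; simp [Function.update_of_ne hk]
    · simp [Function.update_of_ne hk, Function.update_of_ne hk']

theorem spinTwo_add (i j : Fin N) (M M' : Matrix (Fin 2 × Fin 2) (Fin 2 × Fin 2) ℂ) :
    spinTwo i j (M + M') = spinTwo i j M + spinTwo i j M' := by
  simp [spinTwo, add_smul, Finset.sum_add_distrib]

theorem spinTwo_smul (i j : Fin N) (c : ℂ) (M : Matrix (Fin 2 × Fin 2) (Fin 2 × Fin 2) ℂ) :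
    spinTwo i j (c • M) = c • spinTwo i j M := by
  simp [spinTwo, Finset.smul_sum, smul_smul]

theorem spinTwo_one {i j : Fin N} (hij : i ≠ j) : spinTwo i j 1 = 1 := by
  refine LinearMap.ext fun Ψ => funext fun σ => ?_
  rw [spinTwo_apply hij, Finset.sum_eq_single (σ i, σ j)]
  · simp
  · intro y _ hy; rw [Matrix.one_apply_ne (Ne.symm hy), zero_smul]
  · simp

theorem commute_spinTwo_polActHom (i j : Fin N) (M : Matrix (Fin 2 × Fin 2) (Fin 2 × Fin 2) ℂ)
    (O : Module.End ℂ (Pol N)) : Commute (spinTwo i j M) (polActHom O) :=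
  Commute.sum_left _ _ _ fun _ _ => Commute.sum_left _ _ _ fun _ _ =>
    Commute.smul_left ((commute_siteUnit_polActHom i _ _ O).mul_left
      (commute_siteUnit_polActHom j _ _ O)) _

theorem commute_spinTwo_siteUnit {i j k : Fin N} (hi : i ≠ k) (hj : j ≠ k)
    (M : Matrix (Fin 2 × Fin 2) (Fin 2 × Fin 2) ℂ) (s s' : Fin 2) :
    Commute (spinTwo i j M) (siteUnit k s s') :=
  Commute.sum_left _ _ _ fun _ _ => Commute.sum_left _ _ _ fun _ _ =>
    Commute.smul_left ((commute_siteUnit hi _ _ _ _).mul_left (commute_siteUnit hj _ _ _ _)) _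

theorem commute_spinTwo {i j k l : Fin N} (hik : i ≠ k) (hjk : j ≠ k) (hil : i ≠ l) (hjl : j ≠ l)
    (M M' : Matrix (Fin 2 × Fin 2) (Fin 2 × Fin 2) ℂ) :
    Commute (spinTwo i j M) (spinTwo k l M') :=
  Commute.sum_right _ _ _ fun _ _ => Commute.sum_right _ _ _ fun _ _ =>
    Commute.smul_right ((commute_spinTwo_siteUnit hik hjk _ _ _).mul_right
      (commute_spinTwo_siteUnit hil hjl _ _ _)) _

/-- The matrix of modes of a matrix of operator-valued series on `V_a ⊗ (ℂ²)^{⊗N}`. -/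
def modeHom : Matrix (Config (N + 1)) (Config (N + 1)) (Module.End ℂ (Pol N))⟦X⟧ →*
    Matrix (Fin 2) (Fin 2) (Module.End ℂ (BigSpace N))⟦X⟧ where
  toFun M := Matrix.of fun α β => PowerSeries.mk fun n =>
    act (Matrix.of fun σ τ : Config N => PowerSeries.coeff n (M (Fin.cons α σ) (Fin.cons β τ)))
  map_one' := by
    refine Matrix.ext fun α β => PowerSeries.ext fun n => ?_
    rw [Matrix.of_apply, PowerSeries.coeff_mk, Matrix.one_apply]
    have h : (Matrix.of fun σ τ : Config N => PowerSeries.coeff n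
        ((1 : Matrix (Config (N + 1)) (Config (N + 1)) (Module.End ℂ (Pol N))⟦X⟧)
          (Fin.cons α σ) (Fin.cons β τ))) = if α = β ∧ n = 0 then 1 else 0 := by
      ext1 σ τ
      rw [Matrix.of_apply, Matrix.one_apply]
      by_cases h1 : α = β <;> by_cases h2 : n = 0 <;> by_cases h3 : σ = τ <;>
        simp [h1, h2, h3, Fin.cons_inj, PowerSeries.coeff_one, Matrix.one_apply]
    rw [h]
    by_cases h1 : α = β <;> by_cases h2 : n = 0 <;>
      simp [h1, h2, PowerSeries.coeff_one, show act (1 : Matrix (Config N) (Config N) _) = 1 from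
        actHom.map_one, show act (0 : Matrix (Config N) (Config N) _) = 0 from actHom.map_zero]
  map_mul' M M' := by
    refine Matrix.ext fun α β => PowerSeries.ext fun n => ?_
    have hact : ∀ m : Matrix (Config N) (Config N) (Module.End ℂ (Pol N)), act m = actHom m :=
      fun _ => rfl
    simp only [Matrix.of_apply, PowerSeries.coeff_mk, Matrix.mul_apply, map_sum,
      PowerSeries.coeff_mul, hact]
    simp only [← map_mul, ← map_sum]
    congr 1
    ext1 σ τ
    simp only [Matrix.of_apply, Matrix.sum_apply, Matrix.mul_apply]
    -- An intermediate configuration on `V_a ⊗ (ℂ²)^{⊗N}` is split into its auxiliary entry and a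
    -- configuration of the chain.
    rw [← (Fin.consEquiv fun _ => Fin 2).sum_comp, Fintype.sum_prod_type]
    refine Finset.sum_congr rfl fun γ _ => ?_
    rw [Finset.sum_comm]
    rfl

theorem coeff_modeHom_apply (M : Matrix (Config (N + 1)) (Config (N + 1)) (Module.End ℂ (Pol N))⟦X⟧)
    (α β : Fin 2) (n : ℕ) : PowerSeries.coeff n (modeHom M α β) =
      act (Matrix.of fun σ τ : Config N =>
        PowerSeries.coeff n (M (Fin.cons α σ) (Fin.cons β τ))) := by
  simp [modeHom]

theorem modeHom_twoSite (i : Fin N) (M : Matrix (Fin 2 × Fin 2) (Fin 2 × Fin 2)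
    (Module.End ℂ (Pol N))⟦X⟧) (α β : Fin 2) :
    modeHom (twoSite 0 i.succ M) α β = ∑ s, ∑ s', PowerSeries.C (siteUnit i s s') *
      PowerSeries.map (polActHom : _ →ₐ[ℂ] _).toRingHom (M (α, s) (β, s')) := by
  ext n : 1
  rw [coeff_modeHom_apply]
  simp only [map_sum, PowerSeries.coeff_C_mul, PowerSeries.coeff_map]
  refine Eq.trans ?_ (act_oneSite i fun s s' => PowerSeries.coeff n (M (α, s) (β, s')))
  congr 1
  ext1 σ τ
  rw [Matrix.of_apply, Matrix.of_apply, twoSite, Matrix.of_apply, Fin.cons_zero, Fin.cons_zero,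
    Fin.cons_succ, Fin.cons_succ]
  have : (∀ k, k ≠ 0 → k ≠ i.succ → (Fin.cons α σ : Config (N + 1)) k
      = (Fin.cons β τ : Config (N + 1)) k) ↔ ∀ k, k ≠ i → σ k = τ k := by
    constructor
    · intro h k hk
      simpa using h k.succ (Fin.succ_ne_zero k) (fun e => hk (Fin.succ_injective _ e))
    · intro h k
      refine Fin.cases (fun h0 => absurd rfl h0) (fun k _ hk => ?_) k
      simpa using h k (fun e => hk (by rw [e]))
  simp only [this]
  split_ifs <;> simp

/-- The factor of the matrix of modes at site `i`. -/
def siteL [NeZero N] (q p : ℂ) (ε : Pt) (i : Fin N) :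
    Matrix (Fin 2) (Fin 2) (Module.End ℂ (BigSpace N))⟦X⟧ :=
  modeHom (twoSite 0 i.succ (Rmat q (uNum _ ε * Yser q p i) (uDen _ ε)))

/-- Passing to modes is multiplicative, so the factorisation of the monodromy matrix survives as a
product of `2 × 2` matrices of operator-valued series. -/
theorem seriesMatrix_mode [NeZero N] (q p : ℂ) (ε : Pt) :
    seriesMatrix (mode (N := N) q p) ε = ((List.finRange N).reverse.map (siteL q p ε)).prod := by
  have : seriesMatrix (mode (N := N) q p) ε = modeHom (Ltilde q p ε) := rfl
  rw [this, Ltilde, monodromy, map_list_prod, List.map_map]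
  rfl

end SpinOperators


/-! ## Structure of the local factors -/

section LocalFactors

theorem ringInverse_eq_of_mul {R : Type*} [Ring R] {x y : R} (h1 : x * y = 1) (h2 : y * x = 1) :
    Ring.inverse x = y :=
  Ring.inverse_unit (⟨x, y, h1, h2⟩ : Rˣ)

/-- The inverse of the denominator of the `R`-matrix, expanded at `0` or `∞`. -/
def denInv {A : Type*} [Ring A] (c ci : A) : Pt → A⟦X⟧
  | Pt.zero => -PowerSeries.mk fun k => c ^ k
  | Pt.infty => PowerSeries.mk fun k => ci ^ (k + 1)

section Den

variable {A : Type*} [Ring A] [Algebra ℂ A]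

/-- A geometric series: the denominator is `X c - 1` at the origin and `c - X` at infinity. Only the
latter expansion uses the inverse of `c`. -/
theorem Rden_mul_denInv (q : ℂ) {y c ci : A} (hc : c = q ^ 2 • y) (h : c * ci = 1) (ε : Pt) :
    Rden q (uNum A ε * PowerSeries.C y) (uDen A ε) * denInv c ci ε = 1 := by
  have e : q ^ 2 • (uNum A ε * PowerSeries.C y) = uNum A ε * PowerSeries.C c := by
    rw [hc, ← mul_smul_comm]; congr 1
    ext n; simp [PowerSeries.coeff_C, PowerSeries.coeff_smul]
  rw [Rden, e]
  cases ε
  · ext n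
    simp only [uNum, uDen, denInv, sub_mul, one_mul, mul_assoc]
    rcases n with _ | n
    · simp
    · simp [PowerSeries.coeff_succ_X_mul, PowerSeries.coeff_C_mul, PowerSeries.coeff_one, pow_succ']
  · ext n
    simp only [uNum, uDen, denInv, sub_mul, one_mul]
    rcases n with _ | n
    · simp [PowerSeries.coeff_C_mul, h]
    · simp only [map_sub, PowerSeries.coeff_C_mul, PowerSeries.coeff_mk,
        PowerSeries.coeff_succ_X_mul, PowerSeries.coeff_one]
      rw [pow_succ' ci (n + 1), ← mul_assoc, h]; simp

theorem denInv_mul_Rden (q : ℂ) {y c ci : A} (hc : c = q ^ 2 • y) (h : ci * c = 1) (ε : Pt) :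
    denInv c ci ε * Rden q (uNum A ε * PowerSeries.C y) (uDen A ε) = 1 := by
  have e : q ^ 2 • (uNum A ε * PowerSeries.C y) = uNum A ε * PowerSeries.C c := by
    rw [hc, ← mul_smul_comm]; congr 1
    ext n; simp [PowerSeries.coeff_C, PowerSeries.coeff_smul]
  rw [Rden, e]
  cases ε
  · ext n
    simp only [uNum, uDen, denInv, mul_sub, mul_one]
    rw [(PowerSeries.commute_X (PowerSeries.C c)).symm.eq, ← mul_assoc]
    rcases n with _ | n
    · simp
    · simp [PowerSeries.coeff_succ_mul_X, PowerSeries.coeff_mul_C, PowerSeries.coeff_one, pow_succ]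
  · ext n
    simp only [uNum, uDen, denInv, mul_sub, one_mul]
    rcases n with _ | n
    · simp [PowerSeries.coeff_mul_C, h]
    · simp only [map_sub, PowerSeries.coeff_mul_C, PowerSeries.coeff_mk,
        PowerSeries.coeff_succ_mul_X, PowerSeries.coeff_one]
      rw [pow_succ ci (n + 1), mul_assoc, h]; simp

end Den

variable {A B : Type*} [Ring A] [Algebra ℂ A] [Ring B] [Algebra ℂ B]

theorem map_Rnum (f : A →+* B) (hf : ∀ (c : ℂ) (a : A), f (c • a) = c • f a) (q : ℂ) (a b : A)
    (x y : Fin 2 × Fin 2) : f (Rnum q a b x y) = Rnum q (f a) (f b) x y := by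
  simp only [Rnum, RcheckNum, Rden, Matrix.of_apply]
  split_ifs <;> simp [hf]

theorem map_powerSeriesMap_smul (f : A →ₐ[ℂ] B) (c : ℂ) (a : A⟦X⟧) :
    PowerSeries.map f.toRingHom (c • a) = c • PowerSeries.map f.toRingHom a := by
  ext n; simp [PowerSeries.coeff_smul]

theorem map_uNum (f : A →+* B) (ε : Pt) : PowerSeries.map f (uNum A ε) = uNum B ε := by
  cases ε <;> simp [uNum]

theorem map_uDen (f : A →+* B) (ε : Pt) : PowerSeries.map f (uDen A ε) = uDen B ε := by
  cases ε <;> simp [uDen]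

/-- Series all of whose coefficients lie in a given subalgebra. -/
def serIn (S : Subalgebra ℂ A) : Subalgebra ℂ A⟦X⟧ where
  carrier := {f | ∀ n, PowerSeries.coeff n f ∈ S}
  mul_mem' hf hg n := by
    rw [PowerSeries.coeff_mul]
    exact Subalgebra.sum_mem _ fun x _ => S.mul_mem (hf _) (hg _)
  add_mem' hf hg n := by rw [map_add]; exact S.add_mem (hf n) (hg n)
  algebraMap_mem' c n := by
    rw [Algebra.algebraMap_eq_smul_one, PowerSeries.coeff_smul, PowerSeries.coeff_one]
    split_ifs
    · exact S.smul_mem S.one_mem _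
    · simp

theorem C_mem_serIn {S : Subalgebra ℂ A} {a : A} (ha : a ∈ S) : PowerSeries.C a ∈ serIn S := by
  intro n
  rw [PowerSeries.coeff_C]
  split_ifs
  · exact ha
  · exact S.zero_mem

theorem uNum_mem_serIn (S : Subalgebra ℂ A) (ε : Pt) : uNum A ε ∈ serIn S := by
  intro n
  cases ε <;> simp only [uNum, PowerSeries.coeff_X, PowerSeries.coeff_one] <;> split_ifs <;>
    simp [S.one_mem]

theorem uDen_mem_serIn (S : Subalgebra ℂ A) (ε : Pt) : uDen A ε ∈ serIn S := by
  intro n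
  cases ε <;> simp only [uDen, PowerSeries.coeff_X, PowerSeries.coeff_one] <;> split_ifs <;>
    simp [S.one_mem]

theorem denInv_mem_serIn {S : Subalgebra ℂ A} {c ci : A} (hc : c ∈ S) (hci : ci ∈ S) (ε : Pt) :
    denInv c ci ε ∈ serIn S := by
  cases ε
  · refine (serIn S).neg_mem fun n => ?_
    rw [PowerSeries.coeff_mk]; exact S.pow_mem hc _
  · intro n
    rw [denInv, PowerSeries.coeff_mk]; exact S.pow_mem hci _

theorem Rnum_mem {S : Subalgebra ℂ A} (q : ℂ) {a b : A} (ha : a ∈ S) (hb : b ∈ S)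
    (x y : Fin 2 × Fin 2) : Rnum q a b x y ∈ S := by
  simp only [Rnum, RcheckNum, Rden, Matrix.of_apply]
  split_ifs
  · exact S.smul_mem ha _
  · exact S.smul_mem hb _
  · exact S.sub_mem (S.smul_mem ha _) hb
  · exact S.smul_mem (S.sub_mem ha hb) _
  · exact S.zero_mem

theorem commute_powerSeries {f g : A⟦X⟧}
    (h : ∀ m n, Commute (PowerSeries.coeff m f) (PowerSeries.coeff n g)) : Commute f g := by
  ext n
  rw [PowerSeries.coeff_mul, PowerSeries.coeff_mul,
    ← Finset.Nat.sum_antidiagonal_swap (f := fun x =>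
      PowerSeries.coeff x.1 g * PowerSeries.coeff x.2 f)]
  exact Finset.sum_congr rfl fun x _ => (h _ _).eq

theorem commute_C_map_C {f g : A⟦X⟧}
    (h : ∀ m n, Commute (PowerSeries.coeff m f) (PowerSeries.coeff n g)) :
    Commute (PowerSeries.C f : A⟦X⟧⟦X⟧) (PowerSeries.map PowerSeries.C g) := by
  refine commute_powerSeries fun m n => commute_powerSeries fun m' n' => ?_
  rw [PowerSeries.coeff_C, PowerSeries.coeff_map, PowerSeries.coeff_C]
  split_ifs
  · exact h _ _
  · exact Commute.zero_right _
  · rw [map_zero]; exact Commute.zero_left _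
  · exact Commute.zero_right _

variable {N : ℕ} [NeZero N]

/-- `Y_i` acting on the big space. -/
def bigY (q p : ℂ) (i : Fin N) : Module.End ℂ (BigSpace N) := polActHom (Y q p i)

/-- `Y_i⁻¹` acting on the big space. -/
def bigYInv (q p : ℂ) (i : Fin N) : Module.End ℂ (BigSpace N) :=
  polActHom (Ring.inverse (Y q p i))

/-- Inverse of the denominator of the `R`-matrix at site `i`. -/
def siteDenInv (q p : ℂ) (ε : Pt) (i : Fin N) : (Module.End ℂ (BigSpace N))⟦X⟧ :=
  denInv (q ^ 2 • bigY q p i) ((q ^ 2)⁻¹ • bigYInv q p i) ε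

/-- The numerator of the local factor at site `i` with `y` in place of `Y_i`. -/
def siteNum (q : ℂ) (y : Module.End ℂ (BigSpace N)) (ε : Pt) (i : Fin N) :
    Matrix (Fin 2) (Fin 2) (Module.End ℂ (BigSpace N))⟦X⟧ :=
  Matrix.of fun α β => ∑ s, ∑ s', PowerSeries.C (siteUnit i s s') *
    Rnum q (uNum _ ε * PowerSeries.C y) (uDen _ ε) (α, s) (β, s')

section

variable {q p : ℂ} (hq : q ≠ 0) (hp : p ≠ 0)
include hq hp

theorem smul_Y_mul_smul_inverse (i : Fin N) :
    (q ^ 2 • Y q p i) * ((q ^ 2)⁻¹ • Ring.inverse (Y q p i)) = 1 ∧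
      ((q ^ 2)⁻¹ • Ring.inverse (Y q p i)) * (q ^ 2 • Y q p i) = 1 := by
  have hq2 : q ^ 2 ≠ 0 := pow_ne_zero 2 hq
  constructor
  · rw [smul_mul_smul_comm, Ring.mul_inverse_cancel _ (isUnit_Y hq hp i), mul_inv_cancel₀ hq2,
      one_smul]
  · rw [smul_mul_smul_comm, Ring.inverse_mul_cancel _ (isUnit_Y hq hp i), inv_mul_cancel₀ hq2,
      one_smul]

theorem Rden_mul_denInv_Y (ε : Pt) (i : Fin N) :
    Rden q (uNum _ ε * Yser q p i) (uDen _ ε)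
        * denInv (q ^ 2 • Y q p i) ((q ^ 2)⁻¹ • Ring.inverse (Y q p i)) ε = 1 ∧
      denInv (q ^ 2 • Y q p i) ((q ^ 2)⁻¹ • Ring.inverse (Y q p i)) ε
        * Rden q (uNum _ ε * Yser q p i) (uDen _ ε) = 1 := by
  obtain ⟨h1, h2⟩ := smul_Y_mul_smul_inverse hq hp i
  rw [Yser]
  generalize hc : q ^ 2 • Y q p i = c at *
  generalize (q ^ 2)⁻¹ • Ring.inverse (Y q p i) = ci at *
  exact ⟨Rden_mul_denInv q hc.symm h1 ε, denInv_mul_Rden q hc.symm h2 ε⟩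

theorem isUnit_Rden (ε : Pt) (i : Fin N) :
    IsUnit (Rden q (uNum _ ε * Yser q p i) (uDen _ ε)) := by
  obtain ⟨h1, h2⟩ := Rden_mul_denInv_Y hq hp ε i
  exact ⟨⟨_, _, h1, h2⟩, rfl⟩

theorem inverse_Rden (ε : Pt) (i : Fin N) :
    Ring.inverse (Rden q (uNum _ ε * Yser q p i) (uDen _ ε))
      = denInv (q ^ 2 • Y q p i) ((q ^ 2)⁻¹ • Ring.inverse (Y q p i)) ε := by
  obtain ⟨h1, h2⟩ := Rden_mul_denInv_Y hq hp ε i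
  exact ringInverse_eq_of_mul h1 h2

omit hq hp in
theorem map_denInv (f : A →+* B) (c ci : A) (ε : Pt) :
    PowerSeries.map f (denInv c ci ε) = denInv (f c) (f ci) ε := by
  cases ε <;> ext n <;> simp [denInv]

omit hq hp in
theorem commute_siteUnit_bigY (i j : Fin N) (s s' : Fin 2) :
    Commute (siteUnit i s s') (bigY q p j) := commute_siteUnit_polActHom _ _ _ _

omit hq hp in
theorem commute_siteUnit_bigYInv (i j : Fin N) (s s' : Fin 2) :
    Commute (siteUnit i s s') (bigYInv q p j) := commute_siteUnit_polActHom _ _ _ _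

omit hq hp in
theorem commute_C_of_mem_serIn {x : A} {f : A⟦X⟧} (hf : f ∈ serIn (Subalgebra.centralizer ℂ {x})) :
    Commute (PowerSeries.C x) f := by
  refine commute_powerSeries fun m n => ?_
  rw [PowerSeries.coeff_C]
  split_ifs
  · exact (Subalgebra.mem_centralizer_iff ℂ).1 (hf n) x rfl
  · exact Commute.zero_left _

omit hq hp in
theorem siteDenInv_mem {S : Subalgebra ℂ (Module.End ℂ (BigSpace N))} {i : Fin N}
    (h1 : bigY q p i ∈ S) (h2 : bigYInv q p i ∈ S) (ε : Pt) : siteDenInv q p ε i ∈ serIn S :=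
  denInv_mem_serIn (S.smul_mem h1 _) (S.smul_mem h2 _) ε

/-- The denominator involves only `Y_i`, hence commutes with the matrix units and can be split off.
What remains is polynomial in `Y_i`. -/
theorem siteL_eq (ε : Pt) (i : Fin N) :
    siteL q p ε i = siteDenInv q p ε i • siteNum q (bigY q p i) ε i := by
  ext1 α β
  rw [siteL, modeHom_twoSite, Matrix.smul_apply, siteNum, Matrix.of_apply, smul_eq_mul,
    Finset.mul_sum]
  refine Finset.sum_congr rfl fun s _ => ?_
  rw [Finset.mul_sum]
  refine Finset.sum_congr rfl fun s' _ => ?_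
  rw [Rmat, Matrix.of_apply, inverse_Rden hq hp, map_mul, map_denInv, map_Rnum _
    (map_powerSeriesMap_smul _), map_mul, map_uNum, map_uDen, ← mul_assoc, ← mul_assoc]
  congr 1
  · have : denInv ((polActHom : Module.End ℂ (Pol N) →ₐ[ℂ] _).toRingHom (q ^ 2 • Y q p i))
        (polActHom.toRingHom ((q ^ 2)⁻¹ • Ring.inverse (Y q p i))) ε = siteDenInv q p ε i := by
      simp [siteDenInv, bigY, bigYInv]
    rw [this]
    refine (commute_C_of_mem_serIn (siteDenInv_mem ?_ ?_ ε)).eq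
    · exact (Subalgebra.mem_centralizer_iff ℂ).2 fun x hx => by
        rw [Set.mem_singleton_iff.1 hx]; exact commute_siteUnit_bigY _ _ _ _
    · exact (Subalgebra.mem_centralizer_iff ℂ).2 fun x hx => by
        rw [Set.mem_singleton_iff.1 hx]; exact commute_siteUnit_bigYInv _ _ _ _
  · simp [Yser, bigY]

omit hq hp in
theorem siteNum_mem {S : Subalgebra ℂ (Module.End ℂ (BigSpace N))} {i : Fin N} {y}
    (hy : y ∈ S) (hE : ∀ s s', siteUnit i s s' ∈ S) (ε : Pt) (α β : Fin 2) :
    siteNum q y ε i α β ∈ serIn S := by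
  rw [siteNum, Matrix.of_apply]
  exact Subalgebra.sum_mem _ fun s _ => Subalgebra.sum_mem _ fun s' _ =>
    Subalgebra.mul_mem _ (C_mem_serIn (hE s s')) (Rnum_mem q (Subalgebra.mul_mem _
      (uNum_mem_serIn S ε) (C_mem_serIn hy)) (uDen_mem_serIn S ε) _ _)

theorem siteL_mem {S : Subalgebra ℂ (Module.End ℂ (BigSpace N))} {i : Fin N}
    (h1 : bigY q p i ∈ S) (h2 : bigYInv q p i ∈ S) (hE : ∀ s s', siteUnit i s s' ∈ S) (ε : Pt)
    (α β : Fin 2) : siteL q p ε i α β ∈ serIn S := by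
  rw [siteL_eq hq hp]
  exact Subalgebra.mul_mem _ (siteDenInv_mem h1 h2 ε) (siteNum_mem h1 hE ε α β)

/-- Every claim that the modes respect some structure is reduced to the `Y_i`, their inverses and
the matrix units by choosing the subalgebra `S`: a centraliser, or the operators that preserve a
given ideal. -/
theorem mode_mem {S : Subalgebra ℂ (Module.End ℂ (BigSpace N))}
    (h1 : ∀ i, bigY q p i ∈ S) (h2 : ∀ i, bigYInv q p i ∈ S)
    (hE : ∀ (i : Fin N) (s s' : Fin 2), siteUnit i s s' ∈ S)
    (ε : Pt) (n : ℕ) (α β : Fin 2) : mode q p ε n α β ∈ S := by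
  have key : ∀ (l : List (Fin N)) (α β : Fin 2),
      (l.map (siteL q p ε)).prod α β ∈ serIn S := by
    intro l
    induction l with
    | nil =>
      intro α β
      rw [List.map_nil, List.prod_nil, Matrix.one_apply]
      split_ifs
      · exact Subalgebra.one_mem _
      · exact Subalgebra.zero_mem _
    | cons i l ih =>
      intro α β
      rw [List.map_cons, List.prod_cons, Matrix.mul_apply]
      exact Subalgebra.sum_mem _ fun γ _ =>
        Subalgebra.mul_mem _ (siteL_mem hq hp (h1 i) (h2 i) (hE i) ε α γ) (ih γ β)
  have := key (List.finRange N).reverse α β n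
  rw [← seriesMatrix_mode, seriesMatrix, Matrix.of_apply, PowerSeries.coeff_mk] at this
  exact this

/-- Operators on polynomials that commute with all `Y_i` commute with all modes. -/
theorem commute_polActHom_mode {O : Module.End ℂ (Pol N)} (hO : ∀ i : Fin N, Commute O (Y q p i))
    (ε : Pt) (n : ℕ) (α β : Fin 2) : Commute (polActHom O) (mode q p ε n α β) := by
  have : mode q p ε n α β ∈ Subalgebra.centralizer ℂ {polActHom O} := by
    refine mode_mem hq hp (fun i => ?_) (fun i => ?_) (fun i s s' => ?_) ε n α β <;>
      refine (Subalgebra.mem_centralizer_iff ℂ).2 fun x hx => ?_ <;>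
      rw [Set.mem_singleton_iff.1 hx]
    · exact ((hO i).map polActHom).eq
    · have : Commute O (Ring.inverse (Y q p i)) :=
        commute_of_inverse (Ring.mul_inverse_cancel _ (isUnit_Y hq hp i))
          (Ring.inverse_mul_cancel _ (isUnit_Y hq hp i)) (hO i)
      exact (this.map polActHom).eq
    · exact (commute_siteUnit_polActHom _ _ _ _).symm.eq
  exact (Subalgebra.mem_centralizer_iff ℂ).1 this _ rfl

end

end LocalFactors


/-! ## The `RLL`-relations for the modes -/

section RLLRelations

/-- The one-site `RLL`-relation (Yang–Baxter equation), multiplied by all denominators. -/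
theorem yangBaxter {S : Type*} [CommRing S] [Algebra ℂ S] (q : ℂ) (a₁ b₁ a₂ b₂ y : S)
    (α β s α' β' s' : Fin 2) :
    ∑ γ, ∑ δ, ∑ r, Rnum q (a₁ * b₂) (b₁ * a₂) (α, β) (γ, δ)
        * Rnum q (a₁ * y) b₁ (γ, s) (α', r) * Rnum q (a₂ * y) b₂ (δ, r) (β', s')
      = ∑ γ, ∑ δ, ∑ r, Rnum q (a₂ * y) b₂ (β, s) (δ, r)
        * Rnum q (a₁ * y) b₁ (α, r) (γ, s') * Rnum q (a₁ * b₂) (b₁ * a₂) (γ, δ) (α', β') := by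
  simp only [Fin.sum_univ_two]
  fin_cases α <;> fin_cases β <;> fin_cases s <;> fin_cases α' <;> fin_cases β' <;>
    fin_cases s' <;>
    simp [Rnum, RcheckNum, Rden, Algebra.smul_def] <;> ring

section Abstract

variable {B : Type*} [Ring B]

/-- `R` passes through one pair `X i`, `Z i` at a time. The pairs can be formed and taken apart
again because `X i` and `Z j` commute for different indices. -/
theorem train {ι : Type*} (R : B) (X Z : ι → B) (l : List ι) (hl : l.Nodup)
    (h : ∀ i, R * X i * Z i = Z i * X i * R) (hc : ∀ i j, i ≠ j → Commute (X i) (Z j)) :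
    R * (l.map X).prod * (l.map Z).prod = (l.map Z).prod * (l.map X).prod * R := by
  induction l with
  | nil => simp
  | cons i l ih =>
    rw [List.nodup_cons] at hl
    have c1 : Commute (Z i) (l.map X).prod := Commute.list_prod_right _ _ fun x hx => by
      obtain ⟨j, hj, rfl⟩ := List.mem_map.1 hx
      exact (hc j i (fun e => hl.1 (e ▸ hj))).symm
    have c2 : Commute (X i) (l.map Z).prod := Commute.list_prod_right _ _ fun x hx => by
      obtain ⟨j, hj, rfl⟩ := List.mem_map.1 hx
      exact hc i j (fun e => hl.1 (e ▸ hj))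
    rw [List.map_cons, List.map_cons, List.prod_cons, List.prod_cons]
    calc R * (X i * (l.map X).prod) * (Z i * (l.map Z).prod)
        = R * X i * ((l.map X).prod * Z i) * (l.map Z).prod := by noncomm_ring
      _ = (R * X i * Z i) * (l.map X).prod * (l.map Z).prod := by rw [← c1.eq]; noncomm_ring
      _ = Z i * X i * (R * (l.map X).prod * (l.map Z).prod) := by rw [h]; noncomm_ring
      _ = Z i * (X i * (l.map Z).prod) * (l.map X).prod * R := by rw [ih hl.2]; noncomm_ring
      _ = _ := by rw [c2.eq]; noncomm_ring

/-- A matrix over a commutative ring as an element of a ring that contains matrix units. -/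
def unitHom {S : Type*} [CommRing S] (g : S →+* B) (e : Fin 2 → Fin 2 → B)
    (he : ∀ s s' r r', e s s' * e r r' = if s' = r then e s r' else 0) (h1 : ∑ s, e s s = 1)
    (hc : ∀ c s s', Commute (g c) (e s s')) : Matrix (Fin 2) (Fin 2) S →+* B where
  toFun M := ∑ s, ∑ s', g (M s s') * e s s'
  map_one' := by
    rw [← h1]
    refine Finset.sum_congr rfl fun s _ => ?_
    rw [Finset.sum_eq_single s]
    · simp
    · intro s' _ hs; rw [Matrix.one_apply_ne hs.symm]; simp
    · simp
  map_zero' := by simp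
  map_add' M M' := by simp [add_mul, Finset.sum_add_distrib]
  map_mul' M M' := by
    have h : ∀ s s' r r', g (M s s') * e s s' * (g (M' r r') * e r r')
        = if s' = r then g (M s s' * M' r r') * e s r' else 0 := by
      intro s s' r r'
      rw [mul_assoc, ← mul_assoc (e s s'), ← (hc _ _ _).eq, mul_assoc, ← mul_assoc, he, map_mul]
      split_ifs <;> simp
    simp only [Finset.sum_mul_sum]
    simp only [Finset.sum_mul, Finset.mul_sum, h]
    simp only [Fin.sum_univ_two, Matrix.mul_apply, map_add, add_mul]
    simp
    abel

theorem unitHom_apply {S : Type*} [CommRing S] (g : S →+* B) (e : Fin 2 → Fin 2 → B) (he h1 hc)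
    (M : Matrix (Fin 2) (Fin 2) S) :
    unitHom g e he h1 hc M = ∑ s, ∑ s', e s s' * g (M s s') := by
  change ∑ s, ∑ s', g (M s s') * e s s' = _
  exact Finset.sum_congr rfl fun _ _ => Finset.sum_congr rfl fun _ _ => (hc _ _ _).eq

theorem unitHom_smul_one {S : Type*} [CommRing S] (g : S →+* B) (e : Fin 2 → Fin 2 → B) (he h1 hc)
    (c : S) : unitHom g e he h1 hc (c • (1 : Matrix (Fin 2) (Fin 2) S)) = g c := by
  rw [unitHom_apply]
  have : ∀ s, ∑ s', e s s' * g ((c • (1 : Matrix (Fin 2) (Fin 2) S)) s s') = e s s * g c :=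
    fun s => by
      rw [Finset.sum_eq_single s]
      · simp
      · intro s' _ hs; simp [Matrix.one_apply_ne hs.symm]
      · simp
  simp only [this]
  rw [← Finset.sum_mul, h1, one_mul]

/-- The one-site `RLL`-relation in a ring that contains matrix units. -/
theorem rll_of_matrixUnits {S : Type*} [CommRing S] [Algebra ℂ S] [Algebra ℂ B] (g : S →+* B)
    (e : Fin 2 → Fin 2 → B) (he : ∀ s s' r r', e s s' * e r r' = if s' = r then e s r' else 0)
    (h1 : ∑ s, e s s = 1) (hc : ∀ c s s', Commute (g c) (e s s'))
    (hg : ∀ (c : ℂ) a, g (c • a) = c • g a) (q : ℂ) (a₁ b₁ a₂ b₂ y : S)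
    {R P Q : Matrix (Fin 2 × Fin 2) (Fin 2 × Fin 2) B}
    (hR : ∀ x x', R x x' = Rnum q (g (a₁ * b₂)) (g (b₁ * a₂)) x x')
    (hP : ∀ x x', P x x' = if x.2 = x'.2 then
      ∑ s, ∑ s', e s s' * Rnum q (g (a₁ * y)) (g b₁) (x.1, s) (x'.1, s') else 0)
    (hQ : ∀ x x', Q x x' = if x.1 = x'.1 then
      ∑ s, ∑ s', e s s' * Rnum q (g (a₂ * y)) (g b₂) (x.2, s) (x'.2, s') else 0) :
    R * P * Q = Q * P * R := by
  set h := unitHom g e he h1 hc with hh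
  -- The quantum space at the site is modelled by inner `2 × 2` matrices over the commutative ring.
  -- There the relation is the scalar Yang–Baxter equation, and `unitHom` transports it.
  set mR : Matrix (Fin 2 × Fin 2) (Fin 2 × Fin 2) (Matrix (Fin 2) (Fin 2) S) :=
    Matrix.of fun x x' => Rnum q (a₁ * b₂) (b₁ * a₂) x x' • (1 : Matrix (Fin 2) (Fin 2) S) with hmR
  set mA : Matrix (Fin 2 × Fin 2) (Fin 2 × Fin 2) (Matrix (Fin 2) (Fin 2) S) :=
    Matrix.of fun x x' => if x.2 = x'.2 then
      Matrix.of fun s s' => Rnum q (a₁ * y) b₁ (x.1, s) (x'.1, s') else 0 with hmA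
  set mB : Matrix (Fin 2 × Fin 2) (Fin 2 × Fin 2) (Matrix (Fin 2) (Fin 2) S) :=
    Matrix.of fun x x' => if x.1 = x'.1 then
      Matrix.of fun s s' => Rnum q (a₂ * y) b₂ (x.2, s) (x'.2, s') else 0 with hmB
  have key : mR * mA * mB = mB * mA * mR := by
    ext1 x x'
    refine Matrix.ext fun s s' => ?_
    obtain ⟨α, β⟩ := x
    obtain ⟨α', β'⟩ := x'
    have := yangBaxter q a₁ b₁ a₂ b₂ y α β s α' β' s'
    have l : (mR * mA * mB) (α, β) (α', β') s s'
        = ∑ γ, ∑ δ, ∑ r, Rnum q (a₁ * b₂) (b₁ * a₂) (α, β) (γ, δ)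
        * Rnum q (a₁ * y) b₁ (γ, s) (α', r) * Rnum q (a₂ * y) b₂ (δ, r) (β', s') := by
      simp [mR, mA, mB, Matrix.mul_apply, Fintype.sum_prod_type, Fin.sum_univ_two]
      ring
    have r : (mB * mA * mR) (α, β) (α', β') s s'
        = ∑ γ, ∑ δ, ∑ r, Rnum q (a₂ * y) b₂ (β, s) (δ, r)
        * Rnum q (a₁ * y) b₁ (α, r) (γ, s') * Rnum q (a₁ * b₂) (b₁ * a₂) (γ, δ) (α', β') := by
      simp [mR, mA, mB, Matrix.mul_apply, Fintype.sum_prod_type, Fin.sum_univ_two]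
      ring
    rw [l, r, this]
  have eR : h.mapMatrix mR = R := by
    ext1 x x'
    rw [RingHom.mapMatrix_apply, Matrix.map_apply, hmR, Matrix.of_apply, hh, unitHom_smul_one,
      map_Rnum g hg, hR]
  have eA : h.mapMatrix mA = P := by
    ext1 x x'
    rw [RingHom.mapMatrix_apply, Matrix.map_apply, hmA, Matrix.of_apply, hP, apply_ite h, map_zero,
      hh, unitHom_apply]
    simp only [Matrix.of_apply, map_Rnum g hg]
  have eB : h.mapMatrix mB = Q := by
    ext1 x x'
    rw [RingHom.mapMatrix_apply, Matrix.map_apply, hmB, Matrix.of_apply, hQ, apply_ite h, map_zero,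
      hh, unitHom_apply]
    simp only [Matrix.of_apply, map_Rnum g hg]
  have := congrArg h.mapMatrix key
  rw [RingHom.map_mul, RingHom.map_mul, RingHom.map_mul, RingHom.map_mul, eR, eA, eB] at this
  exact this

end Abstract

variable {W : Type*} [Ring W] [Algebra ℂ W]

theorem LaU_apply (L : Matrix (Fin 2) (Fin 2) W⟦X⟧) (x y : Fin 2 × Fin 2) :
    LaU L x y = if x.2 = y.2 then PowerSeries.C (L x.1 y.1) else 0 := by
  rw [LaU, Matrix.kroneckerMap_apply, Matrix.one_apply, mul_ite, mul_one, mul_zero,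
    Matrix.map_apply]

theorem LbV_apply (L : Matrix (Fin 2) (Fin 2) W⟦X⟧) (x y : Fin 2 × Fin 2) :
    LbV L x y = if x.1 = y.1 then PowerSeries.map PowerSeries.C (L x.2 y.2) else 0 := by
  rw [LbV, Matrix.kroneckerMap_apply, Matrix.one_apply, ite_mul, one_mul, zero_mul,
    Matrix.map_apply]

/-- `L ↦ L_a(u)` is multiplicative. -/
def LaUHom : Matrix (Fin 2) (Fin 2) W⟦X⟧ →*
    Matrix (Fin 2 × Fin 2) (Fin 2 × Fin 2) W⟦X⟧⟦X⟧ where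
  toFun := LaU
  map_one' := by
    ext1 x y
    rw [LaU_apply, Matrix.one_apply, Matrix.one_apply]
    by_cases h1 : x.1 = y.1 <;> by_cases h2 : x.2 = y.2 <;> simp [h1, h2, Prod.ext_iff]
  map_mul' L L' := by
    ext1 x y
    rw [Matrix.mul_apply, Fintype.sum_prod_type]
    simp only [LaU_apply, Matrix.mul_apply, map_sum, map_mul]
    by_cases h : x.2 = y.2
    · simp [h]
    · simp [h, ite_mul]

/-- `L ↦ L_b(v)` is multiplicative. -/
def LbVHom : Matrix (Fin 2) (Fin 2) W⟦X⟧ →*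
    Matrix (Fin 2 × Fin 2) (Fin 2 × Fin 2) W⟦X⟧⟦X⟧ where
  toFun := LbV
  map_one' := by
    ext1 x y
    rw [LbV_apply, Matrix.one_apply, Matrix.one_apply]
    by_cases h1 : x.1 = y.1 <;> by_cases h2 : x.2 = y.2 <;> simp [h1, h2, Prod.ext_iff]
  map_mul' L L' := by
    ext1 x y
    rw [Matrix.mul_apply, Fintype.sum_prod_type]
    simp only [LbV_apply, Matrix.mul_apply, map_sum, map_mul]
    by_cases h : x.1 = y.1
    · simp [h]
    · simp [h, ite_mul]

theorem commute_LaU_LbV {L L' : Matrix (Fin 2) (Fin 2) W⟦X⟧}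
    (h : ∀ α β γ δ, Commute (PowerSeries.C (L α β) : W⟦X⟧⟦X⟧)
      (PowerSeries.map PowerSeries.C (L' γ δ))) : Commute (LaU L) (LbV L') := by
  ext1 x y
  rw [Matrix.mul_apply, Matrix.mul_apply, Fintype.sum_prod_type, Fintype.sum_prod_type]
  simp only [LaU_apply, LbV_apply]
  simp [(h _ _ _ _).eq]

theorem mul_smul_of_commute {n : Type*} [Fintype n] {B : Type*} [Ring B] {c : B}
    {M M' : Matrix n n B} (h : ∀ x y, Commute c (M x y)) : M * c • M' = c • (M * M') := by
  ext1 x y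
  simp only [Matrix.mul_apply, Matrix.smul_apply, smul_eq_mul, Finset.mul_sum]
  refine Finset.sum_congr rfl fun z _ => ?_
  rw [← mul_assoc, ← (h x z).eq, mul_assoc]

variable {N : ℕ} [NeZero N]

theorem uNum_central (A : Type*) [Ring A] (ε : Pt) (f : A⟦X⟧) : Commute (uNum A ε) f := by
  cases ε
  · exact (PowerSeries.commute_X f).symm
  · exact Commute.one_left f

theorem uDen_central (A : Type*) [Ring A] (ε : Pt) (f : A⟦X⟧) : Commute (uDen A ε) f := by
  cases ε
  · exact Commute.one_left f
  · exact (PowerSeries.commute_X f).symm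

theorem powerSeries_map_smul {A B : Type*} [Ring A] [Algebra ℂ A] [Ring B] [Algebra ℂ B]
    {f : A →+* B} (hf : ∀ (c : ℂ) a, f (c • a) = c • f a) (c : ℂ) (a : A⟦X⟧) :
    PowerSeries.map f (c • a) = c • PowerSeries.map f a := by
  ext n; simp [hf]

theorem powerSeries_C_smul {A : Type*} [Ring A] [Algebra ℂ A] (c : ℂ) (a : A) :
    (PowerSeries.C (c • a) : A⟦X⟧) = c • PowerSeries.C a := by
  ext n; simp only [PowerSeries.coeff_C, PowerSeries.coeff_smul]; split_ifs <;> simp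

/-- As `y` commutes with the matrix units of its site, it may be replaced by the indeterminate of
`Polynomial ℂ`. The scalar Yang–Baxter equation holds over double power series in that ring and is
then specialised at `y`. -/
theorem rll_siteNum (q : ℂ) {y : Module.End ℂ (BigSpace N)} {i : Fin N}
    (hy : ∀ s s', Commute y (siteUnit i s s')) (ε ε' : Pt) :
    RnumUV _ q ε ε' * LaU (siteNum q y ε i) * LbV (siteNum q y ε' i)
      = LbV (siteNum q y ε' i) * LaU (siteNum q y ε i) * RnumUV _ q ε ε' := by
  let f : Polynomial ℂ →ₐ[ℂ] Module.End ℂ (BigSpace N) := Polynomial.aeval y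
  let g : (Polynomial ℂ)⟦X⟧⟦X⟧ →+* (Module.End ℂ (BigSpace N))⟦X⟧⟦X⟧ :=
    PowerSeries.map (PowerSeries.map f.toRingHom)
  let e : Fin 2 → Fin 2 → (Module.End ℂ (BigSpace N))⟦X⟧⟦X⟧ := fun s s' =>
    PowerSeries.C (PowerSeries.C (siteUnit i s s'))
  have hcf : ∀ c s s', Commute (f c) (siteUnit i s s') := fun c s s' => by
    induction c using Polynomial.induction_on' with
    | add a b ha hb => rw [map_add]; exact ha.add_left hb
    | monomial n a =>
      rw [← Polynomial.C_mul_X_pow_eq_monomial, map_mul, map_pow, Polynomial.aeval_C,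
        Polynomial.aeval_X]
      exact Commute.mul_left (Algebra.commutes a _) ((hy s s').pow_left n)
  have hce : ∀ c s s', Commute (g c) (e s s') := fun c s s' => by
    refine commute_powerSeries fun m n => ?_
    rw [PowerSeries.coeff_C, PowerSeries.coeff_map]
    split_ifs
    · refine commute_powerSeries fun m n => ?_
      rw [PowerSeries.coeff_C, PowerSeries.coeff_map]
      split_ifs
      · exact hcf _ _ _
      · exact Commute.zero_right _
    · exact Commute.zero_right _
  have hee : ∀ s s' r r', e s s' * e r r' = if s' = r then e s r' else 0 := fun s s' r r' => by
    simp only [e, ← map_mul, siteUnit_mul]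
    split_ifs <;> simp
  have he1 : ∑ s, e s s = 1 := by
    simp only [e, ← map_sum, sum_siteUnit, map_one]
  have hg : ∀ (c : ℂ) a, g (c • a) = c • g a :=
    powerSeries_map_smul (map_powerSeriesMap_smul f)
  have gC : ∀ a, g (PowerSeries.C a) = PowerSeries.C (PowerSeries.map f.toRingHom a) :=
    fun a => PowerSeries.map_C _ _
  have fC : PowerSeries.map f.toRingHom (PowerSeries.C Polynomial.X) = PowerSeries.C y :=
    (PowerSeries.map_C _ _).trans (congrArg _ (Polynomial.aeval_X y))
  have gN : g (uNum _ ε') = uNum _ ε' := map_uNum _ _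
  have gD : g (uDen _ ε') = uDen _ ε' := map_uDen _ _
  refine rll_of_matrixUnits g e hee he1 hce hg q (PowerSeries.C (uNum _ ε))
    (PowerSeries.C (uDen _ ε)) (uNum _ ε') (uDen _ ε')
    (PowerSeries.C (PowerSeries.C Polynomial.X)) (fun x x' => ?_) (fun x x' => ?_)
    (fun x x' => ?_)
  · simp only [map_mul, gC, map_uNum, map_uDen, gN, gD, RnumUV]
  · have hM := map_Rnum (PowerSeries.C : (Module.End ℂ (BigSpace N))⟦X⟧ →+*
      (Module.End ℂ (BigSpace N))⟦X⟧⟦X⟧) (fun c a => powerSeries_C_smul c a)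
    simp only [LaU_apply, siteNum, Matrix.of_apply, map_mul, gC, map_uNum, map_uDen, fC, map_sum,
      hM, e]
  · have hM := map_Rnum (PowerSeries.map PowerSeries.C : (Module.End ℂ (BigSpace N))⟦X⟧ →+*
      (Module.End ℂ (BigSpace N))⟦X⟧⟦X⟧)
      (fun c a => powerSeries_map_smul (fun c a => powerSeries_C_smul c a) c a)
    simp only [LbV_apply, siteNum, Matrix.of_apply, map_mul, gC, gN, gD, fC, map_sum,
      hM, map_uNum, map_uDen, PowerSeries.map_C, e]

theorem commute_of_mem_serIn {A : Type*} [Ring A] [Algebra ℂ A] {S S' : Subalgebra ℂ A}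
    (h : ∀ x ∈ S, ∀ y ∈ S', Commute x y) {f g : A⟦X⟧} (hf : f ∈ serIn S) (hg : g ∈ serIn S') :
    Commute (PowerSeries.C f : A⟦X⟧⟦X⟧) (PowerSeries.map PowerSeries.C g) :=
  commute_C_map_C fun m n => h _ (hf m) _ (hg n)

/-- The operators generated by `Y_i` and `Y_i⁻¹`. -/
def yAlg (q p : ℂ) (i : Fin N) : Subalgebra ℂ (Module.End ℂ (BigSpace N)) :=
  Algebra.adjoin ℂ {bigY q p i, bigYInv q p i}

/-- The operators generated by `Y_i`, `Y_i⁻¹` and the matrix units at site `i`. -/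
def siteAlg (q p : ℂ) (i : Fin N) : Subalgebra ℂ (Module.End ℂ (BigSpace N)) :=
  Algebra.adjoin ℂ ({bigY q p i, bigYInv q p i} ∪ Set.range fun x : Fin 2 × Fin 2 =>
    siteUnit i x.1 x.2)

theorem commute_adjoin {A : Type*} [Ring A] [Algebra ℂ A] {s t : Set A}
    (h : ∀ x ∈ s, ∀ y ∈ t, Commute x y) {x y : A} (hx : x ∈ Algebra.adjoin ℂ s)
    (hy : y ∈ Algebra.adjoin ℂ t) : Commute x y := by
  have h1 : ∀ z ∈ t, Commute x z := fun z hz =>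
    (Algebra.commute_of_mem_adjoin_of_forall_mem_commute hx fun b hb => (h b hb z hz).symm).symm
  exact Algebra.commute_of_mem_adjoin_of_forall_mem_commute hy h1

section

variable {q p : ℂ} (hq : q ≠ 0) (hp : p ≠ 0)
include hq hp

theorem commute_bigY_bigY (i j : Fin N) :
    Commute (bigY q p i) (bigY q p j) ∧ Commute (bigY q p i) (bigYInv q p j) ∧
      Commute (bigYInv q p i) (bigYInv q p j) := by
  have h := fun k => isUnit_Y hq hp (N := N) k
  have c1 : ∀ i j : Fin N, Commute (Y q p i) (Y q p j) := commute_Y hq hp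
  have c2 : ∀ i j : Fin N, Commute (Y q p i) (Ring.inverse (Y q p j)) := fun i j =>
    commute_of_inverse (Ring.mul_inverse_cancel _ (h j)) (Ring.inverse_mul_cancel _ (h j)) (c1 i j)
  have c3 : Commute (Ring.inverse (Y q p i)) (Ring.inverse (Y q p j)) :=
    commute_of_inverse (Ring.mul_inverse_cancel _ (h j)) (Ring.inverse_mul_cancel _ (h j))
      (c2 j i).symm
  exact ⟨(c1 i j).map _, (c2 i j).map _, c3.map _⟩

theorem commute_siteAlg {i j : Fin N} (hij : i ≠ j) {x y : Module.End ℂ (BigSpace N)}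
    (hx : x ∈ siteAlg q p i) (hy : y ∈ siteAlg q p j) : Commute x y := by
  obtain ⟨h1, h2, h3⟩ := commute_bigY_bigY hq hp i j
  obtain ⟨h1', h2', h3'⟩ := commute_bigY_bigY hq hp j i
  refine commute_adjoin (fun x hx y hy => ?_) hx hy
  rcases hx with (rfl | rfl) | ⟨a, rfl⟩ <;> rcases hy with (rfl | rfl) | ⟨b, rfl⟩
  · exact h1
  · exact h2
  · exact (commute_siteUnit_bigY _ _ _ _).symm
  · exact h2'.symm
  · exact h3
  · exact (commute_siteUnit_bigYInv _ _ _ _).symm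
  · exact commute_siteUnit_bigY _ _ _ _
  · exact commute_siteUnit_bigYInv _ _ _ _
  · exact commute_siteUnit hij _ _ _ _

theorem commute_yAlg_siteAlg {i : Fin N} {x y : Module.End ℂ (BigSpace N)}
    (hx : x ∈ yAlg q p i) (hy : y ∈ siteAlg q p i) : Commute x y := by
  obtain ⟨h1, h2, h3⟩ := commute_bigY_bigY hq hp i i
  refine commute_adjoin (fun x hx y hy => ?_) hx hy
  rcases hx with rfl | rfl <;> rcases hy with (rfl | rfl) | ⟨b, rfl⟩
  · exact h1
  · exact h2
  · exact (commute_siteUnit_bigY _ _ _ _).symm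
  · exact h2.symm
  · exact h3
  · exact (commute_siteUnit_bigYInv _ _ _ _).symm

omit hq hp in
theorem mem_siteAlg (i : Fin N) : bigY q p i ∈ siteAlg q p i ∧ bigYInv q p i ∈ siteAlg q p i ∧
    ∀ s s', siteUnit i s s' ∈ siteAlg q p i :=
  ⟨Algebra.subset_adjoin (Or.inl (Or.inl rfl)), Algebra.subset_adjoin (Or.inl (Or.inr rfl)),
    fun s s' => Algebra.subset_adjoin (Or.inr ⟨(s, s'), rfl⟩)⟩

omit hq hp in
theorem mem_yAlg (i : Fin N) : bigY q p i ∈ yAlg q p i ∧ bigYInv q p i ∈ yAlg q p i :=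
  ⟨Algebra.subset_adjoin (Or.inl rfl), Algebra.subset_adjoin (Or.inr rfl)⟩

omit hq hp in
theorem LaU_smul {W : Type*} [Ring W] [Algebra ℂ W] (c : W⟦X⟧) (L : Matrix (Fin 2) (Fin 2) W⟦X⟧) :
    LaU (c • L) = (PowerSeries.C c : W⟦X⟧⟦X⟧) • LaU L := by
  ext1 x y
  rw [Matrix.smul_apply]
  simp only [LaU_apply, Matrix.smul_apply, smul_eq_mul, map_mul]
  split_ifs <;> simp

omit hq hp in
theorem LbV_smul {W : Type*} [Ring W] [Algebra ℂ W] (c : W⟦X⟧) (L : Matrix (Fin 2) (Fin 2) W⟦X⟧) :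
    LbV (c • L) = (PowerSeries.map PowerSeries.C c : W⟦X⟧⟦X⟧) • LbV L := by
  ext1 x y
  rw [Matrix.smul_apply]
  simp only [LbV_apply, Matrix.smul_apply, smul_eq_mul, map_mul]
  split_ifs <;> simp

omit hq hp in
theorem commute_RnumUV {W : Type*} [Ring W] [Algebra ℂ W] (q : ℂ) (ε ε' : Pt) (c : W⟦X⟧⟦X⟧)
    (x y : Fin 2 × Fin 2) : Commute c (RnumUV W q ε ε' x y) := by
  have h1 : Commute c (PowerSeries.C (uNum W ε)) := commute_powerSeries fun m n => by
    rw [PowerSeries.coeff_C]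
    split_ifs
    · exact (uNum_central W ε _).symm
    · exact Commute.zero_right _
  have h2 : Commute c (PowerSeries.C (uDen W ε)) := commute_powerSeries fun m n => by
    rw [PowerSeries.coeff_C]
    split_ifs
    · exact (uDen_central W ε _).symm
    · exact Commute.zero_right _
  have h3 : ∀ a b, a ∈ Subalgebra.centralizer ℂ {c} → b ∈ Subalgebra.centralizer ℂ {c} →
      Commute c (Rnum q a b x y) := fun a b ha hb =>
    (Subalgebra.mem_centralizer_iff ℂ).1 (Rnum_mem q ha hb x y) c rfl
  refine h3 _ _ ?_ ?_ <;> refine (Subalgebra.mem_centralizer_iff ℂ).2 fun z hz => ?_ <;>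
    rw [Set.mem_singleton_iff.1 hz]
  · exact h1.mul_right (uDen_central W⟦X⟧ ε' c).symm
  · exact h2.mul_right (uNum_central W⟦X⟧ ε' c).symm

/-- The denominators lie in the algebra generated by `Y_i` and `Y_i⁻¹`, which commutes with all
entries of the factors at site `i`, so they can be put back on both sides. -/
theorem rll_siteL (ε ε' : Pt) (i : Fin N) :
    RnumUV _ q ε ε' * LaU (siteL q p ε i) * LbV (siteL q p ε' i)
      = LbV (siteL q p ε' i) * LaU (siteL q p ε i) * RnumUV _ q ε ε' := by
  have key := rll_siteNum q (y := bigY q p i) (i := i)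
    (fun s s' => (commute_siteUnit_bigY _ _ _ _).symm) ε ε'
  obtain ⟨m1, m2⟩ := mem_yAlg (q := q) (p := p) i
  obtain ⟨n1, n2, n3⟩ := mem_siteAlg (q := q) (p := p) i
  have hd : ∀ ε, siteDenInv q p ε i ∈ serIn (yAlg q p i) := siteDenInv_mem m1 m2
  have hn : ∀ ε α β, siteNum q (bigY q p i) ε i α β ∈ serIn (siteAlg q p i) := siteNum_mem n1 n3
  have hcc : ∀ x ∈ yAlg q p i, ∀ y ∈ siteAlg q p i, Commute x y :=
    fun x hx y hy => commute_yAlg_siteAlg hq hp hx hy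
  have hyy : ∀ x ∈ yAlg q p i, x ∈ siteAlg q p i := fun x hx =>
    Algebra.adjoin_mono Set.subset_union_left hx
  rw [siteL_eq hq hp, siteL_eq hq hp, LaU_smul, LbV_smul]
  set x : (Module.End ℂ (BigSpace N))⟦X⟧⟦X⟧ := PowerSeries.C (siteDenInv q p ε i)
  set y : (Module.End ℂ (BigSpace N))⟦X⟧⟦X⟧ := PowerSeries.map PowerSeries.C (siteDenInv q p ε' i)
  set R := RnumUV (Module.End ℂ (BigSpace N)) q ε ε'
  set P := LaU (siteNum q (bigY q p i) ε i) with hP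
  set Q := LbV (siteNum q (bigY q p i) ε' i) with hQ
  have c1 : ∀ a b, Commute y (P a b) := fun a b => by
    rw [hP, LaU_apply]
    split_ifs
    · exact (commute_of_mem_serIn (fun x hx y hy => (hcc y hy x hx).symm) (hn _ _ _) (hd _)).symm
    · exact Commute.zero_right _
  have c2 : ∀ a b, Commute x (Q a b) := fun a b => by
    rw [hQ, LbV_apply]
    split_ifs
    · exact commute_of_mem_serIn hcc (hd _) (hn _ _ _)
    · exact Commute.zero_right _
  have c3 : Commute x y :=
    commute_of_mem_serIn hcc (hd _) (fun n => hyy _ (hd ε' n))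
  rw [mul_smul_of_commute (commute_RnumUV q ε ε' x), Matrix.smul_mul, mul_assoc R,
    mul_smul_of_commute c1, mul_smul_of_commute (commute_RnumUV q ε ε' y), ← mul_assoc, key,
    Matrix.smul_mul, mul_smul_of_commute c2, Matrix.smul_mul, Matrix.smul_mul, smul_smul, smul_smul,
    c3.eq]

/-- Entries at different sites commute because the `Y`'s do and the matrix units act in different
tensor factors, so the one-site relations combine along the chain. -/
theorem satisfiesRLL_mode : SatisfiesRLL q (mode (N := N) q p) := by
  intro ε ε'
  rw [rllLeft, rllRight, seriesMatrix_mode, seriesMatrix_mode]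
  have h1 := map_list_prod (LaUHom (W := Module.End ℂ (BigSpace N)))
    ((List.finRange N).reverse.map (siteL q p ε))
  have h2 := map_list_prod (LbVHom (W := Module.End ℂ (BigSpace N)))
    ((List.finRange N).reverse.map (siteL q p ε'))
  rw [List.map_map] at h1 h2
  change LaU _ = _ at h1
  change LbV _ = _ at h2
  rw [h1, h2]
  refine train _ _ _ _ (List.nodup_reverse.2 (List.nodup_finRange N)) (rll_siteL hq hp ε ε')
    fun i j hij => ?_
  obtain ⟨n1, n2, n3⟩ := mem_siteAlg (q := q) (p := p) i
  obtain ⟨k1, k2, k3⟩ := mem_siteAlg (q := q) (p := p) j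
  exact commute_LaU_LbV fun α β γ δ => commute_of_mem_serIn
    (fun x hx y hy => commute_siteAlg hq hp hij hx hy) (siteL_mem hq hp n1 n2 n3 _ _ _)
    (siteL_mem hq hp k1 k2 k3 _ _ _)

end

end RLLRelations


/-! ## The physical space is preserved -/

section PhysicalSpace

variable {N : ℕ}

/-- The difference of the spin and the polynomial Hecke generators. -/
def heckeDiff (q : ℂ) (i j : Fin N) : Module.End ℂ (BigSpace N) :=
  spinTwo i j (Tsp q) - polActHom (Tpol q i j)

theorem mem_physical {q : ℂ} {Ψ : BigSpace N} :
    Ψ ∈ physical N q ↔ ∀ i j : Fin N, (j : ℕ) = i + 1 → heckeDiff q i j Ψ = 0 := by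
  simp only [physical, Submodule.mem_iInf, LinearMap.mem_ker]
  refine forall_congr' fun i => forall_congr' fun j => forall_congr' fun h => ?_
  have hij : i ≠ j := fun e => by rw [e] at h; omega
  rw [spinAct_twoSite hij]
  rfl

/-- Commuting with the defining operators would be too much to ask. To preserve their kernels it is
enough that each of them can be moved to the right, whatever `O` turns into. -/
theorem mem_physical_of_intertwines {q : ℂ} {O : Module.End ℂ (BigSpace N)}
    (h : ∀ i j : Fin N, (j : ℕ) = i + 1 → ∃ Z, heckeDiff q i j * O = Z * heckeDiff q i j)
    {Ψ : BigSpace N} (hΨ : Ψ ∈ physical N q) : O Ψ ∈ physical N q := by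
  rw [mem_physical] at hΨ ⊢
  intro i j hij
  obtain ⟨Z, hZ⟩ := h i j hij
  have := DFunLike.congr_fun hZ Ψ
  rw [Module.End.mul_apply, Module.End.mul_apply, hΨ i j hij, map_zero] at this
  exact this

theorem polActHom_mem_physical [NeZero N] {q : ℂ} {O : Module.End ℂ (Pol N)}
    (h : ∀ i : ℕ, i + 1 < N → Commute (heckeT N q i) O) {Ψ : BigSpace N}
    (hΨ : Ψ ∈ physical N q) : polActHom O Ψ ∈ physical N q := by
  refine mem_physical_of_intertwines (fun i j hij => ⟨polActHom O, ?_⟩) hΨ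
  have hi : (i : ℕ) + 1 < N := hij ▸ j.2
  have h1 : Commute (Tpol q i j) O := by
    have := h i hi
    rw [heckeT_of_lt q hi] at this
    have e : j = ⟨i + 1, hi⟩ := Fin.ext hij
    rw [e]; exact this
  exact ((commute_spinTwo_polActHom i j _ O).sub_left (h1.map _)).eq

/-- `K` is the product of two local coefficients in the auxiliary space. -/
def pairCoef (q : ℂ) (c c' d d' : ℂ) (α β : Fin 2) : Matrix (Fin 2 × Fin 2) (Fin 2 × Fin 2) ℂ :=
  Matrix.of fun x y => ∑ γ, Rnum q d d' (γ, x.1) (β, y.1) * Rnum q c c' (α, x.2) (γ, y.2)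

/-- With the next lemmas this expresses, coefficient by coefficient in the two spectral variables,
that the braid-form `R`-matrix intertwines a product of two one-site factors. The extreme
coefficients commute with `T^sp`. -/
theorem Tsp_mul_pairCoef_diag {q : ℂ} (hq : q ≠ 0) (α β : Fin 2) :
    Tsp q * pairCoef q 1 0 1 0 α β = pairCoef q 1 0 1 0 α β * Tsp q ∧
      Tsp q * pairCoef q 0 1 0 1 α β = pairCoef q 0 1 0 1 α β * Tsp q := by
  constructor <;> ext x y <;> obtain ⟨x1, x2⟩ := x <;> obtain ⟨y1, y2⟩ := y <;>
    simp only [Matrix.mul_apply, Fintype.sum_prod_type, Fin.sum_univ_two, pairCoef,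
      Matrix.of_apply] <;>
    fin_cases α <;> fin_cases β <;> fin_cases x1 <;> fin_cases x2 <;> fin_cases y1 <;>
    fin_cases y2 <;>
    simp [Tsp, Rnum, RcheckNum, Rden, -mul_eq_mul_left_iff, -mul_eq_mul_right_iff] <;>
    field_simp <;> ring

theorem Tsp_mul_pairCoef_offDiag {q : ℂ} (hq : q ≠ 0) (α β : Fin 2) :
    Tsp q * pairCoef q 1 0 0 1 α β = pairCoef q 0 1 1 0 α β * Tsp q := by
  ext x y; obtain ⟨x1, x2⟩ := x; obtain ⟨y1, y2⟩ := y
  simp only [Matrix.mul_apply, Fintype.sum_prod_type, Fin.sum_univ_two, pairCoef,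
    Matrix.of_apply]
  fin_cases α <;> fin_cases β <;> fin_cases x1 <;> fin_cases x2 <;> fin_cases y1 <;>
    fin_cases y2 <;>
    simp [Tsp, Rnum, RcheckNum, Rden, -mul_eq_mul_left_iff, -mul_eq_mul_right_iff] <;>
    field_simp <;> ring

theorem Tsp_mul_self {q : ℂ} (hq : q ≠ 0) : Tsp q * Tsp q = (q - q⁻¹) • Tsp q + 1 := by
  ext x y; obtain ⟨x1, x2⟩ := x; obtain ⟨y1, y2⟩ := y
  simp only [Matrix.mul_apply, Fintype.sum_prod_type, Fin.sum_univ_two]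
  fin_cases x1 <;> fin_cases x2 <;> fin_cases y1 <;> fin_cases y2 <;>
    simp [Tsp] <;> field_simp <;> ring

theorem Tsp_mul_pairCoef_offDiag' {q : ℂ} (hq : q ≠ 0) (α β : Fin 2) :
    Tsp q * pairCoef q 0 1 1 0 α β + (q - q⁻¹) • pairCoef q 1 0 0 1 α β
      = (q - q⁻¹) • pairCoef q 0 1 1 0 α β + pairCoef q 1 0 0 1 α β * Tsp q := by
  have h := Tsp_mul_pairCoef_offDiag hq α β
  set T := Tsp q
  set B := pairCoef q 0 1 1 0 α β
  set C := pairCoef q 1 0 0 1 α β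
  have h2 : T * T = (q - q⁻¹) • T + 1 := Tsp_mul_self hq
  -- The second mixed relation is the first one solved with the inverse of `T`, so it needs no
  -- further check of entries.
  have hinv : T * (T - (q - q⁻¹) • 1) = 1 := by rw [mul_sub, h2]; simp
  have hB : B = T * C * (T - (q - q⁻¹) • 1) := by
    rw [h, mul_assoc, hinv, mul_one]
  rw [hB, ← mul_assoc, ← mul_assoc, h2]
  simp only [mul_sub, add_mul, sub_mul, smul_mul_assoc, one_mul, Matrix.mul_smul, mul_one,
    smul_sub, smul_smul]
  abel

theorem C_smul' {A : Type*} [Ring A] [Algebra ℂ A] (c : ℂ) (a : A) :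
    (PowerSeries.C (c • a) : A⟦X⟧) = c • PowerSeries.C a := powerSeries_C_smul c a

/-- The spin part of a local factor. -/
def siteMat (i : Fin N) (m : Fin 2 → Fin 2 → ℂ) : Module.End ℂ (BigSpace N) :=
  ∑ s, ∑ s', m s s' • siteUnit i s s'

theorem Rnum_eq {A : Type*} [Ring A] [Algebra ℂ A] (q : ℂ) (a b : A) (x y : Fin 2 × Fin 2) :
    Rnum q a b x y = Rnum q (1 : ℂ) 0 x y • a + Rnum q (0 : ℂ) 1 x y • b := by
  simp only [Rnum, RcheckNum, Rden, Matrix.of_apply]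
  split_ifs <;> simp [sub_eq_add_neg]

theorem siteNum_eq (q : ℂ) {y : Module.End ℂ (BigSpace N)} {i : Fin N}
    (hy : ∀ s s', Commute y (siteUnit i s s')) (ε : Pt) (α β : Fin 2) :
    siteNum q y ε i α β
      = uNum _ ε * PowerSeries.C (y * siteMat i fun s s' => Rnum q 1 0 (α, s) (β, s'))
        + uDen _ ε * PowerSeries.C (siteMat i fun s s' => Rnum q 0 1 (α, s) (β, s')) := by
  rw [siteNum, Matrix.of_apply]
  simp only [siteMat, Finset.mul_sum, map_sum, ← Finset.sum_add_distrib]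
  refine Finset.sum_congr rfl fun s _ => Finset.sum_congr rfl fun s' _ => ?_
  rw [Rnum_eq, mul_add, mul_smul_comm, mul_smul_comm, mul_smul_comm, C_smul', C_smul',
    mul_smul_comm, mul_smul_comm, ← (uDen_central _ ε _).eq, (hy s s').eq, map_mul,
    ← mul_assoc, ← mul_assoc, (uNum_central _ ε _).eq]

theorem sum_siteMat_mul (q : ℂ) {i j : Fin N} (hij : i ≠ j) (c c' d d' : ℂ) (α β : Fin 2) :
    ∑ γ, siteMat j (fun s s' => Rnum q c c' (α, s) (γ, s'))
        * siteMat i (fun s s' => Rnum q d d' (γ, s) (β, s'))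
      = spinTwo i j (pairCoef q c c' d d' α β) := by
  simp only [siteMat, spinTwo, pairCoef, Matrix.of_apply, Fintype.sum_prod_type, Finset.sum_smul,
    Finset.sum_mul_sum, smul_mul_smul_comm, (commute_siteUnit hij.symm _ _ _ _).eq]
  simp only [Fin.sum_univ_two, mul_comm (Rnum q c c' _ _)]
  abel

theorem commute_siteMat {i : Fin N} {x : Module.End ℂ (BigSpace N)}
    (h : ∀ s s', Commute x (siteUnit i s s')) (m : Fin 2 → Fin 2 → ℂ) : Commute x (siteMat i m) :=
  Commute.sum_right _ _ _ fun s _ => Commute.sum_right _ _ _ fun s' _ => (h s s').smul_right _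

theorem central_mul_C {W : Type*} [Ring W] {x x' : W⟦X⟧} (hx : ∀ f, Commute x' f) (m n : W) :
    x * PowerSeries.C m * (x' * PowerSeries.C n) = x * x' * PowerSeries.C (m * n) := by
  rw [map_mul, mul_assoc, ← mul_assoc (PowerSeries.C m), ← (hx _).eq]
  simp only [mul_assoc]

theorem affine_mul_affine {W : Type*} [Ring W] {a b : W⟦X⟧} (ha : ∀ f, Commute a f)
    (hb : ∀ f, Commute b f) {y y' s₁ s₀ r₁ r₀ : W} (h1 : Commute y s₁) (h0 : Commute y s₀) :
    (a * PowerSeries.C (y' * s₁) + b * PowerSeries.C s₀)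
        * (a * PowerSeries.C (y * r₁) + b * PowerSeries.C r₀)
      = a * a * PowerSeries.C (y' * y * (s₁ * r₁))
        + a * b * PowerSeries.C (y' * (s₁ * r₀) + y * (s₀ * r₁))
        + b * b * PowerSeries.C (s₀ * r₀) := by
  rw [add_mul, mul_add, mul_add, central_mul_C ha, central_mul_C hb, central_mul_C ha,
    central_mul_C hb, (ha b).eq.symm,
    show y' * s₁ * (y * r₁) = y' * y * (s₁ * r₁) by
      rw [mul_assoc, ← mul_assoc s₁, ← h1.eq]; simp only [mul_assoc],
    show s₀ * (y * r₁) = y * (s₀ * r₁) by rw [← mul_assoc, ← h0.eq, mul_assoc],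
    mul_assoc y' s₁ r₀, map_add, mul_add]
  abel

theorem C_mul_central {W : Type*} [Ring W] {x : W⟦X⟧} (hx : ∀ f, Commute x f) (m n : W) :
    PowerSeries.C m * (x * PowerSeries.C n) = x * PowerSeries.C (m * n) := by
  rw [map_mul, ← mul_assoc, ← (hx _).eq, mul_assoc]

/-- Write the product of two factors as a quadratic form in `a`, `b`. The spin part `T` exchanges
the two mixed coefficients and the polynomial part `τ` exchanges `y` and `y'`, each up to a multiple
of `κ`; these defects cancel in `T - τ`. On the right-hand side `y` and `y'` have changed places. -/
theorem diff_mul_quadratic {W : Type*} [Ring W] [Algebra ℂ W] {a b : W⟦X⟧}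
    (ha : ∀ f, Commute a f) (hb : ∀ f, Commute b f) {κ : ℂ} {T τ y y' s₁₁ s₁₀ s₀₁ s₀₀ : W}
    (t1 : τ * y' = y * τ - κ • y) (t2 : τ * y = y' * τ + κ • y)
    (t3 : τ * (y * y') = y * y' * τ) (hyy : y' * y = y * y')
    (d1 : T * s₁₁ = s₁₁ * T) (d2 : T * s₀₀ = s₀₀ * T) (d3 : T * s₁₀ = s₀₁ * T)
    (d4 : T * s₀₁ + κ • s₁₀ = κ • s₀₁ + s₁₀ * T)
    (cT : Commute T y) (cT' : Commute T y') (c11 : Commute s₁₁ τ) (c10 : Commute s₁₀ τ)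
    (c01 : Commute s₀₁ τ) (c00 : Commute s₀₀ τ) :
    PowerSeries.C (T - τ) * (a * a * PowerSeries.C (y' * y * s₁₁)
        + a * b * PowerSeries.C (y' * s₁₀ + y * s₀₁) + b * b * PowerSeries.C s₀₀)
      = (a * a * PowerSeries.C (y * y' * s₁₁)
        + a * b * PowerSeries.C (y * s₁₀ + y' * s₀₁) + b * b * PowerSeries.C s₀₀)
        * PowerSeries.C (T - τ) := by
  have haa : ∀ f, Commute (a * a) f := fun f => (ha f).mul_left (ha f)
  have hab : ∀ f, Commute (a * b) f := fun f => (ha f).mul_left (hb f)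
  have hbb : ∀ f, Commute (b * b) f := fun f => (hb f).mul_left (hb f)
  rw [mul_add, mul_add, C_mul_central haa, C_mul_central hab, C_mul_central hbb, add_mul, add_mul,
    mul_assoc (a * a), mul_assoc (a * b), mul_assoc (b * b), ← map_mul, ← map_mul, ← map_mul]
  have e1 : (T - τ) * (y' * y * s₁₁) = y * y' * s₁₁ * (T - τ) := by
    rw [hyy, sub_mul, mul_sub, ← mul_assoc τ, t3, ← mul_assoc, (cT.mul_right cT').eq, mul_assoc,
      d1, mul_assoc (y * y') τ, ← c11.eq]
    simp only [mul_assoc]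
  have e2 : (T - τ) * s₀₀ = s₀₀ * (T - τ) := by
    rw [sub_mul, mul_sub, d2, c00.eq]
  have e3 : (T - τ) * (y' * s₁₀ + y * s₀₁) = (y * s₁₀ + y' * s₀₁) * (T - τ) := by
    have f1 : T * (y' * s₁₀) = y' * s₀₁ * T := by
      rw [← mul_assoc, cT'.eq, mul_assoc, d3, mul_assoc]
    have f2 : T * (y * s₀₁) = κ • (y * s₀₁) + y * s₁₀ * T - κ • (y * s₁₀) := by
      rw [← mul_assoc, cT.eq, mul_assoc, eq_sub_of_add_eq d4, mul_sub, mul_add, mul_smul_comm,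
        mul_smul_comm, mul_assoc]
    have f3 : τ * (y' * s₁₀) = y * s₁₀ * τ - κ • (y * s₁₀) := by
      rw [← mul_assoc, t1, sub_mul, mul_assoc, ← c10.eq, smul_mul_assoc, mul_assoc]
    have f4 : τ * (y * s₀₁) = y' * s₀₁ * τ + κ • (y * s₀₁) := by
      rw [← mul_assoc, t2, add_mul, mul_assoc, ← c01.eq, smul_mul_assoc, mul_assoc]
    rw [sub_mul, mul_add, mul_add, f1, f2, f3, f4, mul_sub, add_mul, add_mul]
    abel
  rw [e1, e2, e3]

theorem siteNum_mul_siteNum (q : ℂ) {i j : Fin N} (hij : i ≠ j) {y y' : Module.End ℂ (BigSpace N)}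
    (hy : ∀ k s s', Commute y (siteUnit k s s')) (hy' : ∀ k s s', Commute y' (siteUnit k s s'))
    (ε : Pt) (α β : Fin 2) :
    (siteNum q y' ε j * siteNum q y ε i) α β
      = uNum _ ε * uNum _ ε * PowerSeries.C (y' * y * spinTwo i j (pairCoef q 1 0 1 0 α β))
        + uNum _ ε * uDen _ ε * PowerSeries.C (y' * spinTwo i j (pairCoef q 1 0 0 1 α β)
          + y * spinTwo i j (pairCoef q 0 1 1 0 α β))
        + uDen _ ε * uDen _ ε * PowerSeries.C (spinTwo i j (pairCoef q 0 1 0 1 α β)) := by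
  rw [Matrix.mul_apply]
  simp only [siteNum_eq q (hy i), siteNum_eq q (hy' j), ← sum_siteMat_mul q hij, Finset.mul_sum,
    map_sum, map_add, ← Finset.sum_add_distrib]
  refine Finset.sum_congr rfl fun γ _ => ?_
  rw [affine_mul_affine (uNum_central _ ε) (uDen_central _ ε) (commute_siteMat (hy j) _)
    (commute_siteMat (hy j) _), map_add]

/-- The heart of the preservation of the physical space: passing `T^sp - T^pol` through two
neighbouring numerators exchanges the two `Y`'s. The relation `T y' T = y` supplies all commutation
rules on the polynomial side. -/
theorem heckeDiff_mul_siteNum {q : ℂ} (hq : q ≠ 0) {i j : Fin N} (hij : i ≠ j)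
    {y y' : Module.End ℂ (Pol N)} (hyy : Commute y y') (h : Tpol q i j * y' * Tpol q i j = y)
    (ε : Pt) (α β : Fin 2) :
    PowerSeries.C (heckeDiff q i j)
        * (siteNum q (polActHom y') ε j * siteNum q (polActHom y) ε i) α β
      = (siteNum q (polActHom y) ε j * siteNum q (polActHom y') ε i) α β
        * PowerSeries.C (heckeDiff q i j) := by
  have cu : ∀ (O : Module.End ℂ (Pol N)) (k : Fin N) s s',
      Commute (polActHom O) (siteUnit k s s') :=
    fun O k s s' => (commute_siteUnit_polActHom _ _ _ _).symm
  rw [siteNum_mul_siteNum q hij (cu y) (cu y'), siteNum_mul_siteNum q hij (cu y') (cu y)]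
  have hT2 := Tpol_mul_self hq hij
  have t1 : Tpol q i j * y' = y * Tpol q i j - (q - q⁻¹) • y := by
    have : y * Tpol q i j = Tpol q i j * y' * (Tpol q i j * Tpol q i j) := by
      rw [← h]; noncomm_ring
    rw [this, hT2, mul_add, mul_smul_comm, h]; simp
  have t2 : Tpol q i j * y = y' * Tpol q i j + (q - q⁻¹) • y := by
    have : Tpol q i j * y = Tpol q i j * Tpol q i j * y' * Tpol q i j := by
      rw [← h]; noncomm_ring
    rw [this, hT2, add_mul, add_mul, smul_mul_assoc, smul_mul_assoc, h, one_mul, add_comm]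
  have t3 : Commute (Tpol q i j) (y * y') := commute_mul_conj h hyy
  obtain ⟨d1, d2⟩ := Tsp_mul_pairCoef_diag hq α β
  have d3 := Tsp_mul_pairCoef_offDiag hq α β
  have d4 := Tsp_mul_pairCoef_offDiag' hq α β
  replace d1 := congrArg (spinTwo i j) d1
  replace d2 := congrArg (spinTwo i j) d2
  replace d3 := congrArg (spinTwo i j) d3
  replace d4 := congrArg (spinTwo i j) d4
  simp only [spinTwo_mul hij, spinTwo_add, spinTwo_smul] at d1 d2 d3 d4
  replace t1 := congrArg polActHom t1
  replace t2 := congrArg polActHom t2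
  replace t3 := congrArg polActHom t3.eq
  simp only [map_mul, map_sub, map_add, map_smul] at t1 t2 t3
  have cs := commute_spinTwo_polActHom i j
  exact diff_mul_quadratic (uNum_central _ ε) (uDen_central _ ε) t1 t2 t3
    (by rw [← map_mul, ← map_mul, hyy.eq]) d1 d2 d3 d4 (cs _ _) (cs _ _) (cs _ _) (cs _ _)
    (cs _ _) (cs _ _)

/-- Matrices of series that intertwine a given operator with another one. -/
def intertwiners {W : Type*} [Ring W] (θ : W) : Submonoid (Matrix (Fin 2) (Fin 2) W⟦X⟧) where
  carrier := {M | ∃ Z : Matrix (Fin 2) (Fin 2) W⟦X⟧, ∀ α β,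
    PowerSeries.C θ * M α β = Z α β * PowerSeries.C θ}
  one_mem' := ⟨1, fun α β => by
    rw [Matrix.one_apply]; split_ifs <;> simp⟩
  mul_mem' := by
    rintro M M' ⟨Z, hZ⟩ ⟨Z', hZ'⟩
    refine ⟨Z * Z', fun α β => ?_⟩
    simp only [Matrix.mul_apply, Finset.mul_sum, Finset.sum_mul]
    refine Finset.sum_congr rfl fun γ _ => ?_
    rw [← mul_assoc, hZ, mul_assoc, hZ', mul_assoc]

/-- The product of the two denominators is symmetric in `Y_i` and `Y_j`: it depends only on their
sum and product, with which `T^sp - T^pol` commutes. So does its inverse. -/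
theorem heckeDiff_mul_denInv [NeZero N] {q p : ℂ} (hq : q ≠ 0) (hp : p ≠ 0) {i j : Fin N}
    (hij : (j : ℕ) = i + 1) (ε : Pt) :
    Commute (PowerSeries.C (heckeDiff q i j)) (siteDenInv q p ε j * siteDenInv q p ε i) := by
  have hi : (i : ℕ) + 1 < N := hij ▸ j.2
  have hne : i ≠ j := fun e => by rw [e] at hij; omega
  have eT : heckeT N q i = Tpol q i j := by
    rw [heckeT_of_lt q hi, show j = ⟨i + 1, hi⟩ from Fin.ext hij]
  have h1 : Tpol q i j * Y q p j * Tpol q i j = Y q p i := by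
    rw [Y_eq_natY, Y_eq_natY, hij, ← eT]; exact heckeT_mul_natY_mul hq hp hi
  have c1 : Commute (heckeDiff q i j) (bigY q p i + bigY q p j) := by
    refine Commute.sub_left ?_ ?_
    · exact (commute_spinTwo_polActHom i j _ _).add_right (commute_spinTwo_polActHom i j _ _)
    · rw [bigY, bigY, ← map_add]
      exact (commute_add_conj (Tpol_mul_self hq hne) h1).map _
  have c2 : Commute (heckeDiff q i j) (bigY q p i * bigY q p j) := by
    refine Commute.sub_left ?_ ?_
    · exact (commute_spinTwo_polActHom i j _ _).mul_right (commute_spinTwo_polActHom i j _ _)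
    · rw [bigY, bigY, ← map_mul]
      exact (commute_mul_conj h1 (commute_Y hq hp i j)).map _
  have inv : ∀ k : Fin N, Rden q (uNum _ ε * PowerSeries.C (bigY q p k)) (uDen _ ε)
        * siteDenInv q p ε k = 1 ∧
      siteDenInv q p ε k * Rden q (uNum _ ε * PowerSeries.C (bigY q p k)) (uDen _ ε) = 1 := by
    intro k
    have h2 := smul_Y_mul_smul_inverse hq hp k
    have e1 : q ^ 2 • bigY q p k * ((q ^ 2)⁻¹ • bigYInv q p k) = 1 := by
      have := congrArg (polActHom (N := N)) h2.1
      rw [map_mul, map_smul, map_smul, map_one] at this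
      exact this
    have e2 : ((q ^ 2)⁻¹ • bigYInv q p k) * q ^ 2 • bigY q p k = 1 := by
      have := congrArg (polActHom (N := N)) h2.2
      rw [map_mul, map_smul, map_smul, map_one] at this
      exact this
    rw [siteDenInv]
    generalize hc : q ^ 2 • bigY q p k = c at *
    generalize (q ^ 2)⁻¹ • bigYInv q p k = ci at *
    exact ⟨Rden_mul_denInv q hc.symm e1 ε, denInv_mul_Rden q hc.symm e2 ε⟩
  obtain ⟨i1, i2⟩ := inv i
  obtain ⟨j1, j2⟩ := inv j
  refine commute_of_inverse (t := Rden q (uNum _ ε * PowerSeries.C (bigY q p i)) (uDen _ ε)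
    * Rden q (uNum _ ε * PowerSeries.C (bigY q p j)) (uDen _ ε)) ?_ ?_ ?_
  · rw [mul_assoc, ← mul_assoc _ (siteDenInv q p ε j), j1, one_mul, i1]
  · rw [mul_assoc, ← mul_assoc (siteDenInv q p ε i), i2, one_mul, j2]
  · have key : ∀ (W : Type) [Ring W] [Algebra ℂ W] (a b : W⟦X⟧) (_ : ∀ f, Commute a f)
        (_ : ∀ f, Commute b f) (y y' θ : W) (_ : Commute θ (y + y')) (_ : Commute θ (y * y')),
        Commute (PowerSeries.C θ) (Rden q (a * PowerSeries.C y) b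
          * Rden q (a * PowerSeries.C y') b) := by
      intro W _ _ a b ha hb y y' θ h1 h2
      have e : Rden q (a * PowerSeries.C y) b * Rden q (a * PowerSeries.C y') b
          = (q ^ 2 * q ^ 2) • (a * a * PowerSeries.C (y * y'))
            - q ^ 2 • (a * b * PowerSeries.C (y + y')) + b * b := by
        rw [Rden, Rden, sub_mul, mul_sub, mul_sub, smul_mul_smul_comm, central_mul_C ha,
          smul_mul_assoc, mul_smul_comm, mul_assoc a _ b, ← (hb (PowerSeries.C y)).eq,
          ← mul_assoc b, ← (ha b).eq, map_add, mul_add, smul_add, ← mul_assoc a b]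
        abel
      rw [e]
      have g1 : Commute (PowerSeries.C θ) (PowerSeries.C (y * y')) := h2.map PowerSeries.C
      have g2 : Commute (PowerSeries.C θ) (PowerSeries.C (y + y')) := h1.map PowerSeries.C
      exact (((((ha _).symm.mul_right (ha _).symm).mul_right g1).smul_right _).sub_right
        ((((ha _).symm.mul_right (hb _).symm).mul_right g2).smul_right _)).add_right
        ((hb _).symm.mul_right (hb _).symm)
    exact key _ _ _ (uNum_central _ ε) (uDen_central _ ε) _ _ _ c1 c2

end PhysicalSpace

/-! ### The modes preserve the physical space -/

section PhysicalModes

variable {N : ℕ}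

theorem siteL_mul_siteL_mem_intertwiners [NeZero N] {q p : ℂ} (hq : q ≠ 0) (hp : p ≠ 0)
    {i j : Fin N} (hij : (j : ℕ) = i + 1) (ε : Pt) :
    siteL q p ε j * siteL q p ε i ∈ intertwiners (heckeDiff q i j) := by
  have hi : (i : ℕ) + 1 < N := hij ▸ j.2
  have hne : i ≠ j := fun e => by rw [e] at hij; omega
  have eT : heckeT N q i = Tpol q i j := by
    rw [heckeT_of_lt q hi, show j = ⟨i + 1, hi⟩ from Fin.ext hij]
  have h1 : Tpol q i j * Y q p j * Tpol q i j = Y q p i := by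
    rw [Y_eq_natY, Y_eq_natY, hij, ← eT]; exact heckeT_mul_natY_mul hq hp hi
  have hcom : ∀ α β, Commute (siteDenInv q p ε i) (siteNum q (bigY q p j) ε j α β) := by
    intro α β
    obtain ⟨m1, m2⟩ := mem_yAlg (q := q) (p := p) i
    obtain ⟨n1, n2, n3⟩ := mem_siteAlg (q := q) (p := p) j
    have hyy : ∀ x ∈ yAlg q p i, x ∈ siteAlg q p i := fun x hx =>
      Algebra.adjoin_mono Set.subset_union_left hx
    exact commute_powerSeries fun m n => commute_siteAlg hq hp hne
      (hyy _ (siteDenInv_mem m1 m2 ε m)) (siteNum_mem n1 n3 ε α β n)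
  have e : siteL q p ε j * siteL q p ε i = (siteDenInv q p ε j * siteDenInv q p ε i) •
      (siteNum q (bigY q p j) ε j * siteNum q (bigY q p i) ε i) := by
    rw [siteL_eq hq hp, siteL_eq hq hp, Matrix.smul_mul, mul_smul_of_commute hcom, smul_smul]
  rw [e]
  refine ⟨(siteDenInv q p ε j * siteDenInv q p ε i) •
    (siteNum q (bigY q p i) ε j * siteNum q (bigY q p j) ε i), fun α β => ?_⟩
  have hD := (heckeDiff_mul_denInv hq hp hij ε).eq
  have hM := heckeDiff_mul_siteNum hq hne (commute_Y hq hp i j) h1 ε α β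
  rw [Matrix.smul_apply, Matrix.smul_apply, smul_eq_mul, smul_eq_mul, ← mul_assoc, hD]
  generalize siteDenInv q p ε j * siteDenInv q p ε i = D at *
  rw [mul_assoc D, mul_assoc D]
  exact congrArg (D * ·) hM

/-- Away from the sites `i`, `j` nothing interacts: the whole factor commutes with the difference of
the Hecke generators. -/
theorem siteL_mem_intertwiners [NeZero N] {q p : ℂ} (hq : q ≠ 0) (hp : p ≠ 0)
    {i j k : Fin N} (hij : (j : ℕ) = i + 1) (hik : i ≠ k) (hjk : j ≠ k) (ε : Pt) :
    siteL q p ε k ∈ intertwiners (heckeDiff q i j) := by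
  have hi : (i : ℕ) + 1 < N := hij ▸ j.2
  have eT : heckeT N q i = Tpol q i j := by
    rw [heckeT_of_lt q hi, show j = ⟨i + 1, hi⟩ from Fin.ext hij]
  have c0 : Commute (Tpol q i j) (Y q p k) := by
    rw [Y_eq_natY, ← eT]
    exact commute_heckeT_natY hq hp k.2 hi (fun e => hik (Fin.ext e))
      (fun e => hjk (Fin.ext (hij.trans e)))
  have c0' : Commute (Tpol q i j) (Ring.inverse (Y q p k)) :=
    commute_of_inverse (Ring.mul_inverse_cancel _ (isUnit_Y hq hp k))
      (Ring.inverse_mul_cancel _ (isUnit_Y hq hp k)) c0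
  have c1 : Commute (heckeDiff q i j) (bigY q p k) :=
    (commute_spinTwo_polActHom i j _ _).sub_left (c0.map _)
  have c2 : Commute (heckeDiff q i j) (bigYInv q p k) :=
    (commute_spinTwo_polActHom i j _ _).sub_left (c0'.map _)
  have c3 : ∀ s s', Commute (heckeDiff q i j) (siteUnit k s s') := fun s s' =>
    (commute_spinTwo_siteUnit hik hjk _ s s').sub_left
      (commute_siteUnit_polActHom k s s' _).symm
  have mem : ∀ {x : Module.End ℂ (BigSpace N)}, Commute (heckeDiff q i j) x →
      x ∈ Subalgebra.centralizer ℂ {heckeDiff q i j} := fun hx =>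
    (Subalgebra.mem_centralizer_iff ℂ).2 fun z hz => by rw [Set.mem_singleton_iff.1 hz]; exact hx
  exact ⟨siteL q p ε k, fun α β => (commute_C_of_mem_serIn
    (siteL_mem hq hp (mem c1) (mem c2) (fun s s' => mem (c3 s s')) ε α β)).eq⟩

theorem downProd_add {A : Type*} [Ring A] (T : ℕ → A) (a m n : ℕ) :
    downProd T a (m + n) = downProd T (a + m) n * downProd T a m := by
  induction n with
  | zero => simp [downProd_zero]
  | succ n ih => rw [← Nat.add_assoc, downProd_succ, ih, downProd_succ, mul_assoc, Nat.add_assoc]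

theorem downProd_mem {A : Type*} [Ring A] (S : Submonoid A) (L : ℕ → A) (a n : ℕ)
    (h : ∀ k, a ≤ k → k < a + n → L k ∈ S) : downProd L a n ∈ S := by
  induction n with
  | zero => rw [downProd_zero]; exact one_mem _
  | succ n ih =>
    rw [downProd_succ]
    exact mul_mem (h _ (by omega) (by omega)) (ih fun k h1 h2 => h k h1 (by omega))

/-- The two factors that are not separately in the submonoid stand next to each other in the ordered
product, so they can be grouped. -/
theorem downProd_mem_of_pair {A : Type*} [Ring A] (S : Submonoid A) (L : ℕ → A) {i n : ℕ}
    (hi : i + 1 < n) (hp : L (i + 1) * L i ∈ S) (h : ∀ k, k ≠ i → k ≠ i + 1 → L k ∈ S) :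
    downProd L 0 n ∈ S := by
  obtain ⟨l, rfl⟩ : ∃ l, n = i + (2 + l) := ⟨n - i - 2, by omega⟩
  rw [downProd_add, downProd_add]
  refine mul_mem (mul_mem (downProd_mem S _ _ _ fun k h1 h2 => h k (by omega) (by omega)) ?_)
    (downProd_mem S _ _ _ fun k h1 h2 => h k (by omega) (by omega))
  rw [downProd_succ, downProd_succ, downProd_zero, mul_one, zero_add, add_zero]
  exact hp

/-- The local factors, indexed by all natural numbers. -/
def natSiteL (N : ℕ) [NeZero N] (q p : ℂ) (ε : Pt) (k : ℕ) :
    Matrix (Fin 2) (Fin 2) (Module.End ℂ (BigSpace N))⟦X⟧ :=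
  if h : k < N then siteL q p ε ⟨k, h⟩ else 1

theorem natSiteL_coe [NeZero N] (q p : ℂ) (ε : Pt) (k : Fin N) :
    natSiteL N q p ε k = siteL q p ε k := by simp [natSiteL]

theorem seriesMatrix_mode_eq_downProd [NeZero N] (q p : ℂ) (ε : Pt) :
    seriesMatrix (mode (N := N) q p) ε = downProd (natSiteL N q p ε) 0 N := by
  have e1 : siteL q p ε = fun k : Fin N => natSiteL N q p ε k :=
    funext fun k => (natSiteL_coe q p ε k).symm
  rw [seriesMatrix_mode, downProd, List.map_reverse, e1, map_finRange_eq, List.map_reverse]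

theorem seriesMatrix_mode_mem_intertwiners [NeZero N] {q p : ℂ} (hq : q ≠ 0) (hp : p ≠ 0)
    {i j : Fin N} (hij : (j : ℕ) = i + 1) (ε : Pt) :
    seriesMatrix (mode (N := N) q p) ε ∈ intertwiners (heckeDiff q i j) := by
  rw [seriesMatrix_mode_eq_downProd]
  refine downProd_mem_of_pair _ _ (i := i) (hij ▸ j.2) ?_ fun k hki hkj => ?_
  · rw [← hij, natSiteL_coe, natSiteL_coe]
    exact siteL_mul_siteL_mem_intertwiners hq hp hij ε
  · by_cases hk : k < N
    · rw [natSiteL, dif_pos hk]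
      exact siteL_mem_intertwiners hq hp hij (fun e => hki (by rw [e]))
        (fun e => hkj (by rw [← hij, e])) ε
    · rw [natSiteL, dif_neg hk]; exact one_mem _

theorem mode_mem_physical [NeZero N] {q p : ℂ} (hq : q ≠ 0) (hp : p ≠ 0) (ε : Pt) (n : ℕ)
    (α β : Fin 2) {Ψ : BigSpace N} (hΨ : Ψ ∈ physical N q) :
    mode q p ε n α β Ψ ∈ physical N q := by
  refine mem_physical_of_intertwines (fun i j hij => ?_) hΨ
  obtain ⟨Z, hZ⟩ := seriesMatrix_mode_mem_intertwiners (q := q) (p := p) hq hp hij ε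
  refine ⟨PowerSeries.coeff n (Z α β), ?_⟩
  have := congrArg (PowerSeries.coeff n) (hZ α β)
  rw [PowerSeries.coeff_C_mul, PowerSeries.coeff_mul_C, seriesMatrix, Matrix.of_apply,
    PowerSeries.coeff_mk] at this
  exact this

end PhysicalModes

/-! ## Representations of the quantum-loop algebra -/

section LoopRepresentations

/-- A family of modes that satisfies the relations of the quantum-loop algebra. -/
structure IsLoopRep {W : Type*} [Ring W] [Algebra ℂ W] (q : ℂ)
    (ℓ : Pt → ℕ → Fin 2 → Fin 2 → W) : Prop where
  rll : SatisfiesRLL q ℓ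
  upper : ℓ Pt.zero 0 1 0 = 0
  lower : ℓ Pt.infty 0 0 1 = 0
  inv_right : ∀ α, ℓ Pt.zero 0 α α * ℓ Pt.infty 0 α α = 1
  inv_left : ∀ α, ℓ Pt.infty 0 α α * ℓ Pt.zero 0 α α = 1

variable {V W : Type*} [Ring V] [Algebra ℂ V] [Ring W] [Algebra ℂ W]

/-- Coefficientwise image of double series. -/
def mapUV (f : V →ₐ[ℂ] W) : V⟦X⟧⟦X⟧ →+* W⟦X⟧⟦X⟧ :=
  PowerSeries.map (PowerSeries.map f.toRingHom)

theorem coeff_mapUV (f : V →ₐ[ℂ] W) (F : V⟦X⟧⟦X⟧) (m n : ℕ) :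
    PowerSeries.coeff m (PowerSeries.coeff n (mapUV f F))
      = f (PowerSeries.coeff m (PowerSeries.coeff n F)) := by
  simp [mapUV]

theorem mapUV_injective {f : V →ₐ[ℂ] W} (hf : Function.Injective f) :
    Function.Injective (mapUV f) := by
  intro F G h
  ext n m
  apply hf
  rw [← coeff_mapUV, ← coeff_mapUV, h]

theorem map_RnumUV (f : V →ₐ[ℂ] W) (q : ℂ) (ε ε' : Pt) :
    (mapUV f).mapMatrix (RnumUV V q ε ε') = RnumUV W q ε ε' := by
  ext1 x y
  rw [RingHom.mapMatrix_apply, Matrix.map_apply, RnumUV, RnumUV, map_Rnum (mapUV f)]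
  · have h1 : ∀ ε, mapUV f (PowerSeries.C (uNum V ε)) = PowerSeries.C (uNum W ε) := by
      intro ε; rw [mapUV, PowerSeries.map_C, map_uNum]
    have h2 : ∀ ε, mapUV f (PowerSeries.C (uDen V ε)) = PowerSeries.C (uDen W ε) := by
      intro ε; rw [mapUV, PowerSeries.map_C, map_uDen]
    rw [map_mul, map_mul, h1, h2]
    congr 2
    · exact map_uDen _ ε'
    · exact map_uNum _ ε'
  · intro c a
    ext m n
    simp [mapUV]

theorem map_LaU (f : V →ₐ[ℂ] W) (ℓ : Pt → ℕ → Fin 2 → Fin 2 → V) (ε : Pt) :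
    (mapUV f).mapMatrix (LaU (seriesMatrix ℓ ε))
      = LaU (seriesMatrix (fun ε n α β => f (ℓ ε n α β)) ε) := by
  ext1 x y
  rw [RingHom.mapMatrix_apply, Matrix.map_apply, LaU, LaU, Matrix.kroneckerMap_apply,
    Matrix.kroneckerMap_apply, map_mul]
  congr 1
  · ext n m
    simp [mapUV, PowerSeries.coeff_C, seriesMatrix]
    split_ifs <;> simp
  · rw [Matrix.one_apply, Matrix.one_apply]; split_ifs <;> simp

theorem map_LbV (f : V →ₐ[ℂ] W) (ℓ : Pt → ℕ → Fin 2 → Fin 2 → V) (ε : Pt) :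
    (mapUV f).mapMatrix (LbV (seriesMatrix ℓ ε))
      = LbV (seriesMatrix (fun ε n α β => f (ℓ ε n α β)) ε) := by
  ext1 x y
  rw [RingHom.mapMatrix_apply, Matrix.map_apply, LbV, LbV, Matrix.kroneckerMap_apply,
    Matrix.kroneckerMap_apply, map_mul]
  congr 1
  · rw [Matrix.one_apply, Matrix.one_apply]; split_ifs <;> simp
  · ext n m
    simp [Matrix.map_apply, mapUV, PowerSeries.coeff_map, seriesMatrix]

theorem map_rllLeft (f : V →ₐ[ℂ] W) (q : ℂ) (ℓ : Pt → ℕ → Fin 2 → Fin 2 → V) (ε ε' : Pt) :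
    (mapUV f).mapMatrix (rllLeft q (seriesMatrix ℓ) ε ε')
      = rllLeft q (seriesMatrix fun ε n α β => f (ℓ ε n α β)) ε ε' := by
  rw [rllLeft, map_mul, map_mul, map_RnumUV, map_LaU, map_LbV, rllLeft]

theorem map_rllRight (f : V →ₐ[ℂ] W) (q : ℂ) (ℓ : Pt → ℕ → Fin 2 → Fin 2 → V) (ε ε' : Pt) :
    (mapUV f).mapMatrix (rllRight q (seriesMatrix ℓ) ε ε')
      = rllRight q (seriesMatrix fun ε n α β => f (ℓ ε n α β)) ε ε' := by
  rw [rllRight, map_mul, map_mul, map_RnumUV, map_LaU, map_LbV, rllRight]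

theorem IsLoopRep.map {q : ℂ} {ℓ : Pt → ℕ → Fin 2 → Fin 2 → V} (h : IsLoopRep q ℓ)
    (f : V →ₐ[ℂ] W) : IsLoopRep q fun ε n α β => f (ℓ ε n α β) where
  rll ε ε' := by rw [← map_rllLeft, ← map_rllRight, h.rll]
  upper := by rw [h.upper, map_zero]
  lower := by rw [h.lower, map_zero]
  inv_right α := by rw [← map_mul, h.inv_right, map_one]
  inv_left α := by rw [← map_mul, h.inv_left, map_one]

/-- The relations are identities between coefficients, so they can be tested after an injective
homomorphism. Together with `IsLoopRep.map` this moves representations along subspaces and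
quotients. -/
theorem IsLoopRep.of_map {q : ℂ} {ℓ : Pt → ℕ → Fin 2 → Fin 2 → V} {f : V →ₐ[ℂ] W}
    (hf : Function.Injective f) (h : IsLoopRep q fun ε n α β => f (ℓ ε n α β)) :
    IsLoopRep q ℓ where
  rll ε ε' := by
    have := h.rll ε ε'
    rw [← map_rllLeft, ← map_rllRight] at this
    ext1 x y
    exact mapUV_injective hf (congrFun (congrFun this x) y)
  upper := hf (by rw [h.upper, map_zero])
  lower := hf (by rw [h.lower, map_zero])
  inv_right α := hf (by rw [map_mul, h.inv_right, map_one])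
  inv_left α := hf (by rw [map_mul, h.inv_left, map_one])

theorem IsLoopRep.exists_hom {q : ℂ} {ℓ : Pt → ℕ → Fin 2 → Fin 2 → W} (h : IsLoopRep q ℓ) :
    ∃ φ : QuantumLoop q →ₐ[ℂ] W, ∀ ε n α β, φ (loopGen q ε n α β) = ℓ ε n α β := by
  let f : FreeAlgebra ℂ Gen →ₐ[ℂ] W := FreeAlgebra.lift ℂ fun g => ℓ g.1 g.2.1 g.2.2.1 g.2.2.2
  have hf : ∀ ε n α β, f (freeGen ε n α β) = ℓ ε n α β := fun ε n α β =>
    FreeAlgebra.lift_ι_apply _ _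
  have hf' : (fun ε n α β => f (freeGen ε n α β)) = ℓ := by
    funext ε n α β; exact hf ε n α β
  have hrel : ∀ ⦃x y⦄, LoopRel q x y → f x = f y := by
    intro x y hxy
    cases hxy with
    | rll ε ε' x y m n =>
      have h1 := congrFun (congrFun (map_rllLeft f q freeGen ε ε') x) y
      have h2 := congrFun (congrFun (map_rllRight f q freeGen ε ε') x) y
      rw [RingHom.mapMatrix_apply, Matrix.map_apply, hf'] at h1 h2
      rw [← coeff_mapUV, ← coeff_mapUV, h1, h2, h.rll]
    | upper => rw [hf, h.upper, map_zero]
    | lower => rw [hf, h.lower, map_zero]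
    | inv_right α => rw [map_mul, hf, hf, h.inv_right, map_one]
    | inv_left α => rw [map_mul, hf, hf, h.inv_left, map_one]
  refine ⟨RingQuot.liftAlgHom ℂ ⟨f, hrel⟩, fun ε n α β => ?_⟩
  rw [loopGen, RingQuot.liftAlgHom_mkAlgHom_apply, hf]

theorem loopHom_mem {q : ℂ} (φ : QuantumLoop q →ₐ[ℂ] W) {S : Subalgebra ℂ W}
    (h : ∀ ε n α β, φ (loopGen q ε n α β) ∈ S) (x : QuantumLoop q) : φ x ∈ S := by
  obtain ⟨y, rfl⟩ := RingQuot.mkAlgHom_surjective ℂ (LoopRel q) x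
  induction y using FreeAlgebra.induction with
  | grade0 r => rw [AlgHom.commutes, AlgHom.commutes]; exact S.algebraMap_mem r
  | grade1 g => exact h g.1 g.2.1 g.2.2.1 g.2.2.2
  | mul a b ha hb => rw [map_mul, map_mul]; exact S.mul_mem ha hb
  | add a b ha hb => rw [map_add, map_add]; exact S.add_mem ha hb

theorem commute_loopHom {q : ℂ} (φ : QuantumLoop q →ₐ[ℂ] W) {w : W}
    (h : ∀ ε n α β, Commute w (φ (loopGen q ε n α β))) (x : QuantumLoop q) :
    Commute w (φ x) := by
  have := loopHom_mem φ (S := Subalgebra.centralizer ℂ {w}) (fun ε n α β =>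
    (Subalgebra.mem_centralizer_iff ℂ).2 fun z hz => by
      rw [Set.mem_singleton_iff.1 hz]; exact h ε n α β) x
  exact (Subalgebra.mem_centralizer_iff ℂ).1 this w rfl

variable {E F : Type*} [AddCommGroup E] [Module ℂ E] [AddCommGroup F] [Module ℂ F]

/-- Pairs of operators intertwined by a linear map. -/
def intertwinedPairs (e : E →ₗ[ℂ] F) : Subalgebra ℂ (Module.End ℂ E × Module.End ℂ F) where
  carrier := {x | ∀ v, e (x.1 v) = x.2 (e v)}
  mul_mem' {x y} hx hy v := by
    rw [Prod.fst_mul, Prod.snd_mul, Module.End.mul_apply, Module.End.mul_apply, hx, hy]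
  add_mem' {x y} hx hy v := by
    rw [Prod.fst_add, Prod.snd_add, LinearMap.add_apply, LinearMap.add_apply, map_add, hx, hy]
  algebraMap_mem' c v := by
    simp [Prod.algebraMap_apply, Module.algebraMap_end_apply]

/-- Consider the pairs of operators intertwined by `e`. When `e` is onto, the first operator
determines the second, so the relations lift to the algebra of pairs and then project to `F`. -/
theorem IsLoopRep.of_surjective {q : ℂ} {e : E →ₗ[ℂ] F} (he : Function.Surjective e)
    {ℓ : Pt → ℕ → Fin 2 → Fin 2 → Module.End ℂ E} {ℓ' : Pt → ℕ → Fin 2 → Fin 2 → Module.End ℂ F}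
    (h : IsLoopRep q ℓ) (hℓ : ∀ ε n α β v, e (ℓ ε n α β v) = ℓ' ε n α β (e v)) :
    IsLoopRep q ℓ' := by
  let x : Pt → ℕ → Fin 2 → Fin 2 → intertwinedPairs e := fun ε n α β =>
    ⟨(ℓ ε n α β, ℓ' ε n α β), fun v => hℓ ε n α β v⟩
  let f₁ : intertwinedPairs e →ₐ[ℂ] Module.End ℂ E :=
    (AlgHom.fst ℂ _ _).comp (intertwinedPairs e).val
  let f₂ : intertwinedPairs e →ₐ[ℂ] Module.End ℂ F :=
    (AlgHom.snd ℂ _ _).comp (intertwinedPairs e).val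
  have hf : Function.Injective f₁ := by
    rintro ⟨a, ha⟩ ⟨b, hb⟩ hab
    have hab' : a.1 = b.1 := hab
    refine Subtype.ext (Prod.ext hab' (LinearMap.ext fun w => ?_))
    obtain ⟨v, rfl⟩ := he w
    rw [← ha, ← hb, hab']
  exact (IsLoopRep.of_map (ℓ := x) hf h).map f₂

/-- Dually, for injective `e` the second operator of an intertwined pair determines the first. -/
theorem IsLoopRep.of_injective {q : ℂ} {e : E →ₗ[ℂ] F} (he : Function.Injective e)
    {ℓ : Pt → ℕ → Fin 2 → Fin 2 → Module.End ℂ E} {ℓ' : Pt → ℕ → Fin 2 → Fin 2 → Module.End ℂ F}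
    (h : IsLoopRep q ℓ') (hℓ : ∀ ε n α β v, e (ℓ ε n α β v) = ℓ' ε n α β (e v)) :
    IsLoopRep q ℓ := by
  let x : Pt → ℕ → Fin 2 → Fin 2 → intertwinedPairs e := fun ε n α β =>
    ⟨(ℓ ε n α β, ℓ' ε n α β), fun v => hℓ ε n α β v⟩
  let f₁ : intertwinedPairs e →ₐ[ℂ] Module.End ℂ E :=
    (AlgHom.fst ℂ _ _).comp (intertwinedPairs e).val
  let f₂ : intertwinedPairs e →ₐ[ℂ] Module.End ℂ F :=
    (AlgHom.snd ℂ _ _).comp (intertwinedPairs e).val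
  have hf : Function.Injective f₂ := by
    rintro ⟨a, ha⟩ ⟨b, hb⟩ hab
    have hab' : a.2 = b.2 := hab
    refine Subtype.ext (Prod.ext (LinearMap.ext fun v => he ?_) hab')
    rw [ha, hb, hab']
  exact (IsLoopRep.of_map (ℓ := x) hf h).map f₁

end LoopRepresentations

/-! ### Leading coefficients of the modes -/

section Triangularity

variable {N : ℕ}

theorem list_prod_triangular {A ι : Type*} [Ring A] {a b : Fin 2} (hab : a ≠ b)
    (M : ι → Matrix (Fin 2) (Fin 2) A) (h : ∀ i, M i a b = 0) (l : List ι) :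
    (l.map M).prod a b = 0 ∧ ∀ α, (l.map M).prod α α = (l.map fun i => M i α α).prod := by
  induction l with
  | nil => simp [Matrix.one_apply_ne hab]
  | cons i l ih =>
    obtain ⟨h1, h2⟩ := ih
    simp only [List.map_cons, List.prod_cons]
    constructor
    · rw [Matrix.mul_apply, Fin.sum_univ_two]
      fin_cases a <;> fin_cases b <;> simp_all
    · intro α
      rw [Matrix.mul_apply, Fin.sum_univ_two, ← h2]
      fin_cases a <;> fin_cases b <;> fin_cases α <;> simp_all

theorem siteMat_diag_list_apply (z : Fin 2 → ℂ) (l : List (Fin N)) (Ψ : BigSpace N)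
    (σ : Config N) :
    (l.map fun i => siteMat i fun s s' => if s = s' then z s else 0).prod Ψ σ
      = (l.map fun i => z (σ i)).prod • Ψ σ := by
  induction l with
  | nil => simp
  | cons i l ih =>
    rw [List.map_cons, List.prod_cons, Module.End.mul_apply, siteMat, List.map_cons,
      List.prod_cons, mul_smul, ← ih]
    generalize (l.map fun i => siteMat i fun s s' => if s = s' then z s else 0).prod Ψ = Φ
    simp only [LinearMap.sum_apply, Finset.sum_apply, LinearMap.smul_apply, Pi.smul_apply,
      siteUnit_apply, ite_smul, zero_smul, Finset.sum_ite_eq, Finset.mem_univ, if_true]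
    rw [Finset.sum_eq_single (σ i)]
    · simp
    · intro s _ hs; simp [Ne.symm hs]
    · simp

theorem siteMat_neg (i : Fin N) (m : Fin 2 → Fin 2 → ℂ) :
    siteMat i (fun s s' => -m s s') = -siteMat i m := by
  refine eq_neg_of_add_eq_zero_left ?_
  simp only [siteMat, ← Finset.sum_add_distrib, ← add_smul, neg_add_cancel, zero_smul,
    Finset.sum_const_zero]

theorem coeff_zero_denInv_zero_mul {A : Type*} [Ring A] (c ci : A) (f : A⟦X⟧) :
    PowerSeries.coeff 0 (denInv c ci Pt.zero * f) = -PowerSeries.coeff 0 f := by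
  rw [denInv, neg_mul, map_neg, PowerSeries.coeff_mul]
  simp

variable [NeZero N] {q p : ℂ} (hq : q ≠ 0) (hp : p ≠ 0)
include hq hp

/-- At `u = 0` the operator `Y_i` drops out: only the part of the numerator without `u` survives,
and the denominator contributes the sign. -/
theorem coeff_zero_siteL_zero (i : Fin N) (α β : Fin 2) :
    PowerSeries.coeff 0 (siteL q p Pt.zero i α β)
      = siteMat i fun s s' => -Rnum q 0 1 (α, s) (β, s') := by
  rw [siteL_eq hq hp, Matrix.smul_apply, smul_eq_mul,
    siteNum_eq q (fun s s' => (commute_siteUnit_bigY i i s s').symm), siteDenInv]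
  rw [coeff_zero_denInv_zero_mul, siteMat_neg]
  simp only [uNum, uDen, one_mul, map_add, PowerSeries.coeff_zero_X_mul, zero_add,
    PowerSeries.coeff_zero_C]

/-- At `u = ∞` the operator `Y_i` of the numerator is cancelled by the one in the denominator,
leaving a constant spin matrix. -/
theorem coeff_zero_siteL_infty (i : Fin N) (α β : Fin 2) :
    PowerSeries.coeff 0 (siteL q p Pt.infty i α β)
      = siteMat i fun s s' => (q ^ 2)⁻¹ * Rnum q 1 0 (α, s) (β, s') := by
  have h : bigYInv q p i * bigY q p i = 1 := by
    rw [bigYInv, bigY, ← map_mul, Ring.inverse_mul_cancel _ (isUnit_Y hq hp i), map_one]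
  rw [siteL_eq hq hp, Matrix.smul_apply, smul_eq_mul,
    siteNum_eq q (fun s s' => (commute_siteUnit_bigY i i s s').symm), siteDenInv]
  have e : ∀ m, (q ^ 2)⁻¹ • bigYInv q p i * (bigY q p i * m) = (q ^ 2)⁻¹ • m := by
    intro m
    rw [smul_mul_assoc, ← mul_assoc, h, one_mul]
  simp [denInv, uNum, uDen, PowerSeries.coeff_zero_eq_constantCoeff, e, -Algebra.smul_mul_assoc]
  simp only [siteMat, Finset.smul_sum, smul_smul]

omit hq hp in
theorem coeff_zero_mode (ε : Pt) {a b : Fin 2} (hab : a ≠ b)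
    (h : ∀ i : Fin N, PowerSeries.coeff 0 (siteL q p ε i a b) = 0) :
    mode (N := N) q p ε 0 a b = 0 ∧ ∀ α, mode (N := N) q p ε 0 α α
      = ((List.finRange N).reverse.map fun i => PowerSeries.coeff 0 (siteL q p ε i α α)).prod := by
  have e : (seriesMatrix (mode (N := N) q p) ε).map (PowerSeries.coeff 0)
      = ((List.finRange N).reverse.map fun i =>
        (siteL q p ε i).map (PowerSeries.coeff 0)).prod := by
    rw [seriesMatrix_mode]
    have := map_list_prod (PowerSeries.constantCoeff
      (R := Module.End ℂ (BigSpace N))).mapMatrix ((List.finRange N).reverse.map (siteL q p ε))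
    rw [List.map_map] at this
    simp only [PowerSeries.coeff_zero_eq_constantCoeff]
    exact this
  have hm : ∀ α β, mode q p ε 0 α β
      = ((seriesMatrix (mode (N := N) q p) ε).map (PowerSeries.coeff 0)) α β := by
    intro α β
    simp [seriesMatrix]
  obtain ⟨h1, h2⟩ := list_prod_triangular hab
    (fun i => (siteL q p ε i).map (PowerSeries.coeff 0)) h (List.finRange N).reverse
  exact ⟨by rw [hm, e, h1], fun α => by rw [hm, e, h2]; rfl⟩

/-- Each local leading coefficient is triangular, with diagonal entries that act diagonally on
spins: by `1` or `q` at the origin and by `1` or `q⁻¹` at infinity. The products over the sites are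
therefore mutually inverse. -/
theorem isLoopRep_mode : IsLoopRep q (mode (N := N) q p) := by
  have z := coeff_zero_mode (N := N) (q := q) (p := p) Pt.zero (a := 1) (b := 0) (by decide) fun i => by
    rw [coeff_zero_siteL_zero hq hp, siteMat]
    simp [Rnum, RcheckNum, Fin.sum_univ_two]
  have w := coeff_zero_mode (N := N) (q := q) (p := p) Pt.infty (a := 0) (b := 1) (by decide) fun i => by
    rw [coeff_zero_siteL_infty hq hp, siteMat]
    simp [Rnum, RcheckNum, Fin.sum_univ_two]
  have dz : ∀ α (i : Fin N), PowerSeries.coeff 0 (siteL q p Pt.zero i α α)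
      = siteMat i fun s s' => if s = s' then (if s = α then 1 else q) else 0 := by
    intro α i
    rw [coeff_zero_siteL_zero hq hp]
    congr 1
    funext s s'
    fin_cases α <;> fin_cases s <;> fin_cases s' <;> simp [Rnum, RcheckNum, Rden]
  have dw : ∀ α (i : Fin N), PowerSeries.coeff 0 (siteL q p Pt.infty i α α)
      = siteMat i fun s s' => if s = s' then (if s = α then 1 else q⁻¹) else 0 := by
    intro α i
    rw [coeff_zero_siteL_infty hq hp]
    congr 1
    funext s s'
    fin_cases α <;> fin_cases s <;> fin_cases s' <;> simp [Rnum, RcheckNum, Rden] <;> field_simp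
  have key : ∀ (u v : Fin 2 → ℂ) (_ : ∀ s, u s * v s = 1) (l : List (Fin N)),
      (l.map fun i => siteMat i fun s s' => if s = s' then u s else 0).prod
        * (l.map fun i => siteMat i fun s s' => if s = s' then v s else 0).prod = 1 := by
    intro u v huv l
    refine LinearMap.ext fun Ψ => funext fun σ => ?_
    rw [Module.End.mul_apply, siteMat_diag_list_apply, siteMat_diag_list_apply, smul_smul,
      ← List.prod_map_mul]
    simp [huv]
  refine ⟨satisfiesRLL_mode hq hp, z.1, w.1, fun α => ?_, fun α => ?_⟩ <;>
    rw [z.2, w.2] <;> simp only [dz, dw] <;> refine key _ _ (fun s => ?_) _ <;>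
    split_ifs <;> simp [hq]

end Triangularity

/-! ## The monodromy matrix in terms of Hecke generators -/

section HeckeForm

variable {m : ℕ} {A : Type*} [Ring A]

/-- The permutation of tensor factors given by a permutation of their labels. -/
def permMat (A : Type*) [Ring A] (g : Equiv.Perm (Fin m)) : Matrix (Config m) (Config m) A :=
  Matrix.of fun σ τ => if σ ∘ g = τ then 1 else 0

theorem permMat_mul (g : Equiv.Perm (Fin m)) (X : Matrix (Config m) (Config m) A) :
    permMat A g * X = X.submatrix (fun σ => σ ∘ g) id := by
  ext σ τ
  simp [permMat, Matrix.mul_apply]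

theorem mul_permMat (g : Equiv.Perm (Fin m)) (X : Matrix (Config m) (Config m) A) :
    X * permMat A g = X.submatrix id (fun σ => σ ∘ g.symm) := by
  ext σ τ
  have : ∀ ρ : Config m, ρ ∘ g = τ ↔ ρ = τ ∘ g.symm := fun ρ =>
    (Equiv.eq_comp_symm g ρ τ).symm
  simp [permMat, Matrix.mul_apply, this]

theorem permMat_one : permMat A (1 : Equiv.Perm (Fin m)) = 1 := by
  ext σ τ
  simp [permMat, Matrix.one_apply]

/-- The matrix on the left is `P` times `M`. The permutation `P` is absorbed into the permutation of
labels, and `M` then acts in the relabelled factors. -/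
theorem twoSite_mul_permMat (i j : Fin m)
    (M : Matrix (Fin 2 × Fin 2) (Fin 2 × Fin 2) A) (g : Equiv.Perm (Fin m)) :
    twoSite i j (Matrix.of fun x y => M x.swap y) * permMat A g
      = permMat A (Equiv.swap i j * g) * twoSite (g.symm i) (g.symm j) M := by
  rw [permMat_mul, mul_permMat]
  ext σ τ
  simp only [Matrix.submatrix_apply, id, twoSite, Matrix.of_apply, Function.comp_apply,
    Equiv.Perm.mul_apply, Equiv.apply_symm_apply, Equiv.swap_apply_left, Equiv.swap_apply_right,
    Prod.swap_prod_mk]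
  refine if_congr ⟨fun h k hk hk' => ?_, fun h k hk hk' => ?_⟩ rfl rfl
  · have h1 : g k ≠ i := fun e => hk (by rw [← e, Equiv.symm_apply_apply])
    have h2 : g k ≠ j := fun e => hk' (by rw [← e, Equiv.symm_apply_apply])
    rw [Equiv.swap_apply_of_ne_of_ne h1 h2, h _ h1 h2, Equiv.symm_apply_apply]
  · have := h (g.symm k) (fun e => hk (g.symm.injective e)) (fun e => hk' (g.symm.injective e))
    rwa [Equiv.apply_symm_apply, Equiv.swap_apply_of_ne_of_ne hk hk'] at this

/-- The cyclic permutation of the first `k + 1` labels. -/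
def partialCycle (N : ℕ) : ℕ → Equiv.Perm (Fin (N + 1))
  | 0 => 1
  | k + 1 => Equiv.swap 0 (Fin.ofNat (N + 1) (k + 1)) * partialCycle N k

theorem partialCycle_apply {N k : ℕ} (hk : k ≤ N) (j : Fin (N + 1)) :
    (partialCycle N k j : ℕ) = if (j : ℕ) < k then (j : ℕ) + 1 else if (j : ℕ) = k then 0 else j := by
  induction k with
  | zero =>
    simp only [partialCycle, Equiv.Perm.one_apply, Nat.not_lt_zero, if_false]
    split_ifs with h <;> simp [h]
  | succ k ih =>
    specialize ih (by omega)
    have hv : ((Fin.ofNat (N + 1) (k + 1) : Fin (N + 1)) : ℕ) = k + 1 := by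
      simp [Fin.ofNat, Nat.mod_eq_of_lt (by omega : k + 1 < N + 1)]
    rw [partialCycle, Equiv.Perm.mul_apply, Equiv.swap_apply_def]
    simp only [Fin.ext_iff, hv, ih, Fin.val_zero]
    split_ifs <;> simp_all <;> omega

theorem permMat_partialCycle (N : ℕ) : permMat A (partialCycle N N) = cyclicPerm := by
  ext σ τ
  rw [permMat, cyclicPerm, Matrix.of_apply, Matrix.of_apply]
  have : ∀ k, partialCycle N N k = k + 1 := by
    intro k
    apply Fin.ext
    rw [partialCycle_apply le_rfl, Fin.val_add_one]
    have := k.2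
    simp only [Fin.ext_iff, Fin.val_last]
    split_ifs <;> omega
  refine if_congr ?_ rfl rfl
  rw [funext_iff]
  simp [this]

/-- Baxterisation: the braid-form `R`-matrix is a combination of the Hecke generator and its
inverse, linear in the spectral parameter. -/
theorem RcheckNum_eq [Algebra ℂ A] {q : ℂ} (hq : q ≠ 0) (a b : A) :
    RcheckNum q a b = q • Matrix.of fun x x' => Tsp q x x' • a - TspInv q x x' • b := by
  ext ⟨x1, x2⟩ ⟨y1, y2⟩
  have e : q * (q - q⁻¹) = q ^ 2 - 1 := by field_simp
  fin_cases x1 <;> fin_cases x2 <;> fin_cases y1 <;> fin_cases y2 <;>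
    simp [RcheckNum, Tsp, TspInv, Rden, smul_sub, smul_smul, hq, e, pow_two, ← neg_smul, -neg_mul]

theorem twoSite_smul [Algebra ℂ A] (i j : Fin m) (c : ℂ)
    (M : Matrix (Fin 2 × Fin 2) (Fin 2 × Fin 2) A) : twoSite i j (c • M) = c • twoSite i j M := by
  ext σ τ
  rw [Matrix.smul_apply, twoSite, twoSite, Matrix.of_apply, Matrix.of_apply]
  split_ifs <;> simp

theorem prod_twoSite_Rnum [Algebra ℂ A] {N : ℕ} {q : ℂ} (hq : q ≠ 0) (y : Fin N → A) (a b : A) :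
    ((List.finRange N).reverse.map fun i => twoSite 0 i.succ (Rnum q (a * y i) b)).prod
      = q ^ N • heckeForm q y a b := by
  classical
  let F : ℕ → Matrix (Config (N + 1)) (Config (N + 1)) A := fun i =>
    if h : i < N then twoSite 0 (Fin.succ ⟨i, h⟩) (Rnum q (a * y ⟨i, h⟩) b) else 1
  let G : ℕ → Matrix (Config (N + 1)) (Config (N + 1)) A := fun i =>
    if h : i < N then twoSite (Fin.castSucc ⟨i, h⟩) (Fin.succ ⟨i, h⟩)
      (Matrix.of fun x x' => Tsp q x x' • (a * y ⟨i, h⟩) - TspInv q x x' • b) else 1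
  have eF : ((List.finRange N).reverse.map fun i => twoSite 0 i.succ (Rnum q (a * y i) b))
      = (List.range' 0 N).reverse.map F := by
    rw [List.map_reverse, List.map_reverse, ← map_finRange_eq]; simp [F]; intro i; rfl
  have eG : ((List.finRange N).reverse.map fun i => twoSite i.castSucc i.succ
      (Matrix.of fun x x' => Tsp q x x' • (a * y i) - TspInv q x x' • b))
      = (List.range' 0 N).reverse.map G := by
    rw [List.map_reverse, List.map_reverse, ← map_finRange_eq]; simp [G]; intro i; rfl
  rw [heckeForm, eF, eG, ← permMat_partialCycle]
  -- All permutations are collected on the left. After `k` steps the auxiliary label sits at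
  -- position `k`, so the next factor acts in the neighbouring positions `k`, `k + 1`.
  have key : ∀ k ≤ N, downProd F 0 k = q ^ k • (permMat A (partialCycle N k) * downProd G 0 k) := by
    intro k hk
    induction k with
    | zero => simp [downProd_zero, partialCycle, permMat_one]
    | succ k ih =>
      have hk' : k < N := hk
      have hv : (Fin.ofNat (N + 1) (k + 1) : Fin (N + 1)) = Fin.succ ⟨k, hk'⟩ := by
        apply Fin.ext
        simp [Fin.ofNat, Nat.mod_eq_of_lt (by omega : k + 1 < N + 1)]
      have s0 : (partialCycle N k).symm 0 = Fin.castSucc ⟨k, hk'⟩ := by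
        rw [Equiv.symm_apply_eq]
        apply Fin.ext
        rw [partialCycle_apply hk'.le]; simp
      have s1 : (partialCycle N k).symm (Fin.succ ⟨k, hk'⟩) = Fin.succ ⟨k, hk'⟩ := by
        rw [Equiv.symm_apply_eq]
        apply Fin.ext
        rw [partialCycle_apply hk'.le]; simp
      have step : F k * permMat A (partialCycle N k)
          = q • (permMat A (partialCycle N (k + 1)) * G k) := by
        simp only [F, G, dif_pos hk']
        rw [← Matrix.mul_smul, ← twoSite_smul, ← RcheckNum_eq hq, partialCycle, hv]
        have := twoSite_mul_permMat 0 (Fin.succ ⟨k, hk'⟩)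
          (RcheckNum q (a * y ⟨k, hk'⟩) b) (partialCycle N k)
        rw [s0, s1] at this
        exact this
      rw [downProd_succ, downProd_succ, ih (by omega), zero_add, Matrix.mul_smul, ← mul_assoc,
        step, smul_mul_assoc, smul_smul, mul_assoc, pow_succ]
  exact key N le_rfl

theorem list_prod_smul_prod {R ι n : Type*} [Ring R] [Algebra ℂ R] [Fintype n] [DecidableEq n] (d e : ι → R)
    (M : ι → Matrix n n R) (l : List ι) (hde : ∀ i, e i * d i = -1)
    (hM : ∀ i j x y, Commute (e i) (M j x y)) :
    (l.reverse.map e).prod • (l.map fun i => d i • M i).prod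
      = (-1 : ℂ) ^ l.length • (l.map M).prod := by
  induction l with
  | nil => simp
  | cons i l ih =>
    -- The scalars come in reversed order so that the last of them meets the first `d i`; each such
    -- cancellation leaves a sign.
    have hc : ∀ x y, Commute ((l.reverse.map e).prod) (M i x y) := by
      intro x y
      refine (Commute.list_prod_right _ _ fun z hz => ?_).symm
      obtain ⟨j, _, rfl⟩ := List.mem_map.1 hz
      exact (hM j i x y).symm
    rw [List.reverse_cons, List.map_append, List.prod_append, List.map_cons, List.map_cons,
      List.prod_cons, List.map_cons, List.prod_cons, List.map_nil, List.prod_cons,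
      List.prod_nil, mul_one, Matrix.smul_mul, smul_smul, mul_assoc, hde, mul_neg, mul_one,
      neg_smul, List.length_cons, pow_succ, ← mul_smul_of_commute hc, ih, mul_smul_comm]
    simp

theorem heckeForm_Ltilde {N : ℕ} [NeZero N] {q p : ℂ} (hq : q ≠ 0) (hp : p ≠ 0) (ε : Pt) :
    ((List.finRange N).map fun i : Fin N => uDen _ ε - q ^ 2 • (uNum _ ε * Yser q p i)).prod •
        Ltilde (N := N) q p ε
      = (-q) ^ N • heckeForm q (Yser q p) (uNum _ ε) (uDen _ ε) := by
  have hy : ∀ i j : Fin N, Commute (uDen (Module.End ℂ (Pol N)) ε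
      - q ^ 2 • (uNum _ ε * Yser q p i)) (uNum _ ε * Yser q p j) := by
    intro i j
    have h1 : Commute (uNum _ ε * Yser q p i) (uNum _ ε * Yser q p j) :=
      ((uNum_central _ ε _).mul_left ((uNum_central _ ε _).symm.mul_right
        ((commute_Y hq hp i j).map PowerSeries.C)))
    exact (uDen_central _ ε _).sub_left (h1.smul_left _)
  have h := list_prod_smul_prod
    (fun i : Fin N => Ring.inverse (Rden q (uNum _ ε * Yser q p i) (uDen _ ε)))
    (fun i : Fin N => uDen _ ε - q ^ 2 • (uNum _ ε * Yser q p i))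
    (fun i : Fin N => twoSite 0 i.succ (Rnum q (uNum _ ε * Yser q p i) (uDen _ ε)))
    (List.finRange N).reverse (fun i => by
      refine eq_neg_of_add_eq_zero_left ?_
      rw [← Ring.mul_inverse_cancel _ (isUnit_Rden hq hp ε i), ← add_mul]
      simp only [Rden, sub_add_sub_cancel', sub_self, zero_mul]) ?_
  · rw [List.reverse_reverse] at h
    have e : Ltilde (N := N) q p ε = ((List.finRange N).reverse.map fun i =>
        Ring.inverse (Rden q (uNum _ ε * Yser q p i) (uDen _ ε)) •
          twoSite 0 i.succ (Rnum q (uNum _ ε * Yser q p i) (uDen _ ε))).prod := by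
      rw [Ltilde, monodromy]
      congr 1
      refine List.map_congr_left fun i _ => ?_
      ext1 σ τ
      rw [Matrix.smul_apply, twoSite, twoSite, Matrix.of_apply, Matrix.of_apply]
      split_ifs
      · rfl
      · simp
    rw [e, h, prod_twoSite_Rnum hq, List.length_reverse, List.length_finRange, neg_pow q, mul_smul]
  · intro i j σ τ
    rw [twoSite, Matrix.of_apply]
    split_ifs
    · have := Rnum_mem (S := Subalgebra.centralizer ℂ {uDen (Module.End ℂ (Pol N)) ε
        - q ^ 2 • (uNum _ ε * Yser q p i)}) q (a := uNum _ ε * Yser q p j) (b := uDen _ ε)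
        ((Subalgebra.mem_centralizer_iff ℂ).2 fun z hz => by
          rw [Set.mem_singleton_iff.1 hz]; exact hy i j)
        ((Subalgebra.mem_centralizer_iff ℂ).2 fun z _ => (uDen_central _ ε z).symm.eq)
        (σ 0, σ j.succ) (τ 0, τ j.succ)
      exact (Subalgebra.mem_centralizer_iff ℂ).1 this _ rfl
    · exact Commute.zero_right _

end HeckeForm

/-! ## Evaluation on orbits of points -/

section Evaluation

variable {N : ℕ}

open MvPolynomial

/-- Evaluation of the polynomial variables at a point. -/
def evalAt (z : Fin N → ℂ) : BigSpace N →ₗ[ℂ] SpinSpace N :=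
  LinearMap.pi fun σ => (MvPolynomial.aeval z).toLinearMap ∘ₗ LinearMap.proj σ

theorem evalAt_apply (z : Fin N → ℂ) (Ψ : BigSpace N) (σ : Config N) :
    evalAt z Ψ σ = eval z (Ψ σ) := by
  simp [evalAt]

theorem ev_eq_evalAt : ev N = evalAt (evPoint N) := rfl

theorem evalAt_spinTwo (z : Fin N → ℂ) {i j : Fin N} (hij : i ≠ j)
    (M : Matrix (Fin 2 × Fin 2) (Fin 2 × Fin 2) ℂ) (Ψ : BigSpace N) :
    evalAt z (spinTwo i j M Ψ) = Matrix.toLin' (twoSite i j M) (evalAt z Ψ) := by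
  rw [← spinAct_twoSite hij]
  funext σ
  rw [evalAt_apply, spinAct, act_apply, Matrix.toLin'_apply, Matrix.mulVec, dotProduct, map_sum]
  refine Finset.sum_congr rfl fun τ _ => ?_
  rw [Matrix.map_apply, Module.algebraMap_end_apply, smul_eval, evalAt_apply]

theorem evalAt_Tpol (q : ℂ) {z : Fin N → ℂ} {i j : Fin N} (h : z i ≠ z j) (Ψ : BigSpace N) :
    evalAt z (polActHom (Tpol q i j) Ψ) = (q - braidCoef q (z i) (z j)) • evalAt z Ψ
      + braidCoef q (z i) (z j) • evalAt (z ∘ Equiv.swap i j) Ψ := by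
  funext σ
  rw [evalAt_apply, polActHom_apply, eval_Tpol q h, Pi.add_apply, Pi.smul_apply, Pi.smul_apply,
    evalAt_apply, evalAt_apply, smul_eq_mul, smul_eq_mul]

/-- Points at which the braid coefficients are finite and nonzero. -/
structure IsAdmissible (q : ℂ) (z : Fin N → ℂ) : Prop where
  inj : Function.Injective z
  ne : ∀ i j, q ^ 2 * z i ≠ z j
  ne_zero : ∀ j, z j ≠ 0

theorem IsAdmissible.comp {q : ℂ} {z : Fin N → ℂ} (h : IsAdmissible q z)
    (g : Equiv.Perm (Fin N)) : IsAdmissible q (z ∘ g) :=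
  ⟨h.inj.comp g.injective, fun _ _ => h.ne _ _, fun _ => h.ne_zero _⟩

theorem IsAdmissible.apply_ne {q : ℂ} {z : Fin N → ℂ} (h : IsAdmissible q z) {i j : Fin N}
    (hij : i ≠ j) : z i ≠ z j := fun e => hij (h.inj e)

theorem IsAdmissible.braidCoef_ne_zero {q : ℂ} (hq : q ≠ 0) {z : Fin N → ℂ}
    (h : IsAdmissible q z) {i j : Fin N} (hij : i ≠ j) : braidCoef q (z i) (z j) ≠ 0 :=
  div_ne_zero (mul_ne_zero (inv_ne_zero hq) (sub_ne_zero.2 (h.ne i j)))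
    (sub_ne_zero.2 (h.apply_ne hij))

/-- This matches the `R`-matrix with the coefficients in the evaluated action of `T^pol`, the ratio
`x / y` being the spectral parameter. -/
theorem Rcheck_eq {q : ℂ} (hq : q ≠ 0) {x y : ℂ} (hy : y ≠ 0) (hxy : x ≠ y)
    (ht : q ^ 2 * x ≠ y) : Rcheck q (x / y)
      = (braidCoef q x y)⁻¹ • (Tsp q - (q - braidCoef q x y) • 1) := by
  have h1 : x - y ≠ 0 := sub_ne_zero.2 hxy
  have h2 : q ^ 2 * x - y ≠ 0 := sub_ne_zero.2 ht
  have h3 : q ^ 2 * (x / y) - 1 ≠ 0 := by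
    rw [mul_div_assoc', div_sub_one hy]; exact div_ne_zero h2 hy
  ext ⟨x1, x2⟩ ⟨y1, y2⟩
  fin_cases x1 <;> fin_cases x2 <;> fin_cases y1 <;> fin_cases y2 <;>
    simp [Rcheck, RcheckNum, Tsp, Rden, braidCoef] <;> field_simp <;> ring

theorem twoSite_sub {m : ℕ} (i j : Fin m) (M M' : Matrix (Fin 2 × Fin 2) (Fin 2 × Fin 2) ℂ) :
    twoSite i j (M - M') = twoSite i j M - twoSite i j M' := by
  ext σ τ
  rw [Matrix.sub_apply, twoSite, twoSite, twoSite, Matrix.of_apply, Matrix.of_apply,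
    Matrix.of_apply]
  split_ifs <;> simp

theorem twoSite_one {m : ℕ} (i j : Fin m) :
    twoSite i j (1 : Matrix (Fin 2 × Fin 2) (Fin 2 × Fin 2) ℂ) = 1 := by
  ext σ τ
  rw [twoSite, Matrix.of_apply, Matrix.one_apply, Matrix.one_apply, ← ite_and]
  refine if_congr ?_ rfl rfl
  constructor
  · rintro ⟨h1, h2⟩
    funext k
    by_cases hi : k = i
    · rw [hi]; exact congrArg Prod.fst h2
    · by_cases hj : k = j
      · rw [hj]; exact congrArg Prod.snd h2
      · exact h1 k hi hj
  · rintro rfl; simp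

/-- Evaluating the physical condition at `z` gives `T^sp Ψ(z) = (q - b) Ψ(z) + b Ψ(z ∘ s)`, with `b`
the braid coefficient; solving for the last value produces the `R`-matrix. -/
theorem evalAt_comp_swap {q : ℂ} (hq : q ≠ 0) {Ψ : BigSpace N} (hΨ : Ψ ∈ physical N q)
    {z : Fin N → ℂ} (hz : IsAdmissible q z) {i j : Fin N} (hij : (j : ℕ) = i + 1) :
    evalAt (z ∘ Equiv.swap i j) Ψ
      = Matrix.toLin' (twoSite i j (Rcheck q (z i / z j))) (evalAt z Ψ) := by
  have hne : i ≠ j := fun e => by rw [e] at hij; omega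
  have h := congrArg (evalAt z) (mem_physical.1 hΨ i j hij)
  rw [heckeDiff, LinearMap.sub_apply, map_sub, map_zero, evalAt_spinTwo z hne,
    evalAt_Tpol q (hz.apply_ne hne), sub_eq_zero] at h
  have hb := hz.braidCoef_ne_zero hq hne
  rw [Rcheck_eq hq (hz.ne_zero j) (hz.apply_ne hne) (hz.ne i j), twoSite_smul, twoSite_sub,
    twoSite_smul, twoSite_one, map_smul, map_sub, map_smul, Matrix.toLin'_one,
    LinearMap.smul_apply, LinearMap.sub_apply, h, LinearMap.smul_apply, LinearMap.id_apply,
    add_sub_cancel_left, smul_smul, inv_mul_cancel₀ hb, one_smul]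

theorem perm_induction_adjacent {P : Equiv.Perm (Fin N) → Prop} (h1 : P 1)
    (h : ∀ g i j, ((j : Fin N) : ℕ) = (i : Fin N) + 1 → P g → P (g * Equiv.swap i j))
    (g : Equiv.Perm (Fin N)) : P g := by
  rcases N with _ | n
  · rwa [Subsingleton.elim g 1]
  have hg : g ∈ Submonoid.closure
      (Set.range fun i : Fin n => Equiv.swap i.castSucc i.succ) := by
    rw [Equiv.Perm.mclosure_swap_castSucc_succ]; trivial
  refine Submonoid.closure_induction_right (motive := fun g _ => P g) h1 ?_ hg
  rintro g _ _ ⟨i, rfl⟩ hP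
  exact h g _ _ (by simp) hP

/-- Adjacent transpositions generate, and every point of the orbit is again admissible, so the
vanishing spreads step by step. -/
theorem evalAt_comp_perm_eq_zero {q : ℂ} (hq : q ≠ 0) {Ψ : BigSpace N} (hΨ : Ψ ∈ physical N q)
    {z : Fin N → ℂ} (hz : IsAdmissible q z) (h0 : evalAt z Ψ = 0) (g : Equiv.Perm (Fin N)) :
    evalAt (z ∘ g) Ψ = 0 := by
  induction g using perm_induction_adjacent with
  | h1 => exact h0
  | h g i j hij hP =>
    have := evalAt_comp_swap hq hΨ (hz.comp g) hij
    rw [hP, map_zero] at this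
    exact this

/-- The polynomials that vanish on the orbit of a point. -/
def orbitIdeal (z : Fin N → ℂ) : Ideal (Pol N) :=
  ⨅ g : Equiv.Perm (Fin N), RingHom.ker (eval (z ∘ g))

theorem mem_orbitIdeal {z : Fin N → ℂ} {F : Pol N} :
    F ∈ orbitIdeal z ↔ ∀ g : Equiv.Perm (Fin N), eval (z ∘ g) F = 0 := by
  simp [orbitIdeal, RingHom.mem_ker]

/-- The operators that preserve the orbit ideal in both directions. -/
def orbitStab (z : Fin N → ℂ) : Submonoid (Module.End ℂ (Pol N)) where
  carrier := {O | ∀ F, O F ∈ orbitIdeal z ↔ F ∈ orbitIdeal z}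
  one_mem' _ := Iff.rfl
  mul_mem' hO hO' F := (hO _).trans (hO' F)

theorem Tpol_apply_mem_orbitIdeal (q : ℂ) {z : Fin N → ℂ} (hz : Function.Injective z)
    {i j : Fin N} (hij : i ≠ j) {F : Pol N} (hF : F ∈ orbitIdeal z) :
    Tpol q i j F ∈ orbitIdeal z := by
  rw [mem_orbitIdeal] at hF ⊢
  intro g
  have h : (z ∘ g) i ≠ (z ∘ g) j := fun e => hij (g.injective (hz e))
  rw [eval_Tpol q h, hF, Function.comp_assoc, ← Equiv.Perm.coe_mul, hF]
  simp

theorem TpolInv_apply_mem_orbitIdeal (q : ℂ) {z : Fin N → ℂ} (hz : Function.Injective z)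
    {i j : Fin N} (hij : i ≠ j) {F : Pol N} (hF : F ∈ orbitIdeal z) :
    TpolInv q i j F ∈ orbitIdeal z := by
  rw [TpolInv, LinearMap.sub_apply, LinearMap.smul_apply, Module.End.one_apply, smul_eq_C_mul]
  exact Ideal.sub_mem _ (Tpol_apply_mem_orbitIdeal q hz hij hF) (Ideal.mul_mem_left _ _ hF)

theorem Tpol_mem_orbitStab {q : ℂ} (hq : q ≠ 0) {z : Fin N → ℂ} (hz : Function.Injective z)
    {i j : Fin N} (hij : i ≠ j) : Tpol q i j ∈ orbitStab z := fun F => by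
  refine ⟨fun h => ?_, Tpol_apply_mem_orbitIdeal q hz hij⟩
  have := TpolInv_apply_mem_orbitIdeal q hz hij h
  rwa [← Module.End.mul_apply, TpolInv_mul_Tpol hq hij] at this

theorem TpolInv_mem_orbitStab {q : ℂ} (hq : q ≠ 0) {z : Fin N → ℂ} (hz : Function.Injective z)
    {i j : Fin N} (hij : i ≠ j) : TpolInv q i j ∈ orbitStab z := fun F => by
  refine ⟨fun h => ?_, TpolInv_apply_mem_orbitIdeal q hz hij⟩
  have := Tpol_apply_mem_orbitIdeal q hz hij h
  rwa [← Module.End.mul_apply, Tpol_mul_TpolInv hq hij] at this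

theorem heckeT_mem_orbitStab {q : ℂ} (hq : q ≠ 0) {z : Fin N → ℂ} (hz : Function.Injective z)
    (i : ℕ) : heckeT N q i ∈ orbitStab z := by
  rw [heckeT]
  split_ifs
  · exact Tpol_mem_orbitStab hq hz (by simp)
  · exact one_mem _

variable [NeZero N]

theorem shiftPoint_one (z : Fin N → ℂ) : shiftPoint 1 z = z ∘ Equiv.subRight 1 := by
  funext j; simp [shiftPoint]

theorem piOp_one_mem_orbitStab (z : Fin N → ℂ) : piOp 1 ∈ orbitStab z := fun F => by
  rw [mem_orbitIdeal, mem_orbitIdeal]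
  simp only [eval_piOp, shiftPoint_one, Function.comp_assoc, ← Equiv.coe_trans]
  -- At `p = 1` the shift of a point is a permutation of its coordinates, so it maps the orbit to
  -- itself.
  refine ⟨fun h g => ?_, fun h g => h _⟩
  have := h ((Equiv.subRight 1).symm.trans g)
  rwa [← Equiv.trans_assoc, Equiv.self_trans_symm, Equiv.refl_trans] at this

theorem upProd_mem {A : Type*} [Ring A] (S : Submonoid A) {L : ℕ → A} (h : ∀ k, L k ∈ S)
    (a n : ℕ) : upProd L a n ∈ S :=
  list_prod_mem fun x hx => by
    obtain ⟨k, _, rfl⟩ := List.mem_map.1 hx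
    exact h k

theorem natY_one_mem_orbitStab {q : ℂ} (hq : q ≠ 0) {z : Fin N → ℂ} (hz : Function.Injective z)
    (i : ℕ) : natY N q 1 i ∈ orbitStab z := by
  refine mul_mem (mul_mem (upProd_mem _ (heckeT_mem_orbitStab hq hz) _ _)
    (piOp_one_mem_orbitStab z)) (upProd_mem _ (fun k => ?_) _ _)
  rw [heckeTInv]
  split_ifs
  · exact TpolInv_mem_orbitStab hq hz (by simp)
  · exact one_mem _

/-- The modes also contain `Y_i⁻¹`. This is why preservation of the ideal in both directions was
recorded in `orbitStab`. -/
theorem mode_one_apply_mem_orbitIdeal {q : ℂ} (hq : q ≠ 0) {z : Fin N → ℂ}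
    (hz : Function.Injective z) (ε : Pt) (n : ℕ) (α β : Fin 2) {Ψ : BigSpace N}
    (hΨ : ∀ σ, Ψ σ ∈ orbitIdeal z) (σ : Config N) : mode q 1 ε n α β Ψ σ ∈ orbitIdeal z := by
  let S : Subalgebra ℂ (Module.End ℂ (BigSpace N)) :=
    { carrier := {O | ∀ Ψ : BigSpace N, (∀ σ, Ψ σ ∈ orbitIdeal z) → ∀ σ, O Ψ σ ∈ orbitIdeal z}
      mul_mem' := fun ha hb Ψ hΨ => ha _ (hb Ψ hΨ)
      add_mem' := fun ha hb Ψ hΨ σ => Ideal.add_mem _ (ha Ψ hΨ σ) (hb Ψ hΨ σ)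
      algebraMap_mem' := fun c Ψ hΨ σ => by
        rw [Module.algebraMap_end_apply, Pi.smul_apply, smul_eq_C_mul]
        exact Ideal.mul_mem_left _ _ (hΨ σ) }
  have hY : ∀ i : Fin N, Y q 1 i ∈ orbitStab z := fun i => by
    rw [Y_eq_natY]; exact natY_one_mem_orbitStab hq hz i
  have : mode q 1 ε n α β ∈ S := by
    refine mode_mem hq one_ne_zero (fun i Ψ hΨ σ => ?_) (fun i Ψ hΨ σ => ?_)
      (fun i s s' Ψ hΨ σ => ?_) ε n α β
    · exact (hY i _).2 (hΨ σ)
    · refine (hY i _).1 ?_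
      rw [bigYInv, polActHom_apply, ← Module.End.mul_apply,
        Ring.mul_inverse_cancel _ (isUnit_Y hq one_ne_zero i)]
      exact hΨ σ
    · rw [siteUnit_apply]
      split_ifs
      · exact hΨ _
      · exact Ideal.zero_mem _
  exact this Ψ hΨ σ

theorem evPoint_pow (j : Fin N) : evPoint N j ^ N = 1 := by
  rw [evPoint, ← pow_mul, mul_comm ((j : ℕ) + 1), pow_mul,
    (Complex.isPrimitiveRoot_exp N (NeZero.ne N)).pow_eq_one, one_pow]

theorem evPoint_injective : Function.Injective (evPoint N) := by
  intro i j h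
  have hp := Complex.isPrimitiveRoot_exp N (NeZero.ne N)
  rw [evPoint, evPoint, pow_succ, pow_succ] at h
  have := hp.pow_inj i.2 j.2 (mul_right_cancel₀ (hp.ne_zero (NeZero.ne N)) h)
  exact Fin.ext this

/-- The coordinates are `N`-th roots of unity, so a resonance between two of them would force `q ^
(2 * N) = 1`. -/
theorem isAdmissible_evPoint {q : ℂ} (hN : q ^ (2 * N) ≠ 1) :
    IsAdmissible q (evPoint N) where
  inj := evPoint_injective
  ne i j h := hN (by
    have := congrArg (· ^ N) h
    simp only [mul_pow, evPoint_pow, mul_one] at this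
    rw [pow_mul, this])
  ne_zero j h := by
    have := evPoint_pow j
    rw [h, zero_pow (NeZero.ne N)] at this
    exact zero_ne_one this

/-- Vanishing at one point means vanishing on the orbit for physical vectors, and that property is
stable under the modes at `p = 1`. This is what makes the operators on the spin chain well defined.
-/
theorem ev_mode_eq_zero {q : ℂ} (hq : q ≠ 0) (hN : q ^ (2 * N) ≠ 1) {Ψ : BigSpace N}
    (hΨ : Ψ ∈ physical N q) (h0 : ev N Ψ = 0) (ε : Pt) (n : ℕ) (α β : Fin 2) :
    ev N (mode q 1 ε n α β Ψ) = 0 := by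
  have h : ∀ σ, Ψ σ ∈ orbitIdeal (evPoint N) := fun σ => mem_orbitIdeal.2 fun g => by
    rw [← evalAt_apply, evalAt_comp_perm_eq_zero hq hΨ (isAdmissible_evPoint hN) h0 g]; rfl
  funext σ
  rw [ev_eq_evalAt, evalAt_apply]
  exact mem_orbitIdeal.1 (mode_one_apply_mem_orbitIdeal hq evPoint_injective ε n α β h σ) 1

end Evaluation

/-! ## Evaluation is surjective on the physical space -/

section Symmetrizer

variable {A : Type*} [Ring A]

/-- The sum of the products of the `x i` over reduced words in the symmetric group of
`k + 1` letters. -/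
def symmetrizer (x : ℕ → A) : ℕ → A
  | 0 => 1
  | k + 1 => (∑ j ∈ Finset.range (k + 2), upProd x j (k + 1 - j)) * symmetrizer x k

theorem commute_symmetrizer {x : ℕ → A} {y : A} {k : ℕ} (h : ∀ i < k, Commute y (x i)) :
    Commute y (symmetrizer x k) := by
  induction k with
  | zero => exact Commute.one_right y
  | succ k ih =>
    refine Commute.mul_right (Commute.sum_right _ _ _ fun j hj => commute_upProd fun i h1 h2 =>
      h i ?_) (ih fun i hi => h i (by omega))
    have := Finset.mem_range.1 hj
    omega

theorem upProd_mul_of_commute {S P : ℕ → A} (h : ∀ i j, Commute (S i) (P j)) (a n : ℕ) :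
    upProd (fun i => S i * P i) a n = upProd S a n * upProd P a n := by
  induction n with
  | zero => simp [upProd_zero]
  | succ n ih =>
    have : Commute (S (a + n)) (upProd P a n) := commute_upProd fun k _ _ => h _ _
    rw [upProd_succ, upProd_succ, upProd_succ, ih]
    simp only [mul_assoc]
    rw [← mul_assoc (upProd P a n), ← this.eq, mul_assoc]

theorem sub_mul_symmetrizer [Algebra ℂ A] {κ : ℂ} {n : ℕ} {S P : ℕ → A} (hS : BraidRel n S)
    (hP : BraidRel n P) (hSP : ∀ i j, Commute (S i) (P j))
    (hS2 : ∀ i < n, S i * S i = κ • S i + 1) (hP2 : ∀ i < n, P i * P i = κ • P i + 1)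
    {k : ℕ} (hk : k ≤ n) {i : ℕ} (hi : i < k) :
    (S i - P i) * symmetrizer (fun i => S i * P i) k = 0 := by
  induction k generalizing i with
  | zero => omega
  | succ k ih =>
    rw [symmetrizer, ← mul_assoc, Finset.mul_sum, Finset.sum_mul]
    rw [Finset.sum_eq_add i (i + 1) (by omega) ?_ (fun h => absurd (Finset.mem_range.2 (by omega)) h)
      (fun h => absurd (Finset.mem_range.2 (by omega)) h)]
    · have e : upProd (fun i => S i * P i) i (k + 1 - i)
          = S i * P i * upProd (fun i => S i * P i) (i + 1) (k + 1 - (i + 1)) := by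
        rw [show k + 1 - i = (k + 1 - (i + 1)) + 1 by omega, upProd_succ_left]
      -- The key cancellation: since `S` and `P` obey the same quadratic relation, `S - P`
      -- annihilates `S P + 1`. It pairs the coset terms `j = i` and `j = i + 1`.
      have h0 : (S i - P i) * (S i * P i) + (S i - P i) = 0 := by
        have h1 : P i * (S i * P i) = S i * (P i * P i) := by
          rw [← mul_assoc, ← (hSP i i).eq, mul_assoc]
        rw [sub_mul, ← mul_assoc, hS2 i (by omega), h1, hP2 i (by omega), add_mul, mul_add,
          smul_mul_assoc, mul_smul_comm]
        simp
      rw [e, ← add_mul, ← mul_assoc (S i - P i), ← add_mul, h0, zero_mul, zero_mul]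
    · intro j hj hne
      have hj' := Finset.mem_range.1 hj
      rcases lt_or_gt_of_ne hne.1 with h | h
      · obtain ⟨l, rfl⟩ : ∃ l, i = l + 1 := ⟨i - 1, by omega⟩
        -- For a longer coset word the difference passes through with its index lowered by one, and
        -- then meets the smaller symmetriser.
        have e : (S (l + 1) - P (l + 1)) * upProd (fun i => S i * P i) j (k + 1 - j)
            = upProd (fun i => S i * P i) j (k + 1 - j) * (S l - P l) := by
          have c1 : Commute (S l) (upProd P j (k + 1 - j)) := commute_upProd fun m _ _ => hSP _ _
          have c2 : Commute (P (l + 1)) (upProd S j (k + 1 - j)) :=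
            commute_upProd fun m _ _ => (hSP _ _).symm
          rw [upProd_mul_of_commute hSP, sub_mul, mul_sub, ← mul_assoc,
            ← hS.upProd_mul (by omega) (by omega) (by omega), mul_assoc, c1.eq, ← mul_assoc (P _),
            c2.eq, mul_assoc _ (P _), ← hP.upProd_mul (by omega) (by omega) (by omega)]
          simp only [mul_assoc]
        rw [e, mul_assoc, ih (by omega) (by omega), mul_zero]
      -- For a shorter coset word the difference is far from all letters, so it passes unchanged to
      -- the smaller symmetriser.
      · have c : Commute (S i - P i) (upProd (fun i => S i * P i) j (k + 1 - j)) :=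
          commute_upProd fun m h1 h2 => by
            have a1 := hS.far i m (by omega) (by omega)
            have a2 := hP.far i m (by omega) (by omega)
            exact (a1.mul_right (hSP _ _)).sub_left ((hSP _ _).symm.mul_right a2)
        rw [c.eq, mul_assoc, ih (by omega) (by omega), mul_zero]

end Symmetrizer

/-! ### Hecke relations for spins and the symmetriser onto physical vectors -/

section SpinBraid

variable {N : ℕ}

/-- Freezing the spins away from the three sites leaves an identity on eight components, checked
entry by entry. -/
theorem spinTwo_braid {q : ℂ} (hq : q ≠ 0) {i j k : Fin N} (hij : i ≠ j) (hjk : j ≠ k) (hik : i ≠ k) :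
    spinTwo i j (Tsp q) * spinTwo j k (Tsp q) * spinTwo i j (Tsp q)
      = spinTwo j k (Tsp q) * spinTwo i j (Tsp q) * spinTwo j k (Tsp q) := by
  refine LinearMap.ext fun Ψ => funext fun σ => ?_
  let up : Fin 2 → Fin 2 → Fin 2 → Config N := fun a b c =>
    Function.update (Function.update (Function.update σ i a) j b) k c
  have hσ : σ = up (σ i) (σ j) (σ k) := by simp [up]
  have h1 : ∀ (Φ : BigSpace N) a b c, spinTwo i j (Tsp q) Φ (up a b c)
      = ∑ y, Tsp q (a, b) y • Φ (up y.1 y.2 c) := by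
    intro Φ a b c
    rw [spinTwo_apply hij]
    refine Finset.sum_congr rfl fun y _ => ?_
    have e1 : up a b c i = a := by simp [up, hij, hik]
    have e2 : up a b c j = b := by simp [up, hjk]
    rw [e1, e2]
    congr 2
    funext m
    by_cases hi : m = i
    · subst hi; simp [up, hij, hik]
    · by_cases hj : m = j
      · subst hj; simp [up, hjk]
      · by_cases hk : m = k
        · subst hk; simp [up, hi, hj]
        · simp [up, hi, hj, hk]
  have h2 : ∀ (Φ : BigSpace N) a b c, spinTwo j k (Tsp q) Φ (up a b c)
      = ∑ y, Tsp q (b, c) y • Φ (up a y.1 y.2) := by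
    intro Φ a b c
    rw [spinTwo_apply hjk]
    refine Finset.sum_congr rfl fun y _ => ?_
    have e1 : up a b c k = c := by simp [up]
    have e2 : up a b c j = b := by simp [up, hjk]
    rw [e1, e2]
    congr 2
    funext m
    by_cases hi : m = i
    · subst hi; simp [up, hij, hik]
    · by_cases hj : m = j
      · subst hj; simp [up, hjk]
      · by_cases hk : m = k
        · subst hk; simp [up]
        · simp [up, hi, hj, hk]
  rw [hσ]
  generalize σ i = a
  generalize σ j = b
  generalize σ k = c
  clear_value up
  simp only [Module.End.mul_apply, h1, h2, Fintype.sum_prod_type, Fin.sum_univ_two]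
  fin_cases a <;> fin_cases b <;> fin_cases c <;> simp [Tsp] <;> match_scalars <;>
    field_simp <;> ring

/-- The spin Hecke generators on the big space with a natural index. -/
def spinT (N : ℕ) (q : ℂ) (i : ℕ) : Module.End ℂ (BigSpace N) :=
  if h : i + 1 < N then spinTwo ⟨i, (Nat.lt_succ_self i).trans h⟩ ⟨i + 1, h⟩ (Tsp q) else 1

theorem spinT_of_lt (q : ℂ) {i : ℕ} (h : i + 1 < N) :
    spinT N q i = spinTwo ⟨i, (Nat.lt_succ_self i).trans h⟩ ⟨i + 1, h⟩ (Tsp q) := dif_pos h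

theorem braidRel_spinT {q : ℂ} (hq : q ≠ 0) : BraidRel (N - 1) (spinT N q) where
  braid i hi := by
    rw [spinT_of_lt q (by omega : i + 1 < N), spinT_of_lt q (by omega : i + 1 + 1 < N)]
    exact spinTwo_braid hq (by simp) (by simp) (by simp [Fin.ext_iff]; omega)
  far i j hij hj := by
    rw [spinT_of_lt q (by omega : i + 1 < N), spinT_of_lt q (by omega : j + 1 < N)]
    refine commute_spinTwo ?_ ?_ ?_ ?_ _ _ <;> simp [Fin.ext_iff] <;> omega

theorem spinTwo_Tsp_mul_self {q : ℂ} (hq : q ≠ 0) {i j : Fin N} (hij : i ≠ j) :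
    spinTwo i j (Tsp q) * spinTwo i j (Tsp q) = (q - q⁻¹) • spinTwo i j (Tsp q) + 1 := by
  rw [← spinTwo_mul hij, Tsp_mul_self hq, spinTwo_add, spinTwo_smul, spinTwo_one hij]

/-- The product of the spin and polynomial Hecke generators. -/
def pairT (N : ℕ) (q : ℂ) (i : ℕ) : Module.End ℂ (BigSpace N) :=
  spinT N q i * polActHom (heckeT N q i)

theorem commute_spinT_polActHom (q : ℂ) (i : ℕ) (O : Module.End ℂ (Pol N)) :
    Commute (spinT N q i) (polActHom O) := by
  rw [spinT]
  split_ifs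
  · exact commute_spinTwo_polActHom _ _ _ _
  · exact Commute.one_left _

theorem symmetrizer_mem_physical [NeZero N] {q : ℂ} (hq : q ≠ 0) (Φ : BigSpace N) :
    symmetrizer (pairT N q) (N - 1) Φ ∈ physical N q := by
  rw [mem_physical]
  intro i j hij
  have hi : (i : ℕ) + 1 < N := hij ▸ j.2
  have hB := braidRel_heckeT (N := N) hq
  have h := sub_mul_symmetrizer (κ := q - q⁻¹) (braidRel_spinT (N := N) hq)
    (P := fun i => polActHom (heckeT N q i))
    ⟨fun i hi => by simpa using congrArg polActHom (hB.braid i hi),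
      fun i j h1 h2 => (hB.far i j h1 h2).map polActHom⟩
    (fun _ _ => commute_spinT_polActHom q _ _)
    (fun i hi => by
      rw [spinT_of_lt q (by omega : i + 1 < N)]
      exact spinTwo_Tsp_mul_self hq (by simp))
    (fun i hi => by
      rw [← map_mul, heckeT_mul_self hq (by omega), map_add, map_smul, map_one])
    le_rfl (i := i) (by omega)
  have e : heckeDiff q i j = spinT N q i - polActHom (heckeT N q i) := by
    rw [heckeDiff, spinT_of_lt q hi, heckeT_of_lt q hi, show j = ⟨i + 1, hi⟩ from Fin.ext hij]
  rw [e, ← Module.End.mul_apply]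
  exact DFunLike.congr_fun h Φ

end SpinBraid

/-! ### Physical vectors with a prescribed value -/

section EvaluationSurjective

variable {N : ℕ}

open MvPolynomial

/-- A spin vector as a vector of constant polynomials. -/
def constVec (v : SpinSpace N) : BigSpace N := fun σ => C (v σ)

theorem evalAt_constVec (z : Fin N → ℂ) (v : SpinSpace N) : evalAt z (constVec v) = v := by
  funext σ; rw [evalAt_apply, constVec, eval_C]

theorem toLin'_twoSite_Tsp_surjective {q : ℂ} (hq : q ≠ 0) {i j : Fin N} (hij : i ≠ j) :
    Function.Surjective (Matrix.toLin' (twoSite i j (Tsp q))) := by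
  intro v
  refine ⟨evalAt 0 ((spinTwo i j (Tsp q) - (q - q⁻¹) • 1) (constVec v)), ?_⟩
  rw [← evalAt_spinTwo _ hij, ← Module.End.mul_apply, mul_sub, spinTwo_Tsp_mul_self hq hij]
  simp [evalAt_constVec]

variable [NeZero N]

theorem evalAt_pairT {q : ℂ} {z : Fin N → ℂ} (hz : IsAdmissible q z) {i : ℕ} (hi : i + 1 < N)
    (Ψ : BigSpace N) :
    evalAt z (pairT N q i Ψ) = Matrix.toLin'
      (twoSite ⟨i, (Nat.lt_succ_self i).trans hi⟩ ⟨i + 1, hi⟩ (Tsp q))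
      ((q - braidCoef q (z ⟨i, (Nat.lt_succ_self i).trans hi⟩) (z ⟨i + 1, hi⟩)) • evalAt z Ψ
        + braidCoef q (z ⟨i, (Nat.lt_succ_self i).trans hi⟩) (z ⟨i + 1, hi⟩) •
          evalAt (z ∘ Equiv.swap ⟨i, (Nat.lt_succ_self i).trans hi⟩ ⟨i + 1, hi⟩) Ψ) := by
  have hne : (⟨i, (Nat.lt_succ_self i).trans hi⟩ : Fin N) ≠ ⟨i + 1, hi⟩ := by simp
  rw [pairT, Module.End.mul_apply, spinT_of_lt q hi, heckeT_of_lt q hi, evalAt_spinTwo z hne,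
    evalAt_Tpol q (hz.apply_ne hne)]

/-- Expanding the word gives a combination of values of `Ψ` at the points `z ∘ g`, where `g` uses
only transpositions of positions in `j, …, k`; so `g k` never drops below `j`. -/
theorem evalAt_upProd_pairT_eq_zero {q : ℂ} {k : Fin N} {d j : ℕ} (hjd : j + d = k)
    {z : Fin N → ℂ} (hz : IsAdmissible q z) {Ψ : BigSpace N}
    (h : ∀ g : Equiv.Perm (Fin N), j ≤ g k → evalAt (z ∘ g) Ψ = 0) :
    evalAt z (upProd (pairT N q) j d Ψ) = 0 := by
  induction d generalizing j z with
  | zero =>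
    rw [upProd_zero]
    exact h 1 (by simp; omega)
  | succ d ih =>
    have hj : j + 1 < N := by have := k.2; omega
    have h1 := ih (by omega : j + 1 + d = k) hz fun g hg => h g (by omega)
    set a : Fin N := ⟨j, (Nat.lt_succ_self j).trans hj⟩ with ha
    set b : Fin N := ⟨j + 1, hj⟩ with hb
    have h2 := ih (by omega : j + 1 + d = k) (hz.comp (Equiv.swap a b)) fun g hg => by
      have h3 : j ≤ ((Equiv.swap a b * g) k : ℕ) := by
        rw [Equiv.Perm.mul_apply, Equiv.swap_apply_def]
        split_ifs
        · simp [hb]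
        · simp [ha]
        · omega
      have := h (Equiv.swap a b * g) h3
      rwa [Equiv.Perm.coe_mul, ← Function.comp_assoc] at this
    rw [upProd_succ_left, Module.End.mul_apply, evalAt_pairT hz hj, h1, h2]
    simp

/-- Among the points reached by the word, exactly one has `g k = j`: the one where every letter
contributes its transposition. Its coefficient is a product of invertible matrices `T^sp` and
nonzero braid coefficients. -/
theorem evalAt_upProd_pairT {q : ℂ} (hq : q ≠ 0) {k : Fin N} {d j : ℕ} (hjd : j + d = k)
    {z : Fin N → ℂ} (hz : IsAdmissible q z) :
    ∃ (c : Equiv.Perm (Fin N)) (M : Module.End ℂ (SpinSpace N)), (c k : ℕ) = j ∧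
      Function.Surjective M ∧ ∀ Ψ : BigSpace N,
        (∀ g : Equiv.Perm (Fin N), j < g k → evalAt (z ∘ g) Ψ = 0) →
          evalAt z (upProd (pairT N q) j d Ψ) = M (evalAt (z ∘ c) Ψ) := by
  induction d generalizing j z with
  | zero =>
    refine ⟨1, 1, by simp; omega, Function.surjective_id, fun Ψ _ => ?_⟩
    rw [upProd_zero]; rfl
  | succ d ih =>
    have hj : j + 1 < N := by have := k.2; omega
    set a : Fin N := ⟨j, (Nat.lt_succ_self j).trans hj⟩ with ha
    set b : Fin N := ⟨j + 1, hj⟩ with hb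
    have hab : a ≠ b := by simp [ha, hb]
    obtain ⟨c, M, hc, hM, hcM⟩ := ih (j := j + 1) (by omega) (hz.comp (Equiv.swap a b))
    have hcb : c k = b := Fin.ext hc
    refine ⟨Equiv.swap a b * c, Matrix.toLin' (twoSite a b (Tsp q)) *
      braidCoef q (z a) (z b) • M, ?_, ?_, fun Ψ hΨ => ?_⟩
    · rw [Equiv.Perm.mul_apply, hcb, Equiv.swap_apply_right]
    · refine (toLin'_twoSite_Tsp_surjective hq hab).comp fun v => ?_
      obtain ⟨w, hw⟩ := hM ((braidCoef q (z a) (z b))⁻¹ • v)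
      refine ⟨w, ?_⟩
      rw [LinearMap.smul_apply, hw, smul_smul, mul_inv_cancel₀ (hz.braidCoef_ne_zero hq hab),
        one_smul]
    · have e1 := evalAt_upProd_pairT_eq_zero (by omega : j + 1 + d = k) hz (Ψ := Ψ)
        fun g hg => hΨ g (by omega)
      have e2 := hcM Ψ fun g hg => hΨ (Equiv.swap a b * g) (by
        have h1 : g k ≠ a := fun e => by rw [e] at hg; simp [ha] at hg
        have h2 : g k ≠ b := fun e => by rw [e] at hg; simp [hb] at hg
        rw [Equiv.Perm.mul_apply, Equiv.swap_apply_of_ne_of_ne h1 h2]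
        omega)
      rw [upProd_succ_left, Module.End.mul_apply, evalAt_pairT hz hj, e1, e2]
      simp [Function.comp_assoc, ha, hb]

omit [NeZero N] in
theorem evalAt_mulLeft (z : Fin N → ℂ) (f : Pol N) (Ψ : BigSpace N) :
    evalAt z (polActHom (LinearMap.mulLeft ℂ f) Ψ) = eval z f • evalAt z Ψ := by
  funext σ
  rw [evalAt_apply, polActHom_apply, LinearMap.mulLeft_apply, map_mul, Pi.smul_apply,
    evalAt_apply, smul_eq_mul]

theorem exists_evalAt_symmetrizer {q : ℂ} (hq : q ≠ 0) {k : ℕ} (hk : k < N) {z : Fin N → ℂ}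
    (hz : IsAdmissible q z) (v : SpinSpace N) :
    ∃ Φ, evalAt z (symmetrizer (pairT N q) k Φ) = v := by
  induction k generalizing z v with
  | zero => exact ⟨constVec v, evalAt_constVec z v⟩
  | succ k ih =>
    let K : Fin N := ⟨k + 1, hk⟩
    let o : Fin N := ⟨0, by omega⟩
    obtain ⟨c, M, hc, hM, hcM⟩ := evalAt_upProd_pairT hq (k := K) (d := k + 1) (j := 0)
      (by simp [K]) hz
    have hco : c K = o := Fin.ext hc
    -- At `z ∘ g` this polynomial vanishes unless `g` sends the last letter `K` to the first
    -- position. It involves only the variable `z_K`, so it commutes with the smaller symmetriser.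
    let f : Pol N := ∏ m ∈ Finset.univ.erase o, (X K - C (z m))
    have hf0 : ∀ g : Equiv.Perm (Fin N), 0 < (g K : ℕ) → eval (z ∘ g) f = 0 := by
      intro g hg
      rw [map_prod]
      refine Finset.prod_eq_zero (i := g K) (Finset.mem_erase.2 ⟨fun e => ?_, Finset.mem_univ _⟩) ?_
      · rw [e] at hg; exact absurd hg (by simp [o])
      · simp
    have hf1 : eval (z ∘ c) f ≠ 0 := by
      rw [map_prod]
      refine Finset.prod_ne_zero_iff.2 fun m hm => ?_
      rw [map_sub, eval_X, eval_C, Function.comp_apply, hco]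
      exact sub_ne_zero.2 (hz.apply_ne (Finset.ne_of_mem_erase hm).symm)
    obtain ⟨w, hw⟩ := hM v
    obtain ⟨Φ, hΦ⟩ := ih (by omega) (hz.comp c) ((eval (z ∘ c) f)⁻¹ • w)
    have hcomm : Commute (polActHom (LinearMap.mulLeft ℂ f)) (symmetrizer (pairT N q) k) := by
      refine commute_symmetrizer fun i hi => (commute_spinT_polActHom q i _).symm.mul_right ?_
      refine Commute.map ?_ polActHom
      have hi' : i + 1 < N := by omega
      rw [heckeT_of_lt q hi']
      refine (Tpol_mul_mulLeft q (by simp) ?_).symm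
      have hX : swapVars ⟨i, (Nat.lt_succ_self i).trans hi'⟩ ⟨i + 1, hi'⟩ (X K : Pol N) = X K := by
        rw [swapVars, rename_X, Equiv.swap_apply_of_ne_of_ne] <;> simp [K, Fin.ext_iff] <;> omega
      rw [map_prod]
      refine Finset.prod_congr rfl fun m _ => ?_
      rw [map_sub, hX]
      simp [swapVars]
    refine ⟨polActHom (LinearMap.mulLeft ℂ f) Φ, ?_⟩
    rw [symmetrizer, Module.End.mul_apply, ← Module.End.mul_apply (symmetrizer _ _), ← hcomm.eq,
      Module.End.mul_apply]
    have hv : ∀ g : Equiv.Perm (Fin N), 0 < (g K : ℕ) → evalAt (z ∘ g)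
        (polActHom (LinearMap.mulLeft ℂ f) (symmetrizer (pairT N q) k Φ)) = 0 := by
      intro g hg
      rw [evalAt_mulLeft, hf0 g hg, zero_smul]
    -- Only the longest coset word brings the letter `K` to position `0`; all shorter ones see only
    -- zeros of `f`.
    rw [LinearMap.sum_apply, map_sum, Finset.sum_eq_single 0]
    · rw [Nat.sub_zero, hcM _ hv, evalAt_mulLeft, hΦ, smul_smul, mul_inv_cancel₀ hf1, one_smul, hw]
    · intro j hj hj0
      have hj' := Finset.mem_range.1 hj
      exact evalAt_upProd_pairT_eq_zero (k := K) (by simp [K]; omega) hz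
        fun g hg => hv g (by omega)
    · intro h; simp at h

theorem exists_mem_physical_evalAt {q : ℂ} (hq : q ≠ 0) {z : Fin N → ℂ}
    (hz : IsAdmissible q z) (v : SpinSpace N) : ∃ Ψ ∈ physical N q, evalAt z Ψ = v := by
  have hN := NeZero.ne N
  obtain ⟨Φ, hΦ⟩ := exists_evalAt_symmetrizer hq (k := N - 1) (by omega) hz v
  exact ⟨_, symmetrizer_mem_physical hq Φ, hΦ⟩

end EvaluationSurjective

/-! ## The `q`-translation operator -/

section Translation

variable {N : ℕ} [NeZero N]

open MvPolynomial

/-- Scaling of all variables. -/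
def scaleOp (N : ℕ) (c : ℂ) : Module.End ℂ (Pol N) :=
  (aeval fun j : Fin N => C c * (X j : Pol N)).toLinearMap

omit [NeZero N] in
theorem eval_scaleOp (c : ℂ) (z : Fin N → ℂ) (F : Pol N) :
    eval z (scaleOp N c F) = eval (fun j => c * z j) F := by
  have : (aeval z : Pol N →ₐ[ℂ] ℂ).comp (aeval fun j : Fin N => C c * (X j : Pol N))
      = aeval (fun j => c * z j) := by
    refine MvPolynomial.algHom_ext fun j => ?_
    simp
  have := DFunLike.congr_fun this F
  simpa [scaleOp, aeval_eq_eval] using this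

omit [NeZero N] in
theorem commute_scaleOp_Tpol (q : ℂ) {c : ℂ} (hc : c ≠ 0) {i j : Fin N} (hij : i ≠ j) :
    Commute (scaleOp N c) (Tpol q i j) := by
  refine LinearMap.ext fun F => pol_ext_injective fun z hz => ?_
  have h1 : z i ≠ z j := fun e => hij (hz e)
  have h2 : c * z i ≠ c * z j := fun e => h1 (mul_left_cancel₀ hc e)
  simp only [Module.End.mul_apply, eval_scaleOp, eval_Tpol q h1]
  rw [eval_Tpol q (z := fun j => c * z j) h2, braidCoef_scale q hc]
  rfl

omit [NeZero N] in
theorem commute_scaleOp_heckeT (q : ℂ) {c : ℂ} (hc : c ≠ 0) (i : ℕ) :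
    Commute (scaleOp N c) (heckeT N q i) := by
  rw [heckeT]
  split_ifs
  · exact commute_scaleOp_Tpol q hc (by simp)
  · exact Commute.one_right _

omit [NeZero N] in
theorem commute_scaleOp_heckeTInv (q : ℂ) {c : ℂ} (hc : c ≠ 0) (i : ℕ) :
    Commute (scaleOp N c) (heckeTInv N q i) := by
  rw [heckeTInv]
  split_ifs
  · exact (commute_scaleOp_Tpol q hc (by simp)).sub_right ((Commute.one_right _).smul_right _)
  · exact Commute.one_right _

theorem commute_scaleOp_piOp (c p : ℂ) : Commute (scaleOp N c) (piOp p) := by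
  refine LinearMap.ext fun F => MvPolynomial.funext fun z => ?_
  simp only [Module.End.mul_apply, eval_scaleOp, eval_piOp]
  congr 1
  congr 1
  funext j
  simp only [shiftPoint]
  split_ifs <;> ring

/-- The Demazure–Lusztig operators and the shift preserve total degree, so they are compatible with
a common scaling of the variables. -/
theorem commute_scaleOp_Y (q p : ℂ) {c : ℂ} (hc : c ≠ 0) (i : Fin N) :
    Commute (scaleOp N c) (Y q p i) := by
  rw [Y_eq_natY]
  exact ((commute_upProd fun k _ _ => commute_scaleOp_heckeT q hc k).mul_right
    (commute_scaleOp_piOp c p)).mul_right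
    (commute_upProd fun k _ _ => commute_scaleOp_heckeTInv q hc k)

/-- The primitive root of unity `ω`. -/
def omega (N : ℕ) : ℂ := Complex.exp (2 * Real.pi * Complex.I / N)

omit [NeZero N] in
theorem omega_ne_zero : omega N ≠ 0 := Complex.exp_ne_zero _

theorem omega_pow : omega N ^ N = 1 := (Complex.isPrimitiveRoot_exp N (NeZero.ne N)).pow_eq_one

omit [NeZero N] in
theorem evPoint_eq (j : Fin N) : evPoint N j = omega N ^ ((j : ℕ) + 1) := rfl

theorem omega_mul_evPoint (j : Fin N) : omega N * evPoint N j = evPoint N (j + 1) := by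
  rw [evPoint_eq, evPoint_eq, ← pow_succ']
  by_cases h : (j : ℕ) + 1 < N
  · rw [show j + 1 = ⟨j + 1, h⟩ from fin_mk_add_one h]
  · have hj : (j : ℕ) + 1 = N := by have := j.2; omega
    have h0 : j + 1 = 0 := by
      apply Fin.ext
      rw [Fin.val_add, Fin.val_one', Nat.add_mod_mod, hj, Nat.mod_self, Fin.val_zero]
    rw [h0, Fin.val_zero, zero_add, pow_succ, hj, omega_pow, one_mul, pow_one]

/-- Multiplication by `ω` moves each coordinate of the evaluation point to the next one, so scaling
acts there as a cyclic permutation. -/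
theorem ev_scaleOp (Ψ : BigSpace N) :
    ev N (polActHom (scaleOp N (omega N)) Ψ) = evalAt (evPoint N ∘ Equiv.addRight 1) Ψ := by
  funext σ
  rw [ev_eq_evalAt, evalAt_apply, evalAt_apply, polActHom_apply, eval_scaleOp]
  congr 1
  congr 1
  funext j
  exact omega_mul_evPoint j

/-- The cyclic permutation that moves the first label past the first `k` others. -/
def leadCycle (N : ℕ) [NeZero N] : ℕ → Equiv.Perm (Fin N)
  | 0 => 1
  | k + 1 => leadCycle N k * Equiv.swap (Fin.ofNat N k) (Fin.ofNat N (k + 1))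

theorem leadCycle_apply {k : ℕ} (hk : k < N) (j : Fin N) :
    (leadCycle N k j : ℕ) = if (j : ℕ) < k then (j : ℕ) + 1 else if (j : ℕ) = k then 0 else j := by
  induction k generalizing j with
  | zero =>
    simp only [leadCycle, Equiv.Perm.one_apply, Nat.not_lt_zero, if_false]
    split_ifs with h <;> simp [h]
  | succ k ih =>
    have hv : ∀ m < N, ((Fin.ofNat N m : Fin N) : ℕ) = m := fun m hm => by
      simp [Fin.ofNat, Nat.mod_eq_of_lt hm]
    rw [leadCycle, Equiv.Perm.mul_apply, ih (by omega), Equiv.swap_apply_def]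
    simp only [Fin.ext_iff, apply_ite Fin.val, hv k (by omega), hv (k + 1) hk]
    split_ifs <;> simp_all <;> omega

/-- The cyclic permutation is a chain of adjacent transpositions that drag the first coordinate to
the end. Each contributes one `R`-matrix, with the ratio of the first coordinate to the one it
passes, and their product is `G`. -/
theorem qTranslation_ev {q : ℂ} (hq : q ≠ 0) (hN : q ^ (2 * N) ≠ 1) {Ψ : BigSpace N}
    (hΨ : Ψ ∈ physical N q) :
    qTranslation N q (ev N Ψ) = ev N (polActHom (scaleOp N (omega N)) Ψ) := by
  have hN0 : 0 < N := NeZero.pos N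
  have hz := isAdmissible_evPoint (N := N) hN
  let G : ℕ → Matrix (Config N) (Config N) ℂ := fun k =>
    twoSite (Fin.ofNat N k) (Fin.ofNat N (k + 1))
      (Rcheck q (evPoint N 0 / evPoint N (Fin.ofNat N (k + 1))))
  have hof : ∀ (m : ℕ) (hm : m < N), (Fin.ofNat N m : Fin N) = ⟨m, hm⟩ := fun m hm => by
    apply Fin.ext; simp [Fin.ofNat, Nat.mod_eq_of_lt hm]
  have e : qTranslation N q = Matrix.toLin' (downProd G 0 (N - 1)) := by
    have f := map_filter_finRange (fun k : Fin N => twoSite k (k + 1)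
      (Rcheck q (evPoint N 0 / evPoint N (k + 1)))) G
      (fun k : Fin N => (k : ℕ) + 1 < N) (fun k => k + 1 < N) (fun _ => Iff.rfl) (fun k hk => by
        simp only [G]
        rw [hof _ hk, hof k k.2, ← fin_mk_add_one hk])
    have f1 := filter_range'_eq (m := 0) (k := N - 1) (n := 1) (fun k => k + 1 < N)
      (fun j h => by omega) (fun j h h' => by omega) (fun j h h' => by omega)
    rw [show 0 + (N - 1) + 1 = N by omega] at f1
    rw [f1] at f
    rw [qTranslation, downProd, List.map_reverse, List.map_reverse, f]
  have key : ∀ k, k < N → evalAt (evPoint N ∘ leadCycle N k) Ψ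
      = Matrix.toLin' (downProd G 0 k) (ev N Ψ) := by
    intro k hk
    induction k with
    | zero => rw [downProd_zero, Matrix.toLin'_one]; rfl
    | succ k ih =>
      have hsw := evalAt_comp_swap hq hΨ (hz.comp (leadCycle N k)) (i := Fin.ofNat N k)
        (j := Fin.ofNat N (k + 1)) (by rw [hof _ hk, hof k (by omega)])
      have h0 : leadCycle N k (Fin.ofNat N k) = 0 := by
        apply Fin.ext
        rw [leadCycle_apply (by omega), hof k (by omega)]; simp
      have h1 : leadCycle N k (Fin.ofNat N (k + 1)) = Fin.ofNat N (k + 1) := by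
        apply Fin.ext
        rw [leadCycle_apply (by omega), hof _ hk]; simp
      rw [Function.comp_apply, Function.comp_apply, h0, h1, ih (by omega)] at hsw
      rw [downProd_succ, zero_add, Matrix.toLin'_mul, LinearMap.comp_apply, ← hsw]
      rfl
  rw [e, ← key (N - 1) (by omega), ev_scaleOp]
  congr 2
  funext j
  refine congrArg (evPoint N) ?_
  apply Fin.ext
  rw [leadCycle_apply (by omega)]
  have := j.2
  simp only [Equiv.coe_addRight]
  by_cases h : (j : ℕ) + 1 < N
  · rw [if_pos (by omega), show j + 1 = ⟨j + 1, h⟩ from fin_mk_add_one h]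
  · rw [if_neg (by omega), if_pos (by omega), Fin.val_add, Fin.val_one', Nat.add_mod_mod,
      show (j : ℕ) + 1 = N by omega, Nat.mod_self]

end Translation

/-! ## The actions of the quantum-loop algebra -/

section Actions

variable {N : ℕ} [NeZero N]

theorem commute_esymmOp_Y {q p : ℂ} (hq : q ≠ 0) (hp : p ≠ 0) (r : ℕ) (i : Fin N) :
    Commute (esymmOp (Y q p) r) (Y q p i) :=
  (commute_esymmOp_of_forall (fun j => commute_Y hq hp i j) r).symm

theorem commute_esymmOp_inverse_Y {q p : ℂ} (hq : q ≠ 0) (hp : p ≠ 0) (r : ℕ) (i : Fin N) :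
    Commute (esymmOp (fun j => Ring.inverse (Y q p j)) r) (Y q p i) :=
  (commute_esymmOp_of_forall (fun j => commute_of_inverse
    (Ring.mul_inverse_cancel _ (isUnit_Y hq hp j)) (Ring.inverse_mul_cancel _ (isUnit_Y hq hp j))
    (commute_Y hq hp i j)) r).symm

theorem commute_spinMacdonald_mode {q p : ℂ} (hq : q ≠ 0) (hp : p ≠ 0) (r : ℕ) (ε : Pt) (n : ℕ)
    (α β : Fin 2) : Commute (spinMacdonald (N := N) q p r) (mode q p ε n α β) :=
  commute_polActHom_mode hq hp (commute_esymmOp_Y hq hp r) ε n α β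

theorem commute_spinMacdonaldNeg_mode {q p : ℂ} (hq : q ≠ 0) (hp : p ≠ 0) (r : ℕ) (ε : Pt) (n : ℕ)
    (α β : Fin 2) : Commute (spinMacdonaldNeg (N := N) q p r) (mode q p ε n α β) :=
  commute_polActHom_mode hq hp (commute_esymmOp_inverse_Y hq hp r) ε n α β

theorem spinMacdonald_mem_physical {q p : ℂ} (hq : q ≠ 0) (hp : p ≠ 0) (r : ℕ) {Ψ : BigSpace N}
    (hΨ : Ψ ∈ physical N q) : spinMacdonald q p r Ψ ∈ physical N q :=
  polActHom_mem_physical (fun _ hi => commute_heckeT_esymmOp hq hp hi r) hΨ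

theorem spinMacdonaldNeg_mem_physical {q p : ℂ} (hq : q ≠ 0) (hp : p ≠ 0) (r : ℕ)
    {Ψ : BigSpace N} (hΨ : Ψ ∈ physical N q) : spinMacdonaldNeg q p r Ψ ∈ physical N q :=
  polActHom_mem_physical (fun _ hi => commute_heckeT_esymmOp_inverse hq hp hi r) hΨ

/-- The modes of the monodromy matrix on the physical space. -/
def physicalMode {q p : ℂ} (hq : q ≠ 0) (hp : p ≠ 0) (ε : Pt) (n : ℕ) (α β : Fin 2) :
    Module.End ℂ (physical N q) :=
  (mode q p ε n α β).restrict fun _ hΨ => mode_mem_physical hq hp ε n α β hΨ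

theorem isLoopRep_physicalMode {q p : ℂ} (hq : q ≠ 0) (hp : p ≠ 0) :
    IsLoopRep q (physicalMode (N := N) hq hp) :=
  IsLoopRep.of_injective (e := (physical N q).subtype) (Submodule.subtype_injective _)
    (isLoopRep_mode hq hp) fun _ _ _ _ _ => rfl

/-- An operator that preserves the physical space and commutes with the modes restricts to one that
commutes with the generators, hence with the whole image of the algebra. -/
theorem loopHom_apply_of_commute {q p : ℂ} (hq : q ≠ 0) (hp : p ≠ 0)
    {φ : QuantumLoop q →ₐ[ℂ] Module.End ℂ (physical N q)}
    (hφ : ∀ ε n α β, φ (loopGen q ε n α β) = physicalMode hq hp ε n α β)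
    {O : Module.End ℂ (BigSpace N)} (hO : ∀ Ψ ∈ physical N q, O Ψ ∈ physical N q)
    (hc : ∀ ε n α β, Commute O (mode q p ε n α β)) (x : QuantumLoop q)
    {Ψ Ψ' : physical N q} (h : (Ψ' : BigSpace N) = O Ψ) :
    (φ x Ψ' : BigSpace N) = O (φ x Ψ) := by
  have h1 : Commute (O.restrict hO) (φ x) := commute_loopHom (W := Module.End ℂ (physical N q)) φ (fun ε n α β => by
    rw [hφ]
    refine LinearMap.ext fun v => Subtype.ext ?_
    exact DFunLike.congr_fun (hc ε n α β).eq (v : BigSpace N)) x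
  have h2 : Ψ' = O.restrict hO Ψ := Subtype.ext h
  rw [h2]
  have := DFunLike.congr_fun h1.eq Ψ
  exact (congrArg Subtype.val this).symm

theorem exists_factor {E F F' : Type*} [AddCommGroup E] [Module ℂ E] [AddCommGroup F] [Module ℂ F]
    [AddCommGroup F'] [Module ℂ F'] {e : E →ₗ[ℂ] F} (he : Function.Surjective e) (f : E →ₗ[ℂ] F')
    (h : ∀ v, e v = 0 → f v = 0) : ∃ g : F →ₗ[ℂ] F', ∀ v, g (e v) = f v := by
  obtain ⟨s, hs⟩ := e.exists_rightInverse_of_surjective (LinearMap.range_eq_top.2 he)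
  refine ⟨f ∘ₗ s, fun v => ?_⟩
  have : e (s (e v) - v) = 0 := by
    rw [map_sub, sub_eq_zero]; exact DFunLike.congr_fun hs (e v)
  have := h _ this
  rwa [map_sub, sub_eq_zero] at this

/-- Evaluation of physical vectors. -/
def physicalEv (N : ℕ) (q : ℂ) : physical N q →ₗ[ℂ] SpinSpace N := ev N ∘ₗ (physical N q).subtype

theorem physicalEv_surjective {q : ℂ} (hq : q ≠ 0) (hN : q ^ (2 * N) ≠ 1) :
    Function.Surjective (physicalEv N q) := fun v => by
  obtain ⟨Ψ, hΨ, h⟩ := exists_mem_physical_evalAt hq (isAdmissible_evPoint hN) v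
  exact ⟨⟨Ψ, hΨ⟩, h⟩

/-- Surjectivity of evaluation and stability of its kernel on physical vectors let the modes
descend; the defining relations are inherited along the surjection. -/
theorem exists_spinMode {q : ℂ} (hq : q ≠ 0) (hN : q ^ (2 * N) ≠ 1) :
    ∃ ℓ : Pt → ℕ → Fin 2 → Fin 2 → Module.End ℂ (SpinSpace N), IsLoopRep q ℓ ∧
      ∀ ε n α β, ∀ Ψ ∈ physical N q, ℓ ε n α β (ev N Ψ) = ev N (mode q 1 ε n α β Ψ) := by
  have hs := physicalEv_surjective hq hN
  have h := fun ε n α β => exists_factor hs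
    (physicalEv N q ∘ₗ physicalMode hq one_ne_zero ε n α β)
    fun v hv => ev_mode_eq_zero hq hN v.2 hv ε n α β
  choose ℓ hℓ using h
  exact ⟨ℓ, (isLoopRep_physicalMode hq one_ne_zero).of_surjective hs
    (fun ε n α β v => (hℓ ε n α β v).symm), fun ε n α β Ψ hΨ => hℓ ε n α β ⟨Ψ, hΨ⟩⟩

/-- Commutation on the spin chain is checked on evaluations of physical vectors. `Λ` is the
evaluation of an operator upstairs, as for both `G` and the Hamiltonians. -/
theorem commute_spinMode_of_intertwines {q : ℂ} (hq : q ≠ 0) (hN : q ^ (2 * N) ≠ 1)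
    {φ : QuantumLoop q →ₐ[ℂ] Module.End ℂ (SpinSpace N)}
    (hφ : ∀ ε n α β, ∀ Ψ ∈ physical N q,
      φ (loopGen q ε n α β) (ev N Ψ) = ev N (mode q 1 ε n α β Ψ))
    {K : Module.End ℂ (SpinSpace N)} {Λ : BigSpace N →ₗ[ℂ] SpinSpace N}
    (hK : ∀ Ψ ∈ physical N q, K (ev N Ψ) = Λ Ψ)
    (hc : ∀ ε n α β, ∀ Ψ ∈ physical N q,
      Λ (mode q 1 ε n α β Ψ) = φ (loopGen q ε n α β) (Λ Ψ)) (x : QuantumLoop q) :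
    Commute (φ x) K := by
  refine (commute_loopHom φ (fun ε n α β => ?_) x).symm
  refine LinearMap.ext fun v => ?_
  obtain ⟨⟨Ψ, hΨ⟩, rfl⟩ := physicalEv_surjective hq hN v
  change K (φ _ (ev N Ψ)) = φ _ (K (ev N Ψ))
  rw [hφ ε n α β Ψ hΨ, hK _ (mode_mem_physical hq one_ne_zero ε n α β hΨ), hK Ψ hΨ,
    hc ε n α β Ψ hΨ]

theorem commute_qTranslation {q : ℂ} (hq : q ≠ 0) (hN : q ^ (2 * N) ≠ 1)
    {φ : QuantumLoop q →ₐ[ℂ] Module.End ℂ (SpinSpace N)}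
    (hφ : ∀ ε n α β, ∀ Ψ ∈ physical N q,
      φ (loopGen q ε n α β) (ev N Ψ) = ev N (mode q 1 ε n α β Ψ)) (x : QuantumLoop q) :
    Commute (φ x) (qTranslation N q) := by
  refine commute_spinMode_of_intertwines hq hN hφ
    (Λ := ev N ∘ₗ polActHom (scaleOp N (omega N))) (fun Ψ hΨ => qTranslation_ev hq hN hΨ)
    (fun ε n α β Ψ hΨ => ?_) x
  have h1 := (commute_polActHom_mode hq one_ne_zero
    (fun i => commute_scaleOp_Y (N := N) q 1 (omega_ne_zero (N := N)) i) ε n α β).eq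
  have h2 : polActHom (scaleOp N (omega N)) Ψ ∈ physical N q :=
    polActHom_mem_physical (fun i _ => (commute_scaleOp_heckeT q omega_ne_zero i).symm) hΨ
  rw [LinearMap.comp_apply, LinearMap.comp_apply, hφ _ _ _ _ _ h2, ← Module.End.mul_apply, h1]
  rfl

end Actions

/-! ## Families of operators that are polynomial in the difference parameter -/

section Expansions

open Filter Topology

variable {V : Type*} [AddCommGroup V] [Module ℂ V]

/-- The value at `c` of a polynomial with vector coefficients. -/
def polyEval (c : ℂ) : (ℕ →₀ V) →ₗ[ℂ] V := Finsupp.lsum ℂ fun k => c ^ k • LinearMap.id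

theorem polyEval_single (c : ℂ) (k : ℕ) (v : V) :
    polyEval c (Finsupp.single k v) = c ^ k • v := by
  rw [polyEval, Finsupp.lsum_single]; rfl

theorem polyEval_zero (f : ℕ →₀ V) : polyEval 0 f = f 0 := by
  induction f using Finsupp.induction_linear with
  | zero => simp
  | add f g hf hg => rw [map_add, hf, hg, Finsupp.add_apply]
  | single k v =>
    rw [polyEval_single]
    rcases k with _ | k
    · simp
    · simp

theorem hasDerivAt_polyEval (ℓ : V →ₗ[ℂ] ℂ) (f : ℕ →₀ V) :
    HasDerivAt (fun p : ℂ => ℓ (polyEval (p - 1) f)) (ℓ (f 1)) 1 := by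
  induction f using Finsupp.induction_linear with
  | zero => simpa using hasDerivAt_const (1 : ℂ) (0 : ℂ)
  | add f g hf hg =>
    simp only [map_add, Finsupp.add_apply]
    exact HasDerivAt.fun_add hf hg
  | single k v =>
    simp only [polyEval_single, map_smul, smul_eq_mul]
    have h1 : HasDerivAt (fun p : ℂ => p - 1) 1 1 := (hasDerivAt_id (1 : ℂ)).sub_const 1
    have h2 := (h1.pow k).mul_const (ℓ v)
    refine h2.congr_deriv ?_
    rcases k with _ | _ | k
    · simp
    · simp
    · simp

/-- `A` depends polynomially on `p`, with the value `A₀` and the derivative `A₁` at `p = 1`. -/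
def HasExpansion (A : ℂ → Module.End ℂ V) (A₀ A₁ : Module.End ℂ V) : Prop :=
  ∃ a : V →ₗ[ℂ] (ℕ →₀ V), (∀ p v, A p v = polyEval (p - 1) (a v)) ∧
    (∀ v, a v 0 = A₀ v) ∧ ∀ v, a v 1 = A₁ v

namespace HasExpansion

variable {A B : ℂ → Module.End ℂ V} {A₀ A₁ B₀ B₁ : Module.End ℂ V}

theorem const (O : Module.End ℂ V) : HasExpansion (fun _ => O) O 0 :=
  ⟨Finsupp.lsingle 0 ∘ₗ O, fun p v => by simp [polyEval_single], fun v => by simp,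
    fun v => by simp⟩

theorem add (hA : HasExpansion A A₀ A₁) (hB : HasExpansion B B₀ B₁) :
    HasExpansion (fun p => A p + B p) (A₀ + B₀) (A₁ + B₁) := by
  obtain ⟨a, ha, ha0, ha1⟩ := hA
  obtain ⟨b, hb, hb0, hb1⟩ := hB
  exact ⟨a + b, fun p v => by simp [ha, hb], fun v => by simp [ha0, hb0],
    fun v => by simp [ha1, hb1]⟩

theorem mul (hA : HasExpansion A A₀ A₁) (hB : HasExpansion B B₀ B₁) :
    HasExpansion (fun p => A p * B p) (A₀ * B₀) (A₁ * B₀ + A₀ * B₁) := by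
  obtain ⟨a, ha, ha0, ha1⟩ := hA
  obtain ⟨b, hb, hb0, hb1⟩ := hB
  -- Composition is multiplication of polynomials: the expansion of `A` is applied to each
  -- coefficient, and the exponents are shifted accordingly.
  let c : (ℕ →₀ V) →ₗ[ℂ] (ℕ →₀ V) :=
    Finsupp.lsum ℂ fun k => Finsupp.lmapDomain V ℂ (· + k) ∘ₗ a
  have hc : ∀ k v, c (Finsupp.single k v) = Finsupp.mapDomain (· + k) (a v) := fun k v => by
    simp [c]
  have h1 : ∀ p f, polyEval (p - 1) (c f) = A p (polyEval (p - 1) f) := by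
    intro p f
    induction f using Finsupp.induction_linear with
    | zero => simp
    | add f g hf hg => rw [map_add, map_add, hf, hg, map_add, map_add]
    | single k v =>
      rw [hc, polyEval_single, map_smul, ha]
      generalize a v = g
      induction g using Finsupp.induction_linear with
      | zero => simp
      | add f g hf hg => rw [Finsupp.mapDomain_add, map_add, hf, hg, map_add, smul_add]
      | single l w =>
        rw [Finsupp.mapDomain_single, polyEval_single, polyEval_single, smul_smul, pow_add,
          mul_comm]
  have hshift : ∀ (k : ℕ) (g : ℕ →₀ V) m, Finsupp.mapDomain (· + k) g m
      = if k ≤ m then g (m - k) else 0 := by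
    intro k g m
    split_ifs with h
    · obtain ⟨l, rfl⟩ := Nat.exists_eq_add_of_le' h
      rw [Finsupp.mapDomain_apply (add_left_injective k), Nat.add_sub_cancel]
    · exact Finsupp.mapDomain_of_notMem_range _ _ fun ⟨l, hl⟩ => h (by simp only at hl; omega)
  have h2 : ∀ f, c f 0 = a (f 0) 0 ∧ c f 1 = a (f 0) 1 + a (f 1) 0 := by
    intro f
    induction f using Finsupp.induction_linear with
    | zero => simp
    | add f g hf hg =>
      simp only [map_add, Finsupp.add_apply, hf.1, hg.1, hf.2, hg.2]
      exact ⟨trivial, by abel⟩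
    | single k v =>
      rw [hc, hshift, hshift]
      rcases k with _ | _ | k
      · simp
      · simp
      · simp
  refine ⟨c ∘ₗ b, fun p v => ?_, fun v => ?_, fun v => ?_⟩
  · rw [LinearMap.comp_apply, h1, ← hb]; rfl
  · rw [LinearMap.comp_apply, (h2 _).1, ha0, hb0]; rfl
  · rw [LinearMap.comp_apply, (h2 _).2, ha1, hb0, ha0, hb1]; rfl

theorem eq_value (hA : HasExpansion A A₀ A₁) : A 1 = A₀ := by
  obtain ⟨a, ha, ha0, _⟩ := hA
  refine LinearMap.ext fun v => ?_
  rw [ha, sub_self, polyEval_zero, ha0]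

theorem hasDerivAt (hA : HasExpansion A A₀ A₁) (ℓ : V →ₗ[ℂ] ℂ) (v : V) :
    HasDerivAt (fun p => ℓ (A p v)) (ℓ (A₁ v)) 1 := by
  obtain ⟨a, ha, _, ha1⟩ := hA
  simp only [ha, ← ha1]
  exact hasDerivAt_polyEval ℓ (a v)

/-- Linear functionals separate vectors, so no topology on `V` is needed and derivatives are taken
of scalar functions only. -/
theorem eq_deriv (hA : HasExpansion A A₀ A₁) {O : Module.End ℂ V}
    (h : ∀ (ℓ : V →ₗ[ℂ] ℂ) (v : V), HasDerivAt (fun p => ℓ (A p v)) (ℓ (O v)) 1) : A₁ = O := by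
  refine LinearMap.ext fun v => ?_
  rw [← sub_eq_zero, ← Module.forall_dual_apply_eq_zero_iff ℂ]
  intro ℓ
  rw [map_sub, sub_eq_zero]
  exact (hA.hasDerivAt ℓ v).unique (h ℓ v)

/-- This allows operator identities valid for `p` near `1` to be differentiated algebraically.
Agreement near `1` suffices, since identities in the affine Hecke algebra are available only for `p
≠ 0`. -/
theorem deriv_unique (hA : HasExpansion A A₀ A₁) (hB : HasExpansion B B₀ B₁)
    (h : ∀ᶠ p in 𝓝 1, A p = B p) : A₁ = B₁ :=
  hA.eq_deriv fun ℓ v => (hB.hasDerivAt ℓ v).congr_of_eventuallyEq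
    (h.mono fun p hp => by simp only [hp])

end HasExpansion

/-- `A` depends polynomially on `p`. -/
def Expandable (A : ℂ → Module.End ℂ V) : Prop := ∃ A₀ A₁, HasExpansion A A₀ A₁

namespace Expandable

variable {A B : ℂ → Module.End ℂ V}

theorem const (O : Module.End ℂ V) : Expandable fun _ => O := ⟨_, _, HasExpansion.const O⟩

theorem add (hA : Expandable A) (hB : Expandable B) : Expandable fun p => A p + B p := by
  obtain ⟨A₀, A₁, hA⟩ := hA
  obtain ⟨B₀, B₁, hB⟩ := hB
  exact ⟨_, _, hA.add hB⟩

theorem mul (hA : Expandable A) (hB : Expandable B) : Expandable fun p => A p * B p := by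
  obtain ⟨A₀, A₁, hA⟩ := hA
  obtain ⟨B₀, B₁, hB⟩ := hB
  exact ⟨_, _, hA.mul hB⟩

theorem sum {ι : Type*} (s : Finset ι) {A : ι → ℂ → Module.End ℂ V}
    (h : ∀ i ∈ s, Expandable (A i)) : Expandable fun p => ∑ i ∈ s, A i p := by
  classical
  induction s using Finset.induction_on with
  | empty => simpa using const (0 : Module.End ℂ V)
  | insert i s hi ih =>
    simp only [Finset.sum_insert hi]
    exact (h i (Finset.mem_insert_self i s)).add
      (ih fun j hj => h j (Finset.mem_insert_of_mem hj))

theorem coeff_mul {F G : ℂ → Polynomial (Module.End ℂ V)}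
    (hF : ∀ n, Expandable fun p => (F p).coeff n) (hG : ∀ n, Expandable fun p => (G p).coeff n)
    (n : ℕ) : Expandable fun p => (F p * G p).coeff n := by
  simp only [Polynomial.coeff_mul]
  exact sum _ fun x _ => (hF x.1).mul (hG x.2)

theorem coeff_esymmGen {y : ℂ → ℕ → Module.End ℂ V} (hy : ∀ k, Expandable fun p => y p k)
    (a m n : ℕ) : Expandable fun p => (esymmGen (y p) a m).coeff n := by
  induction m generalizing n with
  | zero => simp only [esymmGen, upProd_zero]; exact const _
  | succ m ih =>
    simp only [esymmGen, upProd_succ]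
    refine coeff_mul ih (fun k => ?_) n
    simp only [Polynomial.coeff_add]
    refine (const _).add ?_
    rcases k with _ | _ | k
    · simpa using const (0 : Module.End ℂ V)
    · simpa [Polynomial.coeff_X_mul] using hy (a + m)
    · simpa [Polynomial.coeff_X_mul] using const (0 : Module.End ℂ V)

end Expandable

open MvPolynomial in
-- On a monomial the parameter enters through `p ^ s 0`, with `s 0` the exponent of the first
-- variable; the binomial theorem rewrites this in powers of `p - 1`.
theorem expandable_piOp (N : ℕ) [NeZero N] : Expandable (V := Pol N) fun p => piOp p := by
  have hmon : ∀ (p : ℂ) (s : Fin N →₀ ℕ), piOp p (monomial s (1 : ℂ))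
      = p ^ s 0 • piOp 1 (monomial s (1 : ℂ)) := by
    intro p s
    refine MvPolynomial.funext fun z => ?_
    rw [eval_piOp, smul_eval, eval_piOp, eval_monomial, eval_monomial, one_mul, one_mul,
      Finsupp.prod_fintype _ _ (fun _ => pow_zero _), Finsupp.prod_fintype _ _ (fun _ => pow_zero _)]
    have h : ∀ i, shiftPoint p z i = (if i = 0 then p else 1) * shiftPoint 1 z i := by
      intro i; simp only [shiftPoint]; split_ifs <;> simp
    simp only [h, mul_pow, Finset.prod_mul_distrib, ite_pow, one_pow, Finset.prod_ite_eq',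
      Finset.mem_univ, if_true]
  let a : Pol N →ₗ[ℂ] (ℕ →₀ Pol N) := (basisMonomials (Fin N) ℂ).constr ℂ fun s =>
    ∑ k ∈ Finset.range (s 0 + 1),
      Finsupp.single k (((s 0).choose k : ℂ) • piOp 1 (monomial s (1 : ℂ)))
  have ha : ∀ p v, piOp p v = polyEval (p - 1) (a v) := by
    intro p v
    refine DFunLike.congr_fun ((basisMonomials (Fin N) ℂ).ext (f₁ := piOp p)
      (f₂ := polyEval (p - 1) ∘ₗ a) fun s => ?_) v
    rw [LinearMap.comp_apply, Module.Basis.constr_basis, coe_basisMonomials, hmon, map_sum]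
    simp only [polyEval_single, smul_smul, ← Finset.sum_smul]
    congr 1
    conv_lhs => rw [show p = (p - 1) + 1 by ring, add_pow]
    simp
  exact ⟨Finsupp.lapply 0 ∘ₗ a, Finsupp.lapply 1 ∘ₗ a, a, ha, fun _ => rfl, fun _ => rfl⟩

theorem expandable_natY (N : ℕ) [NeZero N] (q : ℂ) (i : ℕ) :
    Expandable fun p => natY N q p i :=
  ((Expandable.const _).mul (expandable_piOp N)).mul (Expandable.const _)

theorem expandable_esymmOp (N : ℕ) [NeZero N] (q : ℂ) (r : ℕ) :
    Expandable fun p => esymmOp (Y (N := N) q p) r := by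
  have : (fun p => esymmOp (Y (N := N) q p) r) = fun p => (esymmGen (natY N q p) 0 N).coeff r := by
    funext p
    rw [← esymmOp_eq_coeff]
    exact congrArg (fun y => esymmOp y r) (funext (Y_eq_natY q p))
  rw [this]
  exact Expandable.coeff_esymmGen (expandable_natY N q) 0 N r

end Expansions

/-! ## Macdonald operators near the classical point -/

section Shift

open Polynomial

variable {A : Type*} [Ring A]

theorem coeff_zero_esymmGen (y : ℕ → A) (a n : ℕ) : (esymmGen y a n).coeff 0 = 1 := by
  induction n with
  | zero => simp [esymmGen, upProd_zero]
  | succ n ih =>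
    rw [esymmGen, upProd_succ, mul_coeff_zero]
    rw [esymmGen] at ih
    rw [ih]; simp

theorem coeff_esymmGen_succ (y : ℕ → A) (a n r : ℕ) :
    (esymmGen y a (n + 1)).coeff (r + 1)
      = (esymmGen y a n).coeff (r + 1) + (esymmGen y a n).coeff r * y (a + n) := by
  rw [esymmGen, upProd_succ, mul_add, mul_one, ← mul_assoc, coeff_add, coeff_mul_C,
    coeff_mul_X]
  rfl

theorem commute_coeff_esymmGen {y : ℕ → A} {t : A} {n : ℕ} (h : ∀ k < n, Commute t (y k))
    (r : ℕ) : Commute t ((esymmGen y 0 n).coeff r) := by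
  induction n generalizing r with
  | zero =>
    rw [esymmGen, upProd_zero, coeff_one]
    split_ifs
    · exact Commute.one_right t
    · exact Commute.zero_right t
  | succ n ih =>
    have ih := ih fun k hk => h k (by omega)
    rcases r with _ | r
    · rw [coeff_zero_esymmGen]; exact Commute.one_right t
    · rw [coeff_esymmGen_succ, zero_add]
      exact (ih _).add_right ((ih _).mul_right (h n (by omega)))

/-- The terms of `e_r(y_0, …, y_n)` that contain `y_n`. -/
def lastPart (y : ℕ → A) (n : ℕ) : ℕ → A
  | 0 => 0
  | r + 1 => y n * (esymmGen y 0 n).coeff r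

theorem coeff_X_mul_C_mul_esymmGen (y : ℕ → A) (n r : ℕ) :
    (X * C (y n) * esymmGen y 0 n).coeff r = lastPart y n r := by
  rcases r with _ | r
  · rw [mul_assoc]; simp [lastPart]
  · rw [mul_assoc, coeff_X_mul, coeff_C_mul, lastPart]

theorem commute_lastPart {y : ℕ → A} {t : A} {n : ℕ} (h : ∀ k ≤ n, Commute t (y k)) (r : ℕ) :
    Commute t (lastPart y n r) := by
  rcases r with _ | r
  · exact Commute.zero_right t
  · exact (h n le_rfl).mul_right (commute_coeff_esymmGen (fun k hk => h k hk.le) r)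

/-- Moving `w` through the generating function shifts `y_1, …, y_n` to `y_0, …, y_{n-1}` and turns
`y_0` into `c y_n`. For `c = 1` it only permutes the factors, so the defect is `c - 1` times the
terms that contain `y_n`. -/
theorem mul_esymmGen_sub [Algebra ℂ A] {y : ℕ → A} {w : A} {c : ℂ} {n : ℕ}
    (h0 : w * y 0 = c • (y n * w)) (hs : ∀ i < n, w * y (i + 1) = y i * w)
    (hc : ∀ i < n, Commute (y n) (y i)) (r : ℕ) :
    w * (esymmGen y 0 (n + 1)).coeff r - (esymmGen y 0 (n + 1)).coeff r * w
      = (c - 1) • (lastPart y n r * w) := by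
  have hX : ∀ f : A[X], X * f = f * X := fun f => X_mul
  have e1 : ∀ m ≤ n, C w * esymmGen y 1 m = esymmGen y 0 m * C w := by
    intro m hm
    induction m with
    | zero => simp [esymmGen, upProd_zero]
    | succ m ih =>
      have : C w * (1 + X * C (y (1 + m))) = (1 + X * C (y (0 + m))) * C w := by
        rw [mul_add, mul_one, ← mul_assoc, ← hX, mul_assoc, ← C_mul, Nat.add_comm 1 m,
          hs m (by omega), zero_add, add_mul, one_mul, mul_assoc, ← C_mul]
      have ih := ih (by omega)
      rw [esymmGen] at ih ⊢
      rw [esymmGen] at ih ⊢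
      rw [upProd_succ, ← mul_assoc, ih, mul_assoc, this, ← mul_assoc, upProd_succ]
  have e0 : C w * (1 + X * C (y 0)) = (1 + X * C (c • y n)) * C w := by
    rw [mul_add, mul_one, ← mul_assoc, ← hX, mul_assoc, ← C_mul, h0, add_mul, one_mul, mul_assoc,
      ← C_mul, smul_mul_assoc]
  have e2 : Commute (X * C (y n)) (esymmGen y 0 n) := by
    refine commute_upProd fun k _ hk => (Commute.one_right _).add_right ?_
    have h1 : Commute (C (y n)) (C (y k)) := by
      rw [Commute, SemiconjBy, ← C_mul, ← C_mul, (hc k (by omega)).eq]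
    exact (commute_X _).mul_left ((commute_X _).symm.mul_right h1)
  have key : C w * esymmGen y 0 (n + 1) - esymmGen y 0 (n + 1) * C w
      = (c - 1) • (X * C (y n) * esymmGen y 0 n * C w) := by
    have l : C w * esymmGen y 0 (n + 1) = (1 + X * C (c • y n)) * (esymmGen y 0 n * C w) := by
      rw [← e1 n le_rfl, ← mul_assoc, ← e0, mul_assoc, esymmGen, upProd_succ_left]; rfl
    have r : esymmGen y 0 (n + 1) = (1 + X * C (y n)) * esymmGen y 0 n := by
      have : esymmGen y 0 (n + 1) = esymmGen y 0 n * (1 + X * C (y n)) := by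
        rw [esymmGen, upProd_succ, zero_add]; rfl
      rw [this, add_mul, mul_add, e2.eq, one_mul, mul_one]
    rw [l, r, ← smul_C, mul_smul_comm, sub_smul, one_smul, mul_assoc (1 + X * C (y n)), add_mul,
      add_mul, smul_mul_assoc, mul_assoc (X * C (y n))]
    abel
  have := congrArg (fun f => coeff f r) key
  simpa only [coeff_sub, coeff_C_mul, coeff_mul_C, coeff_smul, coeff_X_mul_C_mul_esymmGen] using this

end Shift

/-! ### Gaussian binomials as elementary symmetric functions -/

section QBinomial

theorem coeff_esymmGen_smul {R : Type*} [CommRing R] (c : R) {y y' : ℕ → R}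
    {n : ℕ} (h : ∀ k < n, y' k = c * y k) (r : ℕ) :
    (esymmGen y' 0 n).coeff r = c ^ r * (esymmGen y 0 n).coeff r := by
  induction n generalizing r with
  | zero =>
    rw [esymmGen, upProd_zero, esymmGen, upProd_zero, Polynomial.coeff_one]
    split_ifs with h <;> simp [h]
  | succ n ih =>
    have ih := ih fun k hk => h k (by omega)
    rcases r with _ | r
    · simp [coeff_zero_esymmGen]
    · rw [coeff_esymmGen_succ, coeff_esymmGen_succ, ih, ih, zero_add, h n (by omega)]
      ring

theorem coeff_esymmGen_eq_qBinom {q : ℂ} (hq : q ≠ 0) (n r : ℕ) :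
    (esymmGen (fun k => q ^ ((n : ℤ) - 1 - 2 * k)) 0 n).coeff r = qBinom q n r := by
  induction n generalizing r with
  | zero =>
    rw [esymmGen, upProd_zero, Polynomial.coeff_one]
    rcases r with _ | r <;> simp [qBinom]
  | succ n ih =>
    rcases r with _ | r
    · simp [coeff_zero_esymmGen, qBinom]
    · have h := coeff_esymmGen_smul (n := n) q (y := fun k => q ^ ((n : ℤ) - 1 - 2 * k))
        (y' := fun k => q ^ (((n + 1 : ℕ) : ℤ) - 1 - 2 * k)) fun k _ => by
          rw [← zpow_one_add₀ hq]; congr 1; push_cast; ring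
      rw [coeff_esymmGen_succ, h, h, ih, ih, qBinom]
      have e : q ^ ((r : ℤ) - n) = q ^ r * q ^ (((n + 1 : ℕ) : ℤ) - 1 - 2 * ((0 + n : ℕ) : ℤ)) := by
        rw [← zpow_natCast, ← zpow_add₀ hq]; congr 1; push_cast; ring
      rw [e]; ring

theorem qBinom_eq_zero_of_lt (q : ℂ) {n k : ℕ} (h : n < k) : qBinom q n k = 0 := by
  induction n generalizing k with
  | zero => obtain ⟨k, rfl⟩ := Nat.exists_eq_add_of_lt h; simp [qBinom]
  | succ n ih =>
    obtain ⟨k, rfl⟩ : ∃ l, k = l + 1 := ⟨k - 1, by omega⟩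
    rw [qBinom, ih (by omega), ih (by omega)]; simp

theorem qBinom_self (q : ℂ) (n : ℕ) : qBinom q n n = 1 := by
  induction n with
  | zero => simp [qBinom]
  | succ n ih => rw [qBinom, qBinom_eq_zero_of_lt q (Nat.lt_succ_self n), ih]; simp

end QBinomial

/-! ## The linearised Macdonald operators -/

section Linearised

open Filter Topology

variable {V : Type*} [AddCommGroup V] [Module ℂ V] {A : ℂ → Module.End ℂ V}
  {A₀ A₁ : Module.End ℂ V}

theorem HasExpansion.commute_deriv (hA : HasExpansion A A₀ A₁) {O : Module.End ℂ V}
    (h : ∀ p, p ≠ 0 → Commute O (A p)) : Commute O A₁ := by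
  have h1 := ((HasExpansion.const O).mul hA).deriv_unique (hA.mul (HasExpansion.const O))
    ((eventually_ne_nhds one_ne_zero).mono fun p hp => (h p hp).eq)
  rw [Commute, SemiconjBy]
  simpa using h1

theorem HasExpansion.pow (V : Type*) [AddCommGroup V] [Module ℂ V] (k : ℕ) :
    HasExpansion (V := V) (fun p => p ^ k • 1) 1 ((k : ℂ) • 1) := by
  have h1 : HasExpansion (V := V) (fun p => p • 1) 1 1 :=
    ⟨Finsupp.lsingle 0 + Finsupp.lsingle 1, fun p v => by
      simp only [LinearMap.add_apply, Finsupp.lsingle_apply, map_add, polyEval_single,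
        LinearMap.smul_apply, Module.End.one_apply, pow_zero, pow_one, ← add_smul]
      congr 1; ring, fun v => by simp, fun v => by simp⟩
  induction k with
  | zero => simpa using HasExpansion.const (1 : Module.End ℂ V)
  | succ k ih =>
    have h2 := ih.mul h1
    have e : (fun p : ℂ => p ^ k • (1 : Module.End ℂ V) * p • 1) = fun p => p ^ (k + 1) • 1 := by
      funext p; rw [smul_mul_smul_comm, mul_one, pow_succ]
    rw [e] at h2
    simpa [add_smul] using h2

end Linearised

/-! ### The shift operator; the Macdonald operators at `p = 1` -/

section Macdonald

open MvPolynomial Filter Topology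

variable {N : ℕ} [NeZero N]

/-- Multiplication by `z_i`, with a natural index. -/
def varOp (N : ℕ) [NeZero N] (i : ℕ) : Module.End ℂ (Pol N) :=
  LinearMap.mulLeft ℂ (X (Fin.ofNat N i))

theorem ofNat_of_lt {i : ℕ} (h : i < N) : Fin.ofNat N i = ⟨i, h⟩ := Fin.ext (Nat.mod_eq_of_lt h)

theorem heckeT_mul_varOp_mul_heckeT {q : ℂ} (hq : q ≠ 0) {i : ℕ} (h : i + 1 < N) :
    heckeT N q i * varOp N i * heckeT N q i = varOp N (i + 1) := by
  rw [heckeT_of_lt q h, varOp, varOp, ofNat_of_lt h, ofNat_of_lt ((Nat.lt_succ_self i).trans h)]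
  exact Tpol_mul_mulLeft_X_mul_Tpol hq (by simp)

theorem commute_varOp_zero_heckeT (q : ℂ) {i : ℕ} (hi : 0 < i) (h : i + 1 < N) :
    Commute (varOp N 0) (heckeT N q i) := by
  rw [heckeT_of_lt q h, varOp]
  refine (Tpol_mul_mulLeft q (by simp) ?_).symm
  rw [swapVars, rename_X, Equiv.swap_apply_of_ne_of_ne] <;> simp [Fin.ext_iff]
  all_goals omega

theorem piOp_mul_mulLeft (p : ℂ) (f : Pol N) :
    piOp p * LinearMap.mulLeft ℂ f = LinearMap.mulLeft ℂ (piOp p f) * piOp p := by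
  refine LinearMap.ext fun F => ?_
  simp [piOp]

theorem piOp_mul_varOp_last (p : ℂ) :
    piOp p * varOp N 0 = p • (varOp N (N - 1) * piOp p) := by
  have hN := NeZero.pos N
  have h0 : (0 - 1 : Fin N) = ⟨N - 1, by omega⟩ := by
    rw [sub_eq_iff_eq_add]
    apply Fin.ext
    rw [Fin.val_add, Fin.val_one']
    simp [Nat.sub_add_cancel hN]
  have : piOp p (X (Fin.ofNat N 0) : Pol N) = p • X (Fin.ofNat N (N - 1)) := by
    rw [ofNat_of_lt (by omega : N - 1 < N), ← h0]
    simp [piOp, smul_eq_C_mul]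
  rw [varOp, piOp_mul_mulLeft, this, varOp, ← smul_mul_assoc]
  congr 1
  exact map_smul (LinearMap.mul ℂ (Pol N)) p _

theorem piOp_mul_varOp_succ (p : ℂ) {i : ℕ} (h : i + 1 < N) :
    piOp p * varOp N (i + 1) = varOp N i * piOp p := by
  have h1 : (⟨i + 1, h⟩ : Fin N) - 1 = ⟨i, (Nat.lt_succ_self i).trans h⟩ := by
    rw [← fin_mk_add_one h, add_sub_cancel_right]
  have h2 : (⟨i + 1, h⟩ : Fin N) ≠ 0 := by simp [Fin.ext_iff]
  rw [varOp, varOp, piOp_mul_mulLeft, ofNat_of_lt h, ofNat_of_lt ((Nat.lt_succ_self i).trans h),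
    ← h1]
  simp [piOp, h2]

/-- The operator that shifts the indices of the `Y_i`. -/
def shiftOp (N : ℕ) [NeZero N] (q : ℂ) : Module.End ℂ (Pol N) :=
  downProd (heckeT N q) 0 (N - 1) * varOp N 0

theorem downProd_mul_varOp_mul_upProd {q : ℂ} (hq : q ≠ 0) {k : ℕ} (hk : k < N) :
    downProd (heckeT N q) 0 k * varOp N 0 * upProd (heckeT N q) 0 k = varOp N k := by
  induction k with
  | zero => simp [downProd_zero, upProd_zero]
  | succ k ih =>
    rw [downProd_succ, upProd_succ, zero_add, ← heckeT_mul_varOp_mul_heckeT hq hk,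
      ← ih (by omega)]
    noncomm_ring

theorem shiftOp_mul_natY_succ {q p : ℂ} (hq : q ≠ 0) (hp : p ≠ 0) {i : ℕ} (hi : i < N - 1) :
    shiftOp N q * natY N q p (i + 1) = natY N q p i * shiftOp N q := by
  refine (affineRel_heckeT hq hp).downProd_mul_affineY_succ (x' := varOp N 1)
    (fun k hk hk' => commute_varOp_zero_heckeT q hk (by omega))
    (fun h => heckeT_mul_varOp_mul_heckeT hq (by omega)) (piOp_mul_varOp_succ p (by omega)) hi

/-- Telescoping with `T_i z_i T_i = z_{i+1}` turns `w Y_0` into `z_{N-1} π`, while the inverse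
generators in `Y_{N-1}` cancel against `w` to leave `π z_0`. These differ by the factor `p` acquired
around the end. -/
theorem shiftOp_mul_natY_zero {q p : ℂ} (hq : q ≠ 0) (hp : p ≠ 0) :
    shiftOp N q * natY N q p 0 = p⁻¹ • (natY N q p (N - 1) * shiftOp N q) := by
  have h := affineRel_heckeT (N := N) hq hp
  have e1 : shiftOp N q * natY N q p 0 = varOp N (N - 1) * piOp p := by
    rw [← downProd_mul_varOp_mul_upProd hq (Nat.sub_lt (NeZero.pos N) one_pos)]
    simp [shiftOp, natY, affineY, upProd_zero, mul_assoc]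
  have e2 : natY N q p (N - 1) * shiftOp N q = piOp p * varOp N 0 := by
    have := upProd_mul_downProd (T := heckeTInv N q) (Ti := heckeT N q) (a := 0) (n := N - 1)
      fun k _ hk => h.inv_mul k (by omega)
    simp only [natY, affineY, Nat.sub_self, upProd_zero, one_mul, shiftOp]
    rw [mul_assoc, ← mul_assoc (upProd _ _ _), this, one_mul]
  rw [e1, e2, piOp_mul_varOp_last, smul_smul, inv_mul_cancel₀ hp, one_smul]

theorem esymmOp_Y_eq (q p : ℂ) (r : ℕ) :
    esymmOp (Y (N := N) q p) r = (esymmGen (natY N q p) 0 N).coeff r := by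
  rw [← esymmOp_eq_coeff]
  exact congrArg (fun y => esymmOp y r) (funext (Y_eq_natY q p))

theorem commute_natY {q p : ℂ} (hq : q ≠ 0) (hp : p ≠ 0) {i j : ℕ} (hi : i < N) (hj : j < N) :
    Commute (natY N q p i) (natY N q p j) :=
  (affineRel_heckeT hq hp).commute_affineY (by omega) (by omega)

theorem shiftOp_mul_esymmOp_sub {q p : ℂ} (hq : q ≠ 0) (hp : p ≠ 0) (r : ℕ) :
    shiftOp N q * esymmOp (Y q p) r - esymmOp (Y q p) r * shiftOp N q
      = (p⁻¹ - 1) • (lastPart (natY N q p) (N - 1) r * shiftOp N q) := by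
  have hN : N - 1 + 1 = N := Nat.sub_add_cancel (NeZero.pos N)
  rw [esymmOp_Y_eq]
  have := mul_esymmGen_sub (shiftOp_mul_natY_zero (N := N) hq hp)
    (fun i hi => shiftOp_mul_natY_succ hq hp hi)
    (fun i hi => commute_natY hq hp (by omega) (by omega)) r
  rwa [hN] at this

theorem downProd_mul_eq_zero {q : ℂ} (hq : q ≠ 0) {O : Module.End ℂ (Pol N)}
    (h : downProd (heckeT N q) 0 (N - 1) * O = 0) : O = 0 := by
  have hr := affineRel_heckeT (N := N) hq (one_ne_zero (α := ℂ))
  have := upProd_mul_downProd (T := heckeTInv N q) (Ti := heckeT N q) (a := 0) (n := N - 1)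
      fun k _ hk => hr.inv_mul k (by omega)
  rw [← one_mul O, ← this, mul_assoc, h, mul_zero]

/-- The product of Hecke generators in the shift operator is invertible and can be stripped off,
leaving the first variable; the cross relation then yields the others. -/
theorem commute_varOp_of_commute_shiftOp {q : ℂ} (hq : q ≠ 0) {O : Module.End ℂ (Pol N)}
    (hT : ∀ i, i + 1 < N → Commute O (heckeT N q i)) (hO : Commute O (shiftOp N q)) {i : ℕ}
    (hi : i < N) : Commute O (varOp N i) := by
  induction i with
  | zero =>
    have hd : Commute O (downProd (heckeT N q) 0 (N - 1)) :=
      commute_downProd fun k _ hk => hT k (by omega)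
    have : downProd (heckeT N q) 0 (N - 1) * (O * varOp N 0 - varOp N 0 * O) = 0 := by
      rw [mul_sub, ← mul_assoc, ← mul_assoc, ← hd.eq, mul_assoc, ← shiftOp, hO.eq, sub_self]
    exact sub_eq_zero.1 (downProd_mul_eq_zero hq this)
  | succ i ih =>
    rw [← heckeT_mul_varOp_mul_heckeT hq hi]
    exact ((hT i hi).mul_right (ih (by omega))).mul_right (hT i hi)

/-- An operator that commutes with all multiplications is a multiplication. -/
theorem eq_mulLeft_of_commute {O : Module.End ℂ (Pol N)}
    (h : ∀ i < N, Commute O (varOp N i)) : O = LinearMap.mulLeft ℂ (O 1) := by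
  refine LinearMap.ext fun F => ?_
  have hX : ∀ (j : Fin N) F, O (X j * F) = X j * O F := fun j F => by
    have := DFunLike.congr_fun (h j j.2).eq F
    rw [varOp, ofNat_of_lt j.2] at this
    exact this
  induction F using MvPolynomial.induction_on with
  | C a =>
    rw [← mul_one (C a), ← smul_eq_C_mul, map_smul, LinearMap.mulLeft_apply, mul_smul_comm, mul_one]
  | add F G hF hG => rw [map_add, hF, hG, map_add]
  | mul_X F j hF =>
    rw [mul_comm F, hX, hF, LinearMap.mulLeft_apply, LinearMap.mulLeft_apply]; ring

/-- At `p = 1` the defect of commutation with the shift operator vanishes, so the operator commutes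
with all variables and is multiplication by its value on `1`. On constants the `Y_i` act by the
balanced powers of `q`, whose elementary symmetric functions are the Gaussian binomials. -/
theorem esymmOp_Y_one {q : ℂ} (hq : q ≠ 0) (r : ℕ) :
    esymmOp (Y (N := N) q 1) r = qBinom q N r • 1 := by
  have hc : Commute (esymmOp (Y (N := N) q 1) r) (shiftOp N q) := by
    have := shiftOp_mul_esymmOp_sub (N := N) hq one_ne_zero r
    rw [inv_one, sub_self, zero_smul, sub_eq_zero] at this
    exact this.symm
  have hm := eq_mulLeft_of_commute fun i hi => commute_varOp_of_commute_shiftOp hq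
    (fun i hi => (commute_heckeT_esymmOp hq one_ne_zero hi r).symm) hc hi
  have hT : ∀ i, i + 1 < N → heckeT N q i 1 = q • 1 := fun i hi => by
    rw [heckeT_of_lt q hi]; exact Tpol_apply_of_swapVars_eq q (by simp) (by simp)
  have hTi : ∀ i, i + 1 < N → heckeTInv N q i 1 = q⁻¹ • 1 := fun i hi => by
    have := DFunLike.congr_fun ((affineRel_heckeT (N := N) hq one_ne_zero).inv_mul i (by omega))
      (1 : Pol N)
    rw [Module.End.mul_apply, hT i hi, map_smul, Module.End.one_apply] at this
    rw [← this, smul_smul, inv_mul_cancel₀ hq, one_smul, this]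
  have hup : ∀ (L : ℕ → Module.End ℂ (Pol N)) (c : ℂ) (a m : ℕ),
      (∀ i, a ≤ i → i < a + m → L i 1 = c • 1) → upProd L a m 1 = c ^ m • 1 := by
    intro L c a m h
    induction m with
    | zero => simp [upProd_zero]
    | succ m ih =>
      rw [upProd_succ, Module.End.mul_apply, h _ (by omega) (by omega), map_smul,
        ih fun i h1 h2 => h i h1 (by omega), smul_smul, pow_succ']
  have hY : ∀ i < N, natY N q 1 i 1 = q ^ ((N : ℤ) - 1 - 2 * i) • (1 : Pol N) := fun i hi => by
    have e : q ^ ((N : ℤ) - 1 - 2 * i) = q⁻¹ ^ i * q ^ (N - 1 - i) := by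
      rw [inv_pow, ← zpow_natCast, ← zpow_natCast, ← zpow_neg, ← zpow_add₀ hq]
      congr 1; omega
    rw [natY, affineY, Module.End.mul_apply, Module.End.mul_apply,
      hup _ q⁻¹ 0 i fun k _ hk => hTi k (by omega), map_smul, map_smul,
      show piOp 1 (1 : Pol N) = 1 by simp [piOp], hup _ q i _ fun k _ hk => hT k (by omega),
      smul_smul, e]
  have hgen : ∀ m ≤ N, ∀ r, (esymmGen (natY N q 1) 0 m).coeff r 1
      = (esymmGen (fun k => q ^ ((N : ℤ) - 1 - 2 * k)) 0 m).coeff r • (1 : Pol N) := by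
    intro m hm
    induction m with
    | zero =>
      intro r
      rw [esymmGen, upProd_zero, esymmGen, upProd_zero, Polynomial.coeff_one,
        Polynomial.coeff_one]
      split_ifs <;> simp
    | succ m ih =>
      intro r
      rcases r with _ | r
      · simp [coeff_zero_esymmGen]
      · rw [coeff_esymmGen_succ, coeff_esymmGen_succ, LinearMap.add_apply, Module.End.mul_apply,
          zero_add, hY m (by omega), map_smul, ih (by omega), ih (by omega), smul_smul, add_smul,
          mul_comm]
  have h1 : esymmOp (Y (N := N) q 1) r 1 = qBinom q N r • 1 := by
    rw [esymmOp_Y_eq, hgen N le_rfl, coeff_esymmGen_eq_qBinom hq]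
  rw [hm, h1]
  refine LinearMap.ext fun F => ?_
  simp

end Macdonald

/-! ### The derivative of the Macdonald operators at `p = 1` -/

section Derivative

open MvPolynomial Filter Topology

variable {N : ℕ} [NeZero N]

/-- The derivative at `p = 1` of `e_r(Y_1, …, Y_N)`. -/
def esymmDeriv (N : ℕ) [NeZero N] (q : ℂ) (r : ℕ) : Module.End ℂ (Pol N) :=
  (expandable_esymmOp N q r).choose_spec.choose

theorem hasExpansion_esymmOp {q : ℂ} (hq : q ≠ 0) (r : ℕ) :
    HasExpansion (fun p => esymmOp (Y (N := N) q p) r) (qBinom q N r • 1) (esymmDeriv N q r) := by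
  have h : HasExpansion _ _ (esymmDeriv N q r) := (expandable_esymmOp N q r).choose_spec.choose_spec
  rwa [← h.eq_value, esymmOp_Y_one hq] at h

theorem commute_heckeT_esymmDeriv {q : ℂ} (hq : q ≠ 0) (r : ℕ) {i : ℕ} (hi : i + 1 < N) :
    Commute (heckeT N q i) (esymmDeriv N q r) :=
  (hasExpansion_esymmOp hq r).commute_deriv fun _ hp => commute_heckeT_esymmOp hq hp hi r

theorem commute_scaleOp_esymmDeriv {q : ℂ} (hq : q ≠ 0) (r : ℕ) {c : ℂ} (hc : c ≠ 0) :
    Commute (scaleOp N c) (esymmDeriv N q r) :=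
  (hasExpansion_esymmOp hq r).commute_deriv fun p _ =>
    commute_esymmOp_of_forall (fun i => commute_scaleOp_Y q p hc i) r

/-- Differentiating the commutation of `D_r` with `Y_i` also produces the derivative of `Y_i`, but
that term is multiplied by the scalar value of `D_r` and cancels. -/
theorem commute_esymmDeriv_Y {q : ℂ} (hq : q ≠ 0) (r : ℕ) (i : Fin N) :
    Commute (esymmDeriv N q r) (Y q 1 i) := by
  obtain ⟨Y₀, Y₁, hY⟩ := expandable_natY N q i
  have hD := hasExpansion_esymmOp (N := N) hq r
  have h := (hD.mul hY).deriv_unique (hY.mul hD) ((eventually_ne_nhds one_ne_zero).mono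
    fun p hp => by rw [← Y_eq_natY]; exact (commute_esymmOp_Y hq hp r i).eq)
  have e : Y₀ = Y q 1 i := by rw [Y_eq_natY, hY.eq_value]
  rw [smul_mul_assoc, one_mul, mul_smul_comm, mul_one, add_comm (_ • Y₁), add_comm] at h
  rw [Commute, SemiconjBy, ← e]
  exact add_left_cancel (h.trans (add_comm _ _))

theorem expandable_lastPart (N : ℕ) [NeZero N] (q : ℂ) (r : ℕ) :
    Expandable fun p => lastPart (natY N q p) (N - 1) r := by
  rcases r with _ | r
  · exact Expandable.const _
  · exact (expandable_natY N q _).mul (Expandable.coeff_esymmGen (expandable_natY N q) 0 _ r)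

theorem esymmDeriv_mul_shiftOp_sub {q : ℂ} (hq : q ≠ 0) (r : ℕ) :
    esymmDeriv N q r * shiftOp N q - shiftOp N q * esymmDeriv N q r
      = lastPart (natY N q 1) (N - 1) r * shiftOp N q := by
  obtain ⟨Q₀, Q₁, hQ⟩ := expandable_lastPart N q r
  have e : lastPart (natY N q 1) (N - 1) r = Q₀ := hQ.eq_value
  have hD := hasExpansion_esymmOp (N := N) hq r
  have hw := HasExpansion.const (shiftOp N q)
  have hp := HasExpansion.pow (Pol N) 1
  -- The identity is multiplied by `p` before differentiating, so that both sides are polynomial in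
  -- `p`.
  have h := ((hp.mul (hw.mul hD)).add (hp.mul (hQ.mul hw))).deriv_unique
    ((hp.mul (hD.mul hw)).add (hQ.mul hw)) ((eventually_ne_nhds one_ne_zero).mono
    fun p hp => by
      have := congrArg (fun O => p • O) (shiftOp_mul_esymmOp_sub (N := N) hq hp r)
      simp only [smul_sub, smul_smul, mul_sub, mul_inv_cancel₀ hp, mul_one, sub_smul,
        one_smul] at this
      simp only [pow_one, smul_mul_assoc, one_mul]
      rw [sub_eq_sub_iff_add_eq_add] at this
      rw [this, add_comm])
  simp only [Nat.cast_one, one_smul, one_mul, mul_zero, add_zero, zero_add, smul_zero,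
    smul_mul_assoc, mul_smul_comm, mul_one] at h
  rw [e, sub_eq_iff_eq_add]
  have h2 : shiftOp N q * esymmDeriv N q r + Q₀ * shiftOp N q = esymmDeriv N q r * shiftOp N q := by
    refine add_left_cancel (a := qBinom q N r • shiftOp N q + Q₁ * shiftOp N q) ?_
    convert h using 1 <;> abel
  rw [← h2, add_comm]

theorem commute_mulLeft_heckeT (q : ℂ) {f : Pol N} (hf : f.IsSymmetric) {i : ℕ}
    (hi : i + 1 < N) : Commute (LinearMap.mulLeft ℂ f) (heckeT N q i) := by
  rw [heckeT_of_lt q hi]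
  exact (Tpol_mul_mulLeft q (by simp) (hf _)).symm

theorem commute_mulLeft_natY {q : ℂ} (hq : q ≠ 0) {f : Pol N} (hf : f.IsSymmetric) {i : ℕ}
    (hi : i < N) : Commute (LinearMap.mulLeft ℂ f) (natY N q 1 i) := by
  have hr := affineRel_heckeT (N := N) hq (one_ne_zero (α := ℂ))
  have hpi : piOp 1 f = f := by
    refine MvPolynomial.funext fun z => ?_
    rw [eval_piOp, shiftPoint_one, ← eval_rename, hf]
  refine ((commute_upProd fun k _ hk => commute_mulLeft_heckeT q hf (by omega)).mul_right ?_).mul_right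
    (commute_upProd fun k _ hk => hr.commute_inv (by omega) (commute_mulLeft_heckeT q hf (by omega)))
  rw [Commute, SemiconjBy, piOp_mul_mulLeft, hpi]

omit [NeZero N] in
theorem commute_mulLeft_mulLeft (f g : Pol N) :
    Commute (LinearMap.mulLeft ℂ f) (LinearMap.mulLeft ℂ g) :=
  LinearMap.ext fun F => mul_left_comm f g F

/-- For the first variable the commutator is, up to the invertible product of Hecke generators, the
last part of `e_r(Y)` at `p = 1` times the shift operator; all of these commute with symmetric
polynomials. Conjugation by the Hecke generators gives the other variables. -/
theorem commute_mulLeft_esymmDeriv_mul_varOp_sub {q : ℂ} (hq : q ≠ 0) (r : ℕ) {f : Pol N}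
    (hf : f.IsSymmetric) {i : ℕ} (hi : i < N) :
    Commute (LinearMap.mulLeft ℂ f)
      (esymmDeriv N q r * varOp N i - varOp N i * esymmDeriv N q r) := by
  induction i with
  | zero =>
    set E := esymmDeriv N q r
    set d := downProd (heckeT N q) 0 (N - 1) with hd
    set m := LinearMap.mulLeft ℂ f
    have h1 : Commute m d := commute_downProd fun k _ hk => commute_mulLeft_heckeT q hf (by omega)
    have h2 : Commute d E := (commute_downProd (x := E) fun k _ hk =>
      (commute_heckeT_esymmDeriv hq r (by omega)).symm).symm
    have h3 : Commute m (lastPart (natY N q 1) (N - 1) r) := commute_lastPart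
      (fun k hk => commute_mulLeft_natY hq hf (by have := NeZero.pos N; omega)) r
    have h4 : Commute m (varOp N 0) := commute_mulLeft_mulLeft _ _
    have h5 : d * (E * varOp N 0 - varOp N 0 * E)
        = lastPart (natY N q 1) (N - 1) r * (d * varOp N 0) := by
      have := esymmDeriv_mul_shiftOp_sub (N := N) hq r
      rw [shiftOp, ← hd] at this
      rw [← this, mul_sub, ← mul_assoc, h2.eq]
      simp only [mul_assoc]
      rfl
    have h6 : Commute m (d * (E * varOp N 0 - varOp N 0 * E)) := by
      rw [h5]; exact h3.mul_right (h1.mul_right h4)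
    refine sub_eq_zero.1 (downProd_mul_eq_zero hq ?_)
    rw [mul_sub, ← hd, ← mul_assoc, ← mul_assoc, ← h1.eq, mul_assoc, h6.eq, sub_self]
  | succ i ih =>
    have h1 := commute_mulLeft_heckeT q hf hi
    have h2 := commute_heckeT_esymmDeriv (N := N) hq r hi
    have e : esymmDeriv N q r * varOp N (i + 1) - varOp N (i + 1) * esymmDeriv N q r
        = heckeT N q i * (esymmDeriv N q r * varOp N i - varOp N i * esymmDeriv N q r)
          * heckeT N q i := by
      rw [← heckeT_mul_varOp_mul_heckeT hq hi]
      calc _ = (esymmDeriv N q r * heckeT N q i) * varOp N i * heckeT N q i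
            - heckeT N q i * varOp N i * (heckeT N q i * esymmDeriv N q r) := by simp only [mul_assoc]
        _ = _ := by rw [← h2.eq]; nth_rw 2 [h2.eq]; simp only [mul_sub, sub_mul, mul_assoc]
    rw [e]
    exact (h1.mul_right (ih (by omega))).mul_right h1

/-- The commutator of the linearised Macdonald operator and a symmetric polynomial is a
multiplication operator. -/
theorem esymmDeriv_mul {q : ℂ} (hq : q ≠ 0) (r : ℕ) {f : Pol N} (hf : f.IsSymmetric) (F : Pol N) :
    esymmDeriv N q r (f * F) = f * esymmDeriv N q r F
      + (esymmDeriv N q r f - f * esymmDeriv N q r 1) * F := by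
  set E := esymmDeriv N q r with hE
  set m := LinearMap.mulLeft ℂ f with hm
  -- By the Jacobi identity: `f` commutes with each variable, so the commutator of `[E, f]` with
  -- `z_i` is that of `[E, z_i]` with `f`, which vanishes.
  have h := eq_mulLeft_of_commute (O := E * m - m * E) fun i hi => by
    have h1 := commute_mulLeft_esymmDeriv_mul_varOp_sub hq r hf hi
    rw [← hm, ← hE] at h1
    have h2 : m * varOp N i = varOp N i * m := commute_mulLeft_mulLeft _ _
    rw [Commute, SemiconjBy] at h1 ⊢
    rw [← sub_eq_zero] at h1 ⊢
    have e : (E * m - m * E) * varOp N i - varOp N i * (E * m - m * E)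
        = E * (m * varOp N i) - (varOp N i * E) * m - m * (E * varOp N i) + (varOp N i * m) * E := by
      simp only [mul_sub, sub_mul, mul_assoc]; abel
    have e' : m * (E * varOp N i - varOp N i * E) - (E * varOp N i - varOp N i * E) * m
        = m * (E * varOp N i) - (m * varOp N i) * E - E * (varOp N i * m) + varOp N i * E * m := by
      simp only [mul_sub, sub_mul, mul_assoc]; abel
    rw [e, h2]
    rw [e', h2] at h1
    rw [← neg_eq_zero, ← h1]
    abel
  have h1 := DFunLike.congr_fun h F
  simp only [LinearMap.sub_apply, Module.End.mul_apply, hm, LinearMap.mulLeft_apply, mul_one] at h1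
  rw [← h1]; ring

theorem eval_comp_perm_of_heckeT {q : ℂ} (hq : q ≠ 0) {g : Pol N}
    (hg : ∀ i, i + 1 < N → heckeT N q i g = q • g) {z : Fin N → ℂ} (hz : IsAdmissible q z)
    (σ : Equiv.Perm (Fin N)) : eval (z ∘ σ) g = eval z g := by
  induction σ using perm_induction_adjacent with
  | h1 => rfl
  | h σ i j hij hP =>
    have hj := j.2
    have hz' := hz.comp σ
    have h1 := hg i (by omega)
    rw [heckeT_of_lt q (by omega), show (⟨i + 1, by omega⟩ : Fin N) = j from Fin.ext hij.symm] at h1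
    rw [← hP, ← eval_swap_of_Tpol_apply hq h1 (hz'.apply_ne fun e => by
      have := congrArg Fin.val e; simp only at this; omega) (hz'.ne _ _)]
    rfl

/-- The multiplier `g` takes equal values on the orbit of the evaluation point, because it is a
`q`-eigenvector of the `T_i`. Scaling by `ω` permutes that orbit but multiplies `g` by `ω ^ k`,
which is not `1`. -/
theorem eval_esymmDeriv_esymm_sub {q : ℂ} (hq : q ≠ 0) (hN : q ^ (2 * N) ≠ 1) (r : ℕ) {k : ℕ}
    (hk : 0 < k) (hkN : k < N) :
    eval (evPoint N) (esymmDeriv N q r (esymm (Fin N) ℂ k)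
      - esymm (Fin N) ℂ k * esymmDeriv N q r 1) = 0 := by
  set f := esymm (Fin N) ℂ k with hf
  have hs : f.IsSymmetric := esymm_isSymmetric _ _ _
  set E := esymmDeriv N q r with hE
  set g := E f - f * E 1 with hg
  -- This serves twice: with `c = q`, `d = 1` for the Hecke generators, and with `c = 1`, `d = ω ^
  -- k` for the scaling.
  have hfO : ∀ O : Module.End ℂ (Pol N), ∀ c d : ℂ, O 1 = c • 1 → Commute O E →
      O * LinearMap.mulLeft ℂ f = d • (LinearMap.mulLeft ℂ f * O) → O g = (d * c) • g := by
    intro O c d h1 hc hO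
    have e1 : O f = (d * c) • f := by
      have := DFunLike.congr_fun hO (1 : Pol N)
      simp only [Module.End.mul_apply, LinearMap.mulLeft_apply, mul_one, LinearMap.smul_apply,
        h1] at this
      rw [this, mul_smul_comm, mul_one, smul_smul]
    have e2 : ∀ F, O (E F) = E (O F) := fun F => DFunLike.congr_fun hc.eq F
    have e3 : ∀ F, O (f * F) = d • (f * O F) := fun F => DFunLike.congr_fun hO F
    rw [hg, map_sub, e2, e1, map_smul, e3, e2, h1, map_smul, mul_smul_comm, smul_smul, smul_sub]
  have hT : ∀ i, i + 1 < N → heckeT N q i g = q • g := fun i hi => by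
    have := hfO (heckeT N q i) q 1 (by
      rw [heckeT_of_lt q hi]; exact Tpol_apply_of_swapVars_eq q (by simp) (by simp))
      (commute_heckeT_esymmDeriv hq r hi)
      (by rw [one_smul]; exact (commute_mulLeft_heckeT q hs hi).symm.eq)
    rwa [one_mul] at this
  have hscale : scaleOp N (omega N) f = omega N ^ k • f := by
    refine MvPolynomial.funext fun z => ?_
    rw [eval_scaleOp, smul_eval, hf, esymm, map_sum, map_sum, Finset.mul_sum]
    refine Finset.sum_congr rfl fun s hs => ?_
    rw [map_prod, map_prod]
    simp only [eval_X]
    rw [Finset.prod_mul_distrib, Finset.prod_const, (Finset.mem_powersetCard.1 hs).2]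
  have hS : scaleOp N (omega N) g = omega N ^ k • g := by
    have := hfO (scaleOp N (omega N)) 1 (omega N ^ k) (by simp [scaleOp])
      (commute_scaleOp_esymmDeriv hq r omega_ne_zero) (by
        refine LinearMap.ext fun F => ?_
        rw [Module.End.mul_apply, LinearMap.mulLeft_apply, LinearMap.smul_apply,
          Module.End.mul_apply, LinearMap.mulLeft_apply, ← smul_mul_assoc, ← hscale]
        simp [scaleOp])
    rwa [mul_one] at this
  have h1 := congrArg (eval (evPoint N)) hS
  have h2 : (fun j => omega N * evPoint N j) = evPoint N ∘ Equiv.addRight 1 :=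
    funext fun j => omega_mul_evPoint j
  rw [eval_scaleOp, h2, eval_comp_perm_of_heckeT hq hT (isAdmissible_evPoint hN), smul_eval] at h1
  have h3 : omega N ^ k ≠ 1 := (Complex.isPrimitiveRoot_exp N (NeZero.ne N)).pow_ne_one_of_pos_of_lt
    hk.ne' hkN
  have h4 : (omega N ^ k - 1) * eval (evPoint N) g = 0 := by rw [sub_mul, ← h1]; ring
  exact (mul_eq_zero.1 h4).resolve_left (sub_ne_zero.2 h3)

theorem natY_mul_mulLeft_prod_X {q p : ℂ} (hq : q ≠ 0) (hp : p ≠ 0) {i : ℕ} (hi : i < N) :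
    natY N q p i * LinearMap.mulLeft ℂ (∏ j, X j : Pol N)
      = p • (LinearMap.mulLeft ℂ (∏ j, X j : Pol N) * natY N q p i) := by
  have hr := affineRel_heckeT (N := N) hq hp
  set m := LinearMap.mulLeft ℂ (∏ j, X j : Pol N) with hm
  have hs : (∏ j, X j : Pol N).IsSymmetric := fun e => by
    rw [map_prod]
    simp only [rename_X]
    exact Equiv.prod_comp e fun j => (X j : Pol N)
  have h1 : Commute m (upProd (heckeT N q) i (N - 1 - i)) :=
    commute_upProd fun k _ hk => commute_mulLeft_heckeT q hs (by omega)
  have h2 : Commute m (upProd (heckeTInv N q) 0 i) :=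
    commute_upProd fun k _ hk => hr.commute_inv (by omega) (commute_mulLeft_heckeT q hs (by omega))
  have h3 : piOp p * m = p • (m * piOp p) := by
    have : piOp p (∏ j, X j : Pol N) = p • ∏ j, X j := by
      refine MvPolynomial.funext fun z => ?_
      rw [eval_piOp, smul_eval, map_prod, map_prod]
      simp only [eval_X]
      rw [← Equiv.prod_comp (Equiv.subRight (1 : Fin N)) z,
        ← Finset.mul_prod_erase _ _ (Finset.mem_univ (0 : Fin N)),
        ← Finset.mul_prod_erase _ (fun j => z (Equiv.subRight 1 j)) (Finset.mem_univ (0 : Fin N)),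
        ← mul_assoc]
      congr 1
      exact Finset.prod_congr rfl fun j hj => by simp [shiftPoint, (Finset.mem_erase.1 hj).1]
    rw [hm, piOp_mul_mulLeft, this, ← smul_mul_assoc]
    congr 1
    exact map_smul (LinearMap.mul ℂ (Pol N)) p _
  rw [natY, affineY, mul_assoc, ← h2.eq, ← mul_assoc, mul_assoc _ _ m, h3, mul_smul_comm,
    ← mul_assoc, ← h1.eq, smul_mul_assoc]
  simp only [mul_assoc]

theorem coeff_esymmGen_mul_of_smul {A : Type*} [Ring A] [Algebra ℂ A] {y : ℕ → A} {m : A} {p : ℂ}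
    {n : ℕ} (h : ∀ i < n, y i * m = p • (m * y i)) (r : ℕ) :
    (esymmGen y 0 n).coeff r * m = p ^ r • (m * (esymmGen y 0 n).coeff r) := by
  induction n generalizing r with
  | zero =>
    rw [esymmGen, upProd_zero, Polynomial.coeff_one]
    split_ifs with h <;> simp [h]
  | succ n ih =>
    have ih := ih fun k hk => h k (by omega)
    rcases r with _ | r
    · simp [coeff_zero_esymmGen]
    · rw [coeff_esymmGen_succ, zero_add, add_mul, ih, mul_assoc, h n (by omega), mul_smul_comm,
        ← mul_assoc, ih, mul_add, smul_add, smul_mul_assoc, smul_smul, pow_succ', mul_assoc]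

/-- Each `Y_i` picks up a factor `p` when it passes the product of all variables, so `e_r(Y)` picks
up `p ^ r`. Its derivative at `p = 1`, times the scalar value of `D_r`, is the extra term. -/
theorem esymmDeriv_mul_prod_X {q : ℂ} (hq : q ≠ 0) (r : ℕ) (F : Pol N) :
    esymmDeriv N q r ((∏ j, X j) * F)
      = (∏ j, X j) * esymmDeriv N q r F + (r * qBinom q N r) • ((∏ j, X j) * F) := by
  set m := LinearMap.mulLeft ℂ (∏ j, X j : Pol N) with hm
  have hD := hasExpansion_esymmOp (N := N) hq r
  have hc := HasExpansion.const m
  have h := (hD.mul hc).deriv_unique ((HasExpansion.pow (Pol N) r).mul (hc.mul hD))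
    ((eventually_ne_nhds one_ne_zero).mono fun p hp => by
      rw [smul_mul_assoc, one_mul, esymmOp_Y_eq, coeff_esymmGen_mul_of_smul (p := p)
        fun i hi => natY_mul_mulLeft_prod_X hq hp hi])
  simp only [mul_zero, add_zero, smul_zero, zero_add, one_mul, smul_mul_assoc, mul_smul_comm,
    mul_one, smul_smul] at h
  have h1 := DFunLike.congr_fun h F
  simp only [Module.End.mul_apply, LinearMap.add_apply, LinearMap.smul_apply, hm,
    LinearMap.mulLeft_apply] at h1
  rw [h1, add_comm, mul_comm (r : ℂ)]

end Derivative

/-! ### Functionals on which symmetric polynomials act by their values -/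

section OrbitFunctional

open MvPolynomial

variable {N : ℕ}

/-- A functional on which symmetric polynomials act by their values at a regular point vanishes on
the ideal of the orbit. -/
theorem apply_eq_zero_of_mem_orbitIdeal {z : Fin N → ℂ} (hz : Function.Injective z)
    {Λ : Pol N →ₗ[ℂ] ℂ} (hΛ : ∀ s : Pol N, s.IsSymmetric → ∀ F, Λ (s * F) = eval z s * Λ F)
    {F : Pol N} (hF : F ∈ orbitIdeal z) : Λ F = 0 := by
  rw [mem_orbitIdeal] at hF
  -- The symmetrisation of `b F` is symmetric and vanishes at `z`, so `Λ` kills all its multiples.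
  have htr : ∀ a b : Pol N, Λ (∑ g : Equiv.Perm (Fin N), a * rename g b * rename g F) = 0 := by
    intro a b
    have hs : (∑ g : Equiv.Perm (Fin N), rename g (b * F)).IsSymmetric := fun e => by
      rw [map_sum, ← Equiv.sum_comp (Equiv.mulLeft e) fun g : Equiv.Perm (Fin N) =>
        rename g (b * F)]
      exact Finset.sum_congr rfl fun g _ => by rw [rename_rename]; rfl
    have h0 : eval z (∑ g : Equiv.Perm (Fin N), rename g (b * F)) = 0 := by
      rw [map_sum]
      exact Finset.sum_eq_zero fun g _ => by rw [eval_rename, map_mul, hF, mul_zero]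
    have := hΛ _ hs a
    rw [h0, zero_mul, mul_comm, Finset.mul_sum] at this
    simpa only [map_mul, mul_assoc] using this
  -- Each linear factor is a difference of two sums of the previous kind: one variable is absorbed
  -- into `a`, the other, twisted by `g`, into `b`.
  have hprod : ∀ (t : Finset (Fin N × Fin N)) (a b : Pol N), Λ (∑ g : Equiv.Perm (Fin N),
      a * rename g b * (∏ x ∈ t, (X x.1 - X (g x.2))) * rename g F) = 0 := by
    intro t
    induction t using Finset.induction_on with
    | empty => simpa only [Finset.prod_empty, mul_one] using htr
    | insert x t hx ih =>
      intro a b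
      have h := congrArg₂ (· - ·) (ih (a * X x.1) b) (ih a (b * X x.2))
      simp only [sub_zero, ← map_sub, ← Finset.sum_sub_distrib] at h
      rw [← h]
      refine congrArg Λ (Finset.sum_congr rfl fun g _ => ?_)
      rw [Finset.prod_insert hx, map_mul, rename_X]
      ring
  -- With all off-diagonal pairs, any `g ≠ 1` moves some `j` and meets the vanishing factor of the
  -- pair `(g j, j)`. Only the identity remains; it contributes `F` times a symmetric polynomial
  -- that is nonzero at `z`.
  have h := hprod (Finset.univ : Finset (Fin N)).offDiag 1 1
  simp only [map_one, one_mul] at h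
  rw [Finset.sum_eq_single 1 (fun g _ hg => ?_) (fun h => absurd (Finset.mem_univ _) h)] at h
  · have h1 : rename (1 : Equiv.Perm (Fin N)) F = F := rename_id_apply F
    simp only [Equiv.Perm.one_apply] at h
    rw [h1, hΛ _ fun e => ?_] at h
    · refine (mul_eq_zero.1 h).resolve_left ?_
      rw [map_prod]
      refine Finset.prod_ne_zero_iff.2 ?_
      intro x hx
      rw [map_sub, eval_X, eval_X, sub_ne_zero]
      exact fun e => (Finset.mem_offDiag.1 hx).2.2 (hz e)
    · rw [map_prod]
      refine Finset.prod_equiv (e.prodCongr e) (fun x => by simp) fun x _ => by simp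
  · obtain ⟨j, hj⟩ : ∃ j, g j ≠ j := not_forall.1 fun h => hg (Equiv.ext h)
    rw [Finset.prod_eq_zero (i := (g j, j)) (by simpa using hj) (by simp), zero_mul]

theorem apply_mul_of_isSymmetric {z : Fin N → ℂ} {Λ : Pol N →ₗ[ℂ] ℂ}
    (h : ∀ k, 0 < k → k ≤ N → ∀ F, Λ (esymm (Fin N) ℂ k * F) = eval z (esymm (Fin N) ℂ k) * Λ F)
    {s : Pol N} (hs : s.IsSymmetric) (F : Pol N) : Λ (s * F) = eval z s * Λ F := by
  obtain ⟨P, hP₀⟩ := esymmAlgHom_surjective ℂ (σ := Fin N) (n := N) (by simp)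
    ⟨s, (mem_symmetricSubalgebra s).2 hs⟩
  have hP : (esymmAlgHom (Fin N) ℂ N P : Pol N) = s := congrArg Subtype.val hP₀
  rw [← hP]
  clear hP hP₀ hs
  induction P using MvPolynomial.induction_on generalizing F with
  | C a =>
    rw [show esymmAlgHom (Fin N) ℂ N (C a) = algebraMap ℂ _ a from AlgHom.commutes _ a]
    simp [← smul_eq_C_mul]
  | add P Q hP hQ => simp only [map_add, AddMemClass.coe_add, add_mul, hP, hQ]
  | mul_X P i hP =>
    simp only [map_mul, MulMemClass.coe_mul, mul_assoc, hP]
    rw [show (esymmAlgHom (Fin N) ℂ N (X i) : Pol N) = esymm (Fin N) ℂ (i + 1) by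
      simp [esymmAlgHom], h _ (Nat.succ_pos _) i.2]

end OrbitFunctional

/-! ### The spin-chain Hamiltonians -/

section Hamiltonian

open MvPolynomial

variable {N : ℕ} [NeZero N]

/-- The derivative at `p = 1` of `D_r - (r / N) [N choose r] D_N`. -/
def reducedDeriv (N : ℕ) [NeZero N] (q : ℂ) (r : ℕ) : Module.End ℂ (Pol N) :=
  esymmDeriv N q r - ((r / N : ℂ) * qBinom q N r) • esymmDeriv N q N

/-- It suffices to treat the elementary symmetric polynomials. Below degree `N` the multipliers
vanish at the evaluation point; in degree `N` the extra term of `D_r` is cancelled by `r / N` times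
that of `D_N`. -/
theorem eval_reducedDeriv_mul {q : ℂ} (hq : q ≠ 0) (hN : q ^ (2 * N) ≠ 1) (r : ℕ) {s : Pol N}
    (hs : s.IsSymmetric) (F : Pol N) : eval (evPoint N) (reducedDeriv N q r (s * F))
      = eval (evPoint N) s * eval (evPoint N) (reducedDeriv N q r F) := by
  refine apply_mul_of_isSymmetric
    (Λ := (aeval (evPoint N) : Pol N →ₐ[ℂ] ℂ).toLinearMap ∘ₗ reducedDeriv N q r)
    (fun k hk hkN F => ?_) hs F
  have h0 : (N : ℂ) ≠ 0 := Nat.cast_ne_zero.2 (NeZero.ne N)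
  change eval (evPoint N) _ = _ * eval (evPoint N) _
  simp only [reducedDeriv, LinearMap.sub_apply, LinearMap.smul_apply]
  rcases hkN.lt_or_eq with hlt | rfl
  · have h1 := eval_esymmDeriv_esymm_sub hq hN r hk hlt
    have h2 := eval_esymmDeriv_esymm_sub hq hN N hk hlt
    rw [esymmDeriv_mul hq r (esymm_isSymmetric _ _ _), esymmDeriv_mul hq N (esymm_isSymmetric _ _ _)]
    simp only [map_sub, map_add, map_mul, smul_eval] at h1 h2 ⊢
    rw [h1, h2]; ring
  · have e : esymm (Fin k) ℂ k = ∏ j, X j := by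
      have : Finset.powersetCard k (Finset.univ : Finset (Fin k)) = {Finset.univ} := by
        simpa using Finset.powersetCard_self (Finset.univ : Finset (Fin k))
      rw [esymm, this, Finset.sum_singleton]
    rw [e, esymmDeriv_mul_prod_X hq, esymmDeriv_mul_prod_X hq, qBinom_self]
    simp only [map_sub, map_add, map_mul, smul_eval]
    field_simp
    ring

omit [NeZero N] in
theorem hasDerivAt_ev {A : ℂ → Module.End ℂ (Pol N)} {A₀ A₁ : Module.End ℂ (Pol N)}
    (h : HasExpansion A A₀ A₁) (Ψ : BigSpace N) :
    HasDerivAt (fun p => ev N (polAct (A p) Ψ)) (ev N (polAct A₁ Ψ)) 1 :=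
  hasDerivAt_pi.2 fun σ => h.hasDerivAt (aeval (evPoint N) : Pol N →ₐ[ℂ] ℂ).toLinearMap (Ψ σ)

theorem hasDerivAt_ev_spinMacdonald {q : ℂ} (hq : q ≠ 0) (r : ℕ) (Ψ : BigSpace N) :
    HasDerivAt (fun p : ℂ => ev N (spinMacdonald q p r Ψ - ((r / N : ℂ) * qBinom q N r) •
      spinMacdonald q p N Ψ)) (ev N (polActHom (reducedDeriv N q r) Ψ)) 1 := by
  have h1 := hasDerivAt_ev (hasExpansion_esymmOp (N := N) hq r) Ψ
  have h2 := hasDerivAt_ev (hasExpansion_esymmOp (N := N) hq N) Ψ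
  simp only [map_sub, map_smul]
  refine (h1.sub (h2.const_smul ((r / N : ℂ) * qBinom q N r))).congr_deriv ?_
  rw [← map_smul, ← map_sub]
  rfl

theorem commute_reducedDeriv_Y {q : ℂ} (hq : q ≠ 0) (r : ℕ) (i : Fin N) :
    Commute (reducedDeriv N q r) (Y q 1 i) :=
  (commute_esymmDeriv_Y hq r i).sub_left ((commute_esymmDeriv_Y hq N i).smul_left _)

theorem commute_heckeT_reducedDeriv {q : ℂ} (hq : q ≠ 0) (r : ℕ) {i : ℕ} (hi : i + 1 < N) :
    Commute (heckeT N q i) (reducedDeriv N q r) :=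
  (commute_heckeT_esymmDeriv hq r hi).sub_right ((commute_heckeT_esymmDeriv hq N hi).smul_right _)

/-- If a physical vector evaluates to zero, its components lie in the ideal of the orbit, which the
evaluated reduced derivative annihilates; so this derivative factors through evaluation. It commutes
with the `Y_i` at `p = 1`, hence with the modes. -/
theorem exists_hamiltonian {q : ℂ} (hq : q ≠ 0) (hq₁ : q ≠ 1) (hq₂ : q ≠ -1)
    (hN : q ^ (2 * N) ≠ 1) {φ : QuantumLoop q →ₐ[ℂ] Module.End ℂ (SpinSpace N)}
    (hφ : ∀ ε n α β, ∀ Ψ ∈ physical N q,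
      φ (loopGen q ε n α β) (ev N Ψ) = ev N (mode q 1 ε n α β Ψ)) (r : ℕ) :
    ∃ H : Module.End ℂ (SpinSpace N), IsHamiltonian q r H ∧
      (∀ H', IsHamiltonian q r H' → H' = H) ∧ ∀ x : QuantumLoop q, Commute (φ x) H := by
  -- Needed to divide by `q - q⁻¹` in the definition of the Hamiltonian and in its uniqueness.
  have hκ : q - q⁻¹ ≠ 0 := by
    intro h
    have : (q - 1) * (q + 1) = 0 := by
      have := congrArg (q * ·) h
      simp only [mul_sub, mul_inv_cancel₀ hq, mul_zero] at this
      rw [← this]; ring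
    rcases mul_eq_zero.1 this with h | h
    · exact hq₁ (sub_eq_zero.1 h)
    · exact hq₂ (eq_neg_of_add_eq_zero_left h)
  have hs := physicalEv_surjective (N := N) hq hN
  let D : BigSpace N →ₗ[ℂ] SpinSpace N := ev N ∘ₗ polActHom (reducedDeriv N q r)
  obtain ⟨K, hK⟩ := exists_factor hs (D ∘ₗ (physical N q).subtype) fun Ψ hΨ => by
    funext σ
    change eval (evPoint N) (reducedDeriv N q r (Ψ.1 σ)) = 0
    refine apply_eq_zero_of_mem_orbitIdeal evPoint_injective
      (Λ := (aeval (evPoint N) : Pol N →ₐ[ℂ] ℂ).toLinearMap ∘ₗ reducedDeriv N q r)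
      (fun s hs F => eval_reducedDeriv_mul hq hN r hs F) (mem_orbitIdeal.2 fun g => ?_)
    rw [← evalAt_apply, evalAt_comp_perm_eq_zero hq Ψ.2 (isAdmissible_evPoint hN) hΨ g]
    rfl
  have hK : ∀ Ψ ∈ physical N q, K (ev N Ψ) = D Ψ := fun Ψ hΨ => hK ⟨Ψ, hΨ⟩
  have hder := hasDerivAt_ev_spinMacdonald (N := N) hq r
  refine ⟨(q - q⁻¹)⁻¹ • K, fun Ψ hΨ => ?_, fun H' hH' => ?_, fun x => ?_⟩
  · rw [LinearMap.smul_apply, smul_smul, mul_inv_cancel₀ hκ, one_smul, hK Ψ hΨ]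
    exact hder Ψ
  · refine LinearMap.ext fun v => ?_
    obtain ⟨⟨Ψ, hΨ⟩, rfl⟩ := hs v
    have h1 := (hH' Ψ hΨ).unique (hder Ψ)
    change H' (ev N Ψ) = (q - q⁻¹)⁻¹ • K (ev N Ψ)
    rw [hK Ψ hΨ]
    change _ = (q - q⁻¹)⁻¹ • ev N (polActHom (reducedDeriv N q r) Ψ)
    rw [← h1, smul_smul, inv_mul_cancel₀ hκ, one_smul]
  · refine Commute.smul_right (commute_spinMode_of_intertwines hq hN hφ (Λ := D) hK
      (fun ε n α β Ψ hΨ => ?_) x) _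
    have hc := (commute_polActHom_mode hq one_ne_zero (commute_reducedDeriv_Y (N := N) hq r) ε n α
      β).eq
    have hmem : polActHom (reducedDeriv N q r) Ψ ∈ physical N q :=
      polActHom_mem_physical (fun i hi => commute_heckeT_reducedDeriv hq r hi) hΨ
    rw [LinearMap.comp_apply, LinearMap.comp_apply, hφ _ _ _ _ _ hmem, ← Module.End.mul_apply, hc]
    rfl

end Hamiltonian

end SpinRuijsenaars

end

/-! ### The main theorem -/

theorem theorem3p3 (N : ℕ) [NeZero N] (q : ℂ) (hq₀ : q ≠ 0) (hq₁ : q ≠ 1) (hq₂ : q ≠ -1) :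
    -- the spin-Ruijsenaars model, for any value of the difference parameter
    (∀ p : ℂ, p ≠ 0 →
      -- the objects are well defined: the `Y_i` and the denominators `t u Y_i - 1` are invertible
      (∀ i : Fin N, IsUnit (SpinRuijsenaars.Y q p i)) ∧
      (∀ (ε : SpinRuijsenaars.Pt) (i : Fin N),
        IsUnit (SpinRuijsenaars.Rden q
          (SpinRuijsenaars.uNum _ ε * SpinRuijsenaars.Yser q p i) (SpinRuijsenaars.uDen _ ε))) ∧
      -- the monodromy matrix in terms of Hecke generators, times `Δ(-t u) = ∏ (1 - t u Y_i)`
      (∀ ε : SpinRuijsenaars.Pt,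
        ((List.finRange N).map fun i : Fin N => SpinRuijsenaars.uDen _ ε -
            q ^ 2 • (SpinRuijsenaars.uNum _ ε * SpinRuijsenaars.Yser q p i)).prod •
          SpinRuijsenaars.Ltilde (N := N) q p ε =
        (-q) ^ N • SpinRuijsenaars.heckeForm q (SpinRuijsenaars.Yser q p)
          (SpinRuijsenaars.uNum _ ε) (SpinRuijsenaars.uDen _ ε)) ∧
      -- the `RLL`-relations
      SpinRuijsenaars.SatisfiesRLL q (SpinRuijsenaars.mode (N := N) q p) ∧
      -- all operators preserve the physical space
      (∀ (ε : SpinRuijsenaars.Pt) (n : ℕ) (α β : Fin 2),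
        ∀ Ψ ∈ SpinRuijsenaars.physical N q,
          SpinRuijsenaars.mode q p ε n α β Ψ ∈ SpinRuijsenaars.physical N q) ∧
      (∀ r : ℕ, ∀ Ψ ∈ SpinRuijsenaars.physical N q,
        SpinRuijsenaars.spinMacdonald q p r Ψ ∈ SpinRuijsenaars.physical N q ∧
        SpinRuijsenaars.spinMacdonaldNeg q p r Ψ ∈ SpinRuijsenaars.physical N q) ∧
      -- the action of the quantum-loop algebra on the physical space, and the commutation with the
      -- spin-Macdonald operators
      ∃ φ : SpinRuijsenaars.QuantumLoop q →ₐ[ℂ] Module.End ℂ (SpinRuijsenaars.physical N q),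
        (∀ (ε : SpinRuijsenaars.Pt) (n : ℕ) (α β : Fin 2)
            (Ψ : SpinRuijsenaars.physical N q),
          (φ (SpinRuijsenaars.loopGen q ε n α β) Ψ : SpinRuijsenaars.BigSpace N) =
            SpinRuijsenaars.mode q p ε n α β Ψ) ∧
        (∀ (x : SpinRuijsenaars.QuantumLoop q) (r : ℕ) (Ψ Ψ' : SpinRuijsenaars.physical N q),
          ((Ψ' : SpinRuijsenaars.BigSpace N) = SpinRuijsenaars.spinMacdonald q p r Ψ →
            (φ x Ψ' : SpinRuijsenaars.BigSpace N) =
              SpinRuijsenaars.spinMacdonald q p r (φ x Ψ)) ∧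
          ((Ψ' : SpinRuijsenaars.BigSpace N) = SpinRuijsenaars.spinMacdonaldNeg q p r Ψ →
            (φ x Ψ' : SpinRuijsenaars.BigSpace N) =
              SpinRuijsenaars.spinMacdonaldNeg q p r (φ x Ψ)))) ∧
    -- the spin chain
    (q ^ (2 * N) ≠ 1 →
      -- every vector of the spin chain is the evaluation of a physical vector
      (∀ v : SpinRuijsenaars.SpinSpace N,
        ∃ Ψ ∈ SpinRuijsenaars.physical N q, SpinRuijsenaars.ev N Ψ = v) ∧
      -- the monodromy matrix at `p = 1` descends to the spin chain
      ∃ φ : SpinRuijsenaars.QuantumLoop q →ₐ[ℂ] Module.End ℂ (SpinRuijsenaars.SpinSpace N),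
        (∀ (ε : SpinRuijsenaars.Pt) (n : ℕ) (α β : Fin 2),
          ∀ Ψ ∈ SpinRuijsenaars.physical N q,
            φ (SpinRuijsenaars.loopGen q ε n α β) (SpinRuijsenaars.ev N Ψ) =
              SpinRuijsenaars.ev N (SpinRuijsenaars.mode q 1 ε n α β Ψ)) ∧
        SpinRuijsenaars.SatisfiesRLL q
          (fun ε n α β => φ (SpinRuijsenaars.loopGen q ε n α β)) ∧
        -- and commutes with the abelian symmetries `H_1, …, H_N` and `G`
        (∀ r : ℕ, 1 ≤ r → r ≤ N →
          ∃ H : Module.End ℂ (SpinRuijsenaars.SpinSpace N),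
            SpinRuijsenaars.IsHamiltonian q r H ∧
              (∀ H', SpinRuijsenaars.IsHamiltonian q r H' → H' = H) ∧
              ∀ x : SpinRuijsenaars.QuantumLoop q, Commute (φ x) H) ∧
        ∀ x : SpinRuijsenaars.QuantumLoop q, Commute (φ x) (SpinRuijsenaars.qTranslation N q)) := by
  open SpinRuijsenaars in
  refine ⟨fun p hp => ⟨isUnit_Y hq₀ hp, isUnit_Rden hq₀ hp, heckeForm_Ltilde hq₀ hp,
    satisfiesRLL_mode hq₀ hp, fun ε n α β Ψ hΨ => mode_mem_physical hq₀ hp ε n α β hΨ,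
    fun r Ψ hΨ => ⟨spinMacdonald_mem_physical hq₀ hp r hΨ,
      spinMacdonaldNeg_mem_physical hq₀ hp r hΨ⟩, ?_⟩, fun hN => ⟨fun v =>
      exists_mem_physical_evalAt hq₀ (isAdmissible_evPoint hN) v, ?_⟩⟩
  · obtain ⟨φ, hφ⟩ := (isLoopRep_physicalMode (N := N) hq₀ hp).exists_hom
    refine ⟨φ, fun ε n α β Ψ => by rw [hφ]; rfl, fun x r Ψ Ψ' => ⟨fun h => ?_, fun h => ?_⟩⟩
    · exact loopHom_apply_of_commute hq₀ hp hφ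
        (fun Φ hΦ => spinMacdonald_mem_physical hq₀ hp r hΦ)
        (commute_spinMacdonald_mode hq₀ hp r) x h
    · exact loopHom_apply_of_commute hq₀ hp hφ
        (fun Φ hΦ => spinMacdonaldNeg_mem_physical hq₀ hp r hΦ)
        (commute_spinMacdonaldNeg_mode hq₀ hp r) x h
  · obtain ⟨ℓ, hℓ, hev⟩ := exists_spinMode (N := N) hq₀ hN
    obtain ⟨φ, hφ⟩ := hℓ.exists_hom
    have hφev : ∀ ε n α β, ∀ Ψ ∈ physical N q,
        φ (loopGen q ε n α β) (ev N Ψ) = ev N (mode q 1 ε n α β Ψ) := by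
      intro ε n α β Ψ hΨ; rw [hφ, hev ε n α β Ψ hΨ]
    have hφℓ : (fun ε n α β => φ (loopGen q ε n α β)) = ℓ := by
      funext ε n α β; exact hφ ε n α β
    refine ⟨φ, hφev, by rw [hφℓ]; exact hℓ.rll, fun r _ hr => ?_, fun x =>
      commute_qTranslation hq₀ hN hφev x⟩
    exact exists_hamiltonian hq₀ hq₁ hq₂ hN hφev r
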